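/- Let $\mathbb T=\mathbb R/2\pi\mathbb Z$, and let $(\tau,m,n)\in\mathbb R\times\mathbb Z^2$ be the Fourier variables dual to $(t,x,y)\in\mathbb R\times\mathbb T^2$. Put $\langle x\rangle=(1+x^2)^{1/2}$ and, for $m\neq0$, $\omega(m,n)=m^5+\frac{n^2}{m}$ and $p(m,n)=\langle\langle m\rangle^{-2}\frac nm\rangle$. For $\sigma\ge2$ let $\mathbf E^\sigma$ be the space of real functions $f\in L^2(\mathbb T^2)$ with $\widehat f(0,n)=0$ for all $n\in\mathbb Z$ and $\|f\|_{\mathbf E^\sigma}=\|\langle m\rangle^\sigma p\,\widehat f\|_{\ell^2(\mathbb Z^2)}<\infty$, and let $\mathbf E^\infty=\bigcap_{\sigma\ge2}\mathbf E^\sigma$, with the topology of all these norms. For $M\in2^{\mathbb N}=\{1,2,4,\dots\}$ let $P_M$ be the Fourier multiplier with symbol $\mathbb 1_{\{5M/8\le|m|\le8M/5\}}$. Fix $\chi\in C_c^\infty(\mathbb R)$ with $0\le\chi\le1$, $\operatorname{supp}\chi\subset[-\frac85,\frac85]$ and $\chi=1$ on $[-\frac54,\frac54]$; let $\eta_1=\chi$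 and $\eta_K(x)=\chi(x/K)-\chi(2x/K)$ for $K\in2^{\mathbb N}$, $K>1$. Fix also a sign $\varepsilon\in\{1,-1\}$. For $v\in C(\mathbb R,\mathbf E^\infty)$ with $P_Mv=v$ let $$\|v\|_{F_M}=\sup_{t_0\in\mathbb R}\ \sum_{K\in2^{\mathbb N}}K^{1/2}\Big\|\eta_K(\tau+\varepsilon\omega)\,p\,\mathcal F\{\chi(M^2(t-t_0))v\}\Big\|_{L^2(\mathbb R\times\mathbb Z^2)},$$ where $\mathcal F$ is the Fourier transform in $(t,x,y)$ with kernel $e^{-i(t\tau+mx+ny)}$. For $T>0$ and $u\in C([-T,T],\mathbf E^\infty)$ let $\|P_Mu\|_{F_M(T)}$ be the infimum of $\|v\|_{F_M}$ over all $v\in C(\mathbb R,\mathbf E^\infty)$ with $P_Mv=v$ and $v=P_Mu$ on $[-T,T]$, and let $$\|u\|_{\mathbf F^\sigma(T)}=\Big(\sum_{M\in2^{\mathbb N}}M^{2\sigma}\|P_Mu\|_{F_M(T)}^2\Big)^{1/2},\qquad \|u\|_{\mathbf B^\sigma(T)}=\Big(\sum_{M\in2^{\mathbb N}}\sup_{t\in[-T,T]}\|P_Mu(t)\|_{\mathbf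 E^\sigma}^2\Big)^{1/2},$$ with values in $[0,\infty]$, and $\mathbf F(T)=\mathbf F^2(T)$. **Proposition.** There is $\mu_0>0$ such that for every $\sigma\ge2$ there is a constant $C>0$ with the following property: for each of the two signs $\varepsilon$, every $T\in(0,1)$ and every solution $u\in C([-T,T],\mathbf E^\infty)$ of $$\partial_tu-\partial_x^5u-\partial_x^{-1}\partial_y^2u+u\,\partial_xu=0\quad\text{on }[-T,T]\times\mathbb T^2$$ with initial value $u_0=u(0)$, $$\|u\|_{\mathbf B^\sigma(T)}^2\le C\Big(\|u_0\|_{\mathbf E^\sigma}^2+T^{\mu_0}\,\|u\|_{\mathbf F(T)}\,\|u\|_{\mathbf F^\sigma(T)}^2\Big).$$ -/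

import Mathlib

open MeasureTheory Filter Topology Set
open scoped ENNReal NNReal

namespace KPOneFifth

noncomputable section

/-- Real-valued square integrable functions on the two-dimensional torus `𝕋² = (ℝ / 2πℤ)²`.
A point of `𝕋²` is represented by its pair of angles `θ ∈ (ℝ / ℤ)²`, that is `(x, y) = 2π θ`, so that
the characters `exp (i (m x + n y))` are Mathlib's monomials `mFourier ![m, n]`. The measure is the normalized Haar measure, with respect
to which Mathlib's `mFourierCoeff` integrates. -/
abbrev L2Torus : Type :=
  Lp ℝ 2 (Measure.pi fun _ : Fin 2 => (AddCircle.haarAddCircle : Measure UnitAddCircle))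

/-- Frequencies `k = (m, n)`: `k 0 = m` is dual to `x` and `k 1 = n` is dual to `y`. -/
abbrev Freq : Type := Fin 2 → ℤ

/-- The Fourier coefficients `û(m, n)` of a real function on the torus. -/
def coeff (f : L2Torus) (k : Freq) : ℂ :=
  UnitAddTorus.mFourierCoeff (fun z => ((f z : ℝ) : ℂ)) k

/-- The Fourier coefficients of the pointwise product `f g` (an integrable function). -/
def coeffMul (f g : L2Torus) (k : Freq) : ℂ :=
  UnitAddTorus.mFourierCoeff (fun z => ((f z * g z : ℝ) : ℂ)) k

/-- `∂ₓ`, as a Fourier multiplier on families of Fourier coefficients. -/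
def dx (a : Freq → ℂ) (k : Freq) : ℂ := Complex.I * (k 0 : ℂ) * a k

/-- `∂_y`, as a Fourier multiplier. -/
def dy (a : Freq → ℂ) (k : Freq) : ℂ := Complex.I * (k 1 : ℂ) * a k

/-- `∂ₓ⁻¹`, as a Fourier multiplier; it is only used on families vanishing for `m = 0`. -/
def dxInv (a : Freq → ℂ) (k : Freq) : ℂ := (Complex.I * (k 0 : ℂ))⁻¹ * a k

/-- The Japanese bracket `⟨x⟩ = (1 + x²)^{1/2}`. -/
def bracket (x : ℝ) : ℝ := Real.sqrt (1 + x ^ 2)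

/-- The dispersion relation `ω(m, n) = m⁵ + n² / m` (used for `m ≠ 0`). -/
def omega (k : Freq) : ℝ := (k 0 : ℝ) ^ 5 + (k 1 : ℝ) ^ 2 / (k 0 : ℝ)

/-- The weight `p(m, n) = ⟨ ⟨m⟩⁻² n / m ⟩` (used for `m ≠ 0`). -/
def weight (k : Freq) : ℝ := bracket ((bracket (k 0 : ℝ) ^ 2)⁻¹ * ((k 1 : ℝ) / (k 0 : ℝ)))

/-- The norm `‖ ⟨m⟩^σ p(m,n) û(m,n) ‖` of `ℓ²(ℤ²)`, with values in `[0, ∞]`,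
in terms of the Fourier coefficients. -/
def energyNorm (σ : ℝ) (a : Freq → ℂ) : ℝ≥0∞ :=
  (∑' k : Freq, (ENNReal.ofReal (bracket (k 0 : ℝ) ^ σ * weight k) * ‖a k‖ₑ) ^ 2) ^ (1 / 2 : ℝ)

/-- The space `E^σ`: square integrable functions with `û(0, n) = 0` for all `n` and finite norm. -/
def energySpace (σ : ℝ) : Set L2Torus :=
  {f | (∀ k : Freq, k 0 = 0 → coeff f k = 0) ∧ energyNorm σ (coeff f) < ⊤}

/-- The space `E^∞ = ⋂_{σ ≥ 2} E^σ`. -/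
def energySpaceInf : Set L2Torus := ⋂ σ ∈ Ici (2 : ℝ), energySpace σ

/-- `u ∈ C(S, E^∞)`, where `E^∞` carries the topology of all the norms of the `E^σ`, `σ ≥ 2`. -/
def ContinuousInto (S : Set ℝ) (u : ℝ → L2Torus) : Prop :=
  (∀ t ∈ S, u t ∈ energySpaceInf) ∧
    ∀ σ : ℝ, 2 ≤ σ → ∀ t₀ ∈ S,
      Tendsto (fun t => energyNorm σ (coeff (u t - u t₀))) (𝓝[S] t₀) (𝓝 0)

/-- `u` solves `∂ₜu - ∂ₓ⁵u - ∂ₓ⁻¹∂_y²u + u ∂ₓu = 0` on `[-T, T] × 𝕋²`, in the sense of distributions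
in space: the equation holds for each Fourier coefficient. Here `w` is the function `∂ₓ u(t)`. -/
def IsSolution (T : ℝ) (u : ℝ → L2Torus) : Prop :=
  ∀ t ∈ Icc (-T) T, ∃ w : L2Torus, coeff w = dx (coeff (u t)) ∧
    ∀ k : Freq, HasDerivWithinAt (fun s => coeff (u s) k)
      (dx^[5] (coeff (u t)) k + dxInv (dy^[2] (coeff (u t))) k - coeffMul (u t) w k)
      (Icc (-T) T) t

/-- The frequency set `I_M = {5M/8 ≤ |m| ≤ 8M/5}` for `M = 2^j`. -/
def freqBlock (j : ℕ) : Set ℤ :=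
  {m | 5 / 8 * (2 : ℝ) ^ j ≤ |(m : ℝ)| ∧ |(m : ℝ)| ≤ 8 / 5 * (2 : ℝ) ^ j}

/-- The projector `P_M`, `M = 2^j`, that is the Fourier multiplier with symbol `𝟙_{I_M}(m)`. -/
def proj (j : ℕ) (a : Freq → ℂ) : Freq → ℂ := {k : Freq | k 0 ∈ freqBlock j}.indicator a

/-- The admissible cutoff functions `χ`. -/
structure IsCutoff (χ : ℝ → ℝ) : Prop where
  smooth : ContDiff ℝ (⊤ : ℕ∞) χ
  nonneg : ∀ x, 0 ≤ χ x
  le_one : ∀ x, χ x ≤ 1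
  supp : tsupport χ ⊆ Icc (-(8 / 5)) (8 / 5)
  eq_one : ∀ x ∈ Icc (-(5 / 4) : ℝ) (5 / 4), χ x = 1

/-- The dyadic partition of unity: `η₁ = χ` and `η_K(x) = χ(x/K) - χ(2x/K)` for `K = 2^l > 1`. -/
def eta (χ : ℝ → ℝ) (l : ℕ) (x : ℝ) : ℝ :=
  if l = 0 then χ x else χ (x / 2 ^ l) - χ (2 * x / 2 ^ l)

/-- The Fourier transform in time, `ĝ(τ) = ∫ e^{-itτ} g(t) dt`. -/
def timeFourier (g : ℝ → ℂ) (τ : ℝ) : ℂ :=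
  ∫ t : ℝ, Complex.exp (-(Complex.I * (t : ℂ) * (τ : ℂ))) * g t

/-- The norm `∑_K K^{1/2} ‖η_K(τ + ε ω(m,n)) f(τ,m,n)‖` (norms of `L²(ℝ × ℤ²)`, sum over the dyadic
`K = 2^l ≥ 1`) of the spaces `X_M`. -/
def xNorm (χ : ℝ → ℝ) (ε : ℝ) (f : ℝ → Freq → ℂ) : ℝ≥0∞ :=
  ∑' l : ℕ, (2 : ℝ≥0∞) ^ ((l : ℝ) / 2) *
    (∑' k : Freq, ∫⁻ τ : ℝ, (‖(eta χ l (τ + ε * omega k) : ℂ) * f τ k‖ₑ) ^ 2) ^ (1 / 2 : ℝ)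

/-- The norm of `F_M`, `M = 2^j`: the supremum over `t₀ ∈ ℝ` of the norms in `X_M` of
`p · 𝓕 {χ(M² (t - t₀)) v}`, with `𝓕` the Fourier transform in `(t, x, y)`. -/
def shortNorm (χ : ℝ → ℝ) (ε : ℝ) (j : ℕ) (v : ℝ → L2Torus) : ℝ≥0∞ :=
  ⨆ t₀ : ℝ, xNorm χ ε (fun τ k => (weight k : ℂ) *
    timeFourier (fun t => (χ (((2 : ℝ) ^ j) ^ 2 * (t - t₀)) : ℂ) * coeff (v t) k) τ)

/-- The norm `‖P_M u‖_{F_M(T)}`, `M = 2^j`: the infimum of the norms in `F_M` of all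
`v ∈ C(ℝ, E^∞)` with `P_M v = v` that coincide with `P_M u` on `[-T, T]`. -/
def shortNormOn (χ : ℝ → ℝ) (ε : ℝ) (j : ℕ) (T : ℝ) (u : ℝ → L2Torus) : ℝ≥0∞ :=
  ⨅ (v : ℝ → L2Torus) (_ : ContinuousInto univ v)
    (_ : ∀ t, proj j (coeff (v t)) = coeff (v t))
    (_ : ∀ t ∈ Icc (-T) T, coeff (v t) = proj j (coeff (u t))), shortNorm χ ε j v

/-- The norm of `F^σ(T)`, `(∑_M M^{2σ} ‖P_M u‖²_{F_M(T)})^{1/2}`; `F(T)` is the case `σ = 2`. -/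
def solutionNorm (χ : ℝ → ℝ) (ε : ℝ) (σ T : ℝ) (u : ℝ → L2Torus) : ℝ≥0∞ :=
  (∑' j : ℕ, ((2 : ℝ≥0∞) ^ j) ^ (2 * σ) * shortNormOn χ ε j T u ^ 2) ^ (1 / 2 : ℝ)

/-- The norm of `B^σ(T)`, `(∑_M sup_{t ∈ [-T,T]} ‖P_M u(t)‖²_{E^σ})^{1/2}`. -/
def energyTypeNorm (σ T : ℝ) (u : ℝ → L2Torus) : ℝ≥0∞ :=
  (∑' j : ℕ, ⨆ t ∈ Icc (-T) T, energyNorm σ (proj j (coeff (u t))) ^ 2) ^ (1 / 2 : ℝ)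

end

end KPOneFifth

open MeasureTheory Filter Topology Set
open scoped ENNReal NNReal

namespace KPOneFifth

noncomputable section

/-! For M = 2^j consider the energy Σ_k w_j(k) |û(t,k)|² with w_j = `enWeight σ j`. It controls the
squared E^σ norm of P_M u, and its sum over j is controlled by that of u. Since ω is odd and u is
real, the dispersive terms drop out of its time derivative. The nonlinearity leaves a sum over k₁ +
k₂ + k₃ = 0 of time integrals of û û û (`tripInt`), and symmetrization in the three frequencies
replaces its multiplier by `symbol` (`FourierFlow.energy_le`). The function w_j(k) m is an odd
Lipschitz function of m times a polynomial in n, so the contributions of the two high frequencies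
nearly cancel. By `abs_symbol_le` essentially only a derivative at the lowest frequency remains.

Let a ≤ b be the smallest and the largest dyadic size in a triple. The interval [0, t] is cut into
b² windows of length at most b⁻². There the functions may be replaced by localized extensions and
written by Fourier inversion as superpositions of oscillations. Over a window of length δ the
integral of exp(itΦ) is at most a constant times δ^{1/4} (b² + |Φ|)^{-3/4}
(`enorm_integral_exp_le`), where Φ is the sum of the three modulations minus ε times the resonance
function.

The resonance function is m₁m₂m₃ times a difference of two positive terms (`resonance_eq`). Off the
set `resSet` it is at least of size a b⁴. Then either one modulation is large, which the X_M norm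
rewards, or the kernel is small (`modForm_le_split`), and summability in n comes from the weights p
(`triForm_symBound_le`). On `resSet` the resonance function moves by at least a multiple of b²
whenever n₁ moves by one, so the kernel itself is summable in n₁ (`tsum_resonant_le`). In both cases
a window costs (a/b)^{3/2} δ^{1/4} (`tsum_modForm_le`). The b² windows add up to T^{1/4} a^{3/2}
(`tsum_tripInt_le`), whence μ₀ = 1/4.

Finally a^{3/2} = a^{-1/2} a² is summed by Cauchy–Schwarz against the F norm. The two largest sizes
are comparable and give the square of the F^σ norm (`tsum_cubicBound_le`). -/

/-! ### Square roots, ℓ² norms and Cauchy–Schwarz in [0, ∞] -/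

/-- The `ℓ²` norm of a family of extended nonnegative reals. -/
def l2 {ι : Type*} (a : ι → ℝ≥0∞) : ℝ≥0∞ := (∑' k, a k ^ 2) ^ (1 / 2 : ℝ)

lemma rpow_half_sq (x : ℝ≥0∞) : (x ^ (1 / 2 : ℝ)) ^ 2 = x := by
  rw [← ENNReal.rpow_natCast, ← ENNReal.rpow_mul]; norm_num

lemma sq_rpow_half (x : ℝ≥0∞) : (x ^ 2) ^ (1 / 2 : ℝ) = x := by
  rw [← ENNReal.rpow_natCast, ← ENNReal.rpow_mul]; norm_num

lemma mul_rpow_half (x y : ℝ≥0∞) :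
    (x * y) ^ (1 / 2 : ℝ) = x ^ (1 / 2 : ℝ) * y ^ (1 / 2 : ℝ) :=
  ENNReal.mul_rpow_of_nonneg _ _ (by norm_num)

lemma rpow_half_mono {x y : ℝ≥0∞} (h : x ≤ y) : x ^ (1 / 2 : ℝ) ≤ y ^ (1 / 2 : ℝ) :=
  ENNReal.rpow_le_rpow h (by norm_num)

lemma rpow_half_le_iff {x y : ℝ≥0∞} : x ^ (1 / 2 : ℝ) ≤ y ↔ x ≤ y ^ 2 := by
  constructor
  · intro h
    calc x = (x ^ (1 / 2 : ℝ)) ^ 2 := (rpow_half_sq x).symm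
      _ ≤ y ^ 2 := by gcongr
  · intro h
    calc x ^ (1 / 2 : ℝ) ≤ (y ^ 2) ^ (1 / 2 : ℝ) := rpow_half_mono h
      _ = y := sq_rpow_half y

lemma l2_sq {ι : Type*} (a : ι → ℝ≥0∞) : l2 a ^ 2 = ∑' k, a k ^ 2 := rpow_half_sq _

lemma l2_mono {ι : Type*} {a b : ι → ℝ≥0∞} (h : ∀ k, a k ≤ b k) : l2 a ≤ l2 b :=
  rpow_half_mono (ENNReal.tsum_le_tsum fun k => by gcongr; exact h k)

lemma l2_const_mul {ι : Type*} (c : ℝ≥0∞) (a : ι → ℝ≥0∞) : l2 (fun k => c * a k) = c * l2 a := by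
  simp only [l2, mul_pow, ENNReal.tsum_mul_left, mul_rpow_half, sq_rpow_half]

lemma le_l2 {ι : Type*} (a : ι → ℝ≥0∞) (k : ι) : a k ≤ l2 a := by
  rw [← sq_rpow_half (a k)]
  exact rpow_half_mono (ENNReal.le_tsum (f := fun k => a k ^ 2) k)

lemma lintegral_mul_le_sqrt {α : Type*} [MeasurableSpace α] (μ : Measure α) {f g : α → ℝ≥0∞}
    (hf : AEMeasurable f μ) (hg : AEMeasurable g μ) :
    ∫⁻ x, f x * g x ∂μ ≤ (∫⁻ x, f x ^ 2 ∂μ) ^ (1 / 2 : ℝ) * (∫⁻ x, g x ^ 2 ∂μ) ^ (1 / 2 : ℝ) := by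
  have := ENNReal.lintegral_mul_le_Lp_mul_Lq μ Real.HolderConjugate.two_two hf hg
  simpa only [Pi.mul_apply, ENNReal.rpow_two] using this

lemma tsum_mul_le_l2 {ι : Type*} (f g : ι → ℝ≥0∞) : ∑' k, f k * g k ≤ l2 f * l2 g := by
  -- With the discrete σ-algebra and counting measure, sums are integrals and measurability is
  -- automatic.
  let _ : MeasurableSpace ι := ⊤
  have := lintegral_mul_le_sqrt (Measure.count : Measure ι) (f := f) (g := g)
    (measurable_from_top).aemeasurable (measurable_from_top).aemeasurable
  simpa only [lintegral_count, l2] using this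

lemma tsum_sq_le_sq_tsum {ι : Type*} (a : ι → ℝ≥0∞) : ∑' k, a k ^ 2 ≤ (∑' k, a k) ^ 2 := by
  rw [sq, ← ENNReal.tsum_mul_right]
  refine ENNReal.tsum_le_tsum fun k => ?_
  rw [sq]
  gcongr
  exact ENNReal.le_tsum k

/-- Minkowski's integral inequality for the `ℓ²` norm. -/
lemma l2_lintegral_le {ι : Type*} [Countable ι] {g : ℝ → ι → ℝ≥0∞}
    (hg : ∀ k, Measurable fun s => g s k) :
    l2 (fun k => ∫⁻ s, g s k) ≤ ∫⁻ s, l2 (g s) := by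
  rw [l2, rpow_half_le_iff]
  have hm : Measurable fun s => l2 (g s) := by
    unfold l2
    exact (Measurable.tsum fun k => (hg k).pow_const 2).pow_const _
  -- The square is opened into a double integral, so that Cauchy–Schwarz in k applies at each fixed
  -- pair (s, s').
  calc ∑' k, (∫⁻ s, g s k) ^ 2
      = ∑' k, ∫⁻ s, ∫⁻ s', g s k * g s' k := by
        congr 1; ext k
        rw [sq, ← lintegral_mul_const _ (hg k)]
        congr 1; ext s
        rw [lintegral_const_mul _ (hg k)]
    _ = ∫⁻ s, ∑' k, ∫⁻ s', g s k * g s' k := by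
        rw [lintegral_tsum]
        intro k
        simp_rw [lintegral_const_mul _ (hg k)]
        exact ((hg k).mul_const _).aemeasurable
    _ = ∫⁻ s, ∫⁻ s', ∑' k, g s k * g s' k := by
        congr 1; ext s
        rw [lintegral_tsum]
        intro k
        exact ((hg k).const_mul _).aemeasurable
    _ ≤ ∫⁻ s, ∫⁻ s', l2 (g s) * l2 (g s') := by
        gcongr with s s'
        exact tsum_mul_le_l2 _ _
    _ = (∫⁻ s, l2 (g s)) ^ 2 := by
        rw [sq, ← lintegral_mul_const _ hm]
        congr 1; ext s
        rw [lintegral_const_mul _ hm]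

/-! ### Trilinear forms on zero-sum frequencies and Schur's test -/

/-- The positive trilinear form with kernel `c`, restricted to `k₁ + k₂ + k₃ = 0`. -/
def triForm (c : Freq → Freq → ℝ≥0∞) (g₁ g₂ g₃ : Freq → ℝ≥0∞) : ℝ≥0∞ :=
  ∑' k₁, ∑' k₂, c k₁ k₂ * (g₁ k₁ * g₂ k₂ * g₃ (-k₁ - k₂))

lemma triForm_add (c c' : Freq → Freq → ℝ≥0∞) (g₁ g₂ g₃ : Freq → ℝ≥0∞) :
    triForm (fun k₁ k₂ => c k₁ k₂ + c' k₁ k₂) g₁ g₂ g₃ =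
      triForm c g₁ g₂ g₃ + triForm c' g₁ g₂ g₃ := by
  simp only [triForm, add_mul, ENNReal.tsum_add]

lemma triForm_const_mul (a : ℝ≥0∞) (c : Freq → Freq → ℝ≥0∞) (g₁ g₂ g₃ : Freq → ℝ≥0∞) :
    triForm (fun k₁ k₂ => a * c k₁ k₂) g₁ g₂ g₃ = a * triForm c g₁ g₂ g₃ := by
  simp only [triForm, mul_assoc, ENNReal.tsum_mul_left]

lemma triForm_swap (c : Freq → Freq → ℝ≥0∞) (g₁ g₂ g₃ : Freq → ℝ≥0∞) :
    triForm c g₁ g₂ g₃ = triForm (fun k₁ k₂ => c k₂ k₁) g₂ g₁ g₃ := by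
  unfold triForm
  rw [ENNReal.tsum_comm]
  refine tsum_congr fun k₁ => tsum_congr fun k₂ => ?_
  rw [show -k₂ - k₁ = -k₁ - k₂ by abel, mul_comm (g₁ k₂)]

/-- The involution `k₂ ↦ -k₁ - k₂`. -/
def thirdEquiv (k₁ : Freq) : Freq ≃ Freq where
  toFun k₂ := -k₁ - k₂
  invFun k₂ := -k₁ - k₂
  left_inv k₂ := by simp
  right_inv k₂ := by simp

lemma triForm_swap_right (c : Freq → Freq → ℝ≥0∞) (g₁ g₂ g₃ : Freq → ℝ≥0∞) :
    triForm c g₁ g₂ g₃ = triForm (fun k₁ k₂ => c k₁ (-k₁ - k₂)) g₁ g₃ g₂ := by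
  unfold triForm
  refine tsum_congr fun k₁ => ?_
  rw [← (thirdEquiv k₁).tsum_eq]
  refine tsum_congr fun k₂ => ?_
  simp only [thirdEquiv, Equiv.coe_fn_mk]
  rw [show -k₁ - (-k₁ - k₂) = k₂ by abel]
  ring

/-- Schur's test for the trilinear form, with `k₂` frozen. -/
lemma triForm_le {c : Freq → Freq → ℝ≥0∞} {B : ℝ≥0∞} (hB : ∀ k₂, ∑' k₁, c k₁ k₂ ^ 2 ≤ B)
    (g₁ g₂ g₃ : Freq → ℝ≥0∞) :
    triForm c g₁ g₂ g₃ ≤ B ^ (1 / 2 : ℝ) * (l2 g₁ * l2 g₂ * l2 g₃) := by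
  -- The kernel is grouped with g₂, so that its square is summed over k₁ alone; g₁ g₃ has a
  -- factorized ℓ² norm because k₂ ↦ -k₁ - k₂ is a bijection.
  have h1 : triForm c g₁ g₂ g₃ =
      ∑' p : Freq × Freq, (c p.1 p.2 * g₂ p.2) * (g₁ p.1 * g₃ (-p.1 - p.2)) := by
    rw [ENNReal.tsum_prod']
    refine tsum_congr fun k₁ => tsum_congr fun k₂ => by ring
  rw [h1]
  refine (tsum_mul_le_l2 _ _).trans ?_
  have h2 : l2 (fun p : Freq × Freq => c p.1 p.2 * g₂ p.2) ≤ B ^ (1 / 2 : ℝ) * l2 g₂ := by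
    rw [l2, l2, ← mul_rpow_half]
    refine rpow_half_mono ?_
    rw [ENNReal.tsum_prod', ENNReal.tsum_comm, ← ENNReal.tsum_mul_left]
    refine ENNReal.tsum_le_tsum fun k₂ => ?_
    simp only [mul_pow, ENNReal.tsum_mul_right]
    gcongr
    exact hB k₂
  have h3 : l2 (fun p : Freq × Freq => g₁ p.1 * g₃ (-p.1 - p.2)) = l2 g₁ * l2 g₃ := by
    simp only [l2]
    rw [← mul_rpow_half, ENNReal.tsum_prod', ← ENNReal.tsum_mul_right]
    congr 1
    refine tsum_congr fun k₁ => ?_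
    simp only [mul_pow, ENNReal.tsum_mul_left]
    congr 1
    exact (thirdEquiv k₁).tsum_eq (fun k => g₃ k ^ 2)
  rw [h3]
  calc _ ≤ B ^ (1 / 2 : ℝ) * l2 g₂ * (l2 g₁ * l2 g₃) := by gcongr
    _ = _ := by ring

/-- Schur's test for the trilinear form, with `k₃` frozen. -/
lemma triForm_le' {c : Freq → Freq → ℝ≥0∞} {B : ℝ≥0∞}
    (hB : ∀ k₃, ∑' k₁, c k₁ (-k₁ - k₃) ^ 2 ≤ B) (g₁ g₂ g₃ : Freq → ℝ≥0∞) :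
    triForm c g₁ g₂ g₃ ≤ B ^ (1 / 2 : ℝ) * (l2 g₁ * l2 g₂ * l2 g₃) := by
  rw [triForm_swap_right]
  refine (triForm_le hB _ _ _).trans_eq ?_
  ring

/-! ### Convolution forms in the modulation variables -/

/-- The trilinear convolution form in the modulation variables. -/
def modForm (κ : ℝ → ℝ≥0∞) (c : ℝ) (f₁ f₂ f₃ : ℝ → ℝ≥0∞) : ℝ≥0∞ :=
  ∫⁻ s₁, ∫⁻ s₂, ∫⁻ s₃, f₁ s₁ * f₂ s₂ * f₃ s₃ * κ (s₁ + s₂ + s₃ + c)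

lemma modForm_swap_right {κ : ℝ → ℝ≥0∞} (hκ : Measurable κ) (c : ℝ) {f₁ f₂ f₃ : ℝ → ℝ≥0∞}
    (h₂ : Measurable f₂) (h₃ : Measurable f₃) :
    modForm κ c f₁ f₂ f₃ = modForm κ c f₁ f₃ f₂ := by
  unfold modForm
  refine lintegral_congr fun s₁ => ?_
  rw [lintegral_lintegral_swap (by fun_prop)]
  refine lintegral_congr fun s₂ => lintegral_congr fun s₃ => ?_
  rw [add_right_comm s₁]; ring

lemma modForm_swap {κ : ℝ → ℝ≥0∞} (hκ : Measurable κ) (c : ℝ) {f₁ f₂ f₃ : ℝ → ℝ≥0∞}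
    (h₁ : Measurable f₁) (h₂ : Measurable f₂) (h₃ : Measurable f₃) :
    modForm κ c f₁ f₂ f₃ = modForm κ c f₂ f₁ f₃ := by
  unfold modForm
  rw [lintegral_lintegral_swap]
  · refine lintegral_congr fun s₁ => lintegral_congr fun s₂ => lintegral_congr fun s₃ => ?_
    rw [add_comm s₁]; ring
  · refine Measurable.aemeasurable ?_
    refine Measurable.lintegral_prod_right' (f := fun z : (ℝ × ℝ) × ℝ =>
      f₁ z.1.1 * f₂ z.1.2 * f₃ z.2 * κ (z.1.1 + z.1.2 + z.2 + c)) ?_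
    fun_prop

lemma modForm_le_const {κ : ℝ → ℝ≥0∞} (c : ℝ) {f₁ f₂ f₃ : ℝ → ℝ≥0∞}
    (h₁ : Measurable f₁) (h₂ : Measurable f₂) (h₃ : Measurable f₃)
    {κ₀ : ℝ≥0∞} (h : ∀ x, κ x ≤ κ₀) :
    modForm κ c f₁ f₂ f₃ ≤ κ₀ * ((∫⁻ s, f₁ s) * (∫⁻ s, f₂ s) * (∫⁻ s, f₃ s)) := by
  calc modForm κ c f₁ f₂ f₃ ≤ ∫⁻ s₁, ∫⁻ s₂, ∫⁻ s₃, f₁ s₁ * f₂ s₂ * f₃ s₃ * κ₀ := by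
        unfold modForm; gcongr; apply h
    _ = _ := by
        have e1 : ∀ s₁ s₂, ∫⁻ s₃, f₁ s₁ * f₂ s₂ * f₃ s₃ * κ₀ =
            f₁ s₁ * (f₂ s₂ * ((∫⁻ s, f₃ s) * κ₀)) := fun s₁ s₂ => by
          rw [lintegral_mul_const _ (by fun_prop), lintegral_const_mul _ h₃]; ring
        simp_rw [e1]
        have e2 : ∀ s₁, ∫⁻ s₂, f₁ s₁ * (f₂ s₂ * ((∫⁻ s, f₃ s) * κ₀)) =
            f₁ s₁ * ((∫⁻ s, f₂ s) * ((∫⁻ s, f₃ s) * κ₀)) := fun s₁ => by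
          rw [lintegral_const_mul _ (by fun_prop), lintegral_mul_const _ h₂]
        simp_rw [e2]
        rw [lintegral_mul_const _ h₁]; ring

/-- Cauchy–Schwarz is used in s₃ only: by translation invariance the L² norm of the kernel no longer
depends on s₁, s₂, and these are integrated in L¹. -/
lemma modForm_le_sqrt {κ : ℝ → ℝ≥0∞} (hκ : Measurable κ) (c : ℝ) {f₁ f₂ f₃ : ℝ → ℝ≥0∞}
    (h₁ : Measurable f₁) (h₂ : Measurable f₂) (h₃ : Measurable f₃) :
    modForm κ c f₁ f₂ f₃ ≤ (∫⁻ x, κ x ^ 2) ^ (1 / 2 : ℝ) *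
    ((∫⁻ s, f₁ s) * (∫⁻ s, f₂ s) * (∫⁻ s, f₃ s ^ 2) ^ (1 / 2 : ℝ)) := by
  have e : ∀ s₁ s₂, ∫⁻ s₃, f₁ s₁ * f₂ s₂ * f₃ s₃ * κ (s₁ + s₂ + s₃ + c) ≤ f₁ s₁ *
      (f₂ s₂ * ((∫⁻ s, f₃ s ^ 2) ^ (1 / 2 : ℝ) * (∫⁻ x, κ x ^ 2) ^ (1 / 2 : ℝ))) := by
    intro s₁ s₂
    simp_rw [mul_assoc]
    rw [lintegral_const_mul _ (by fun_prop), lintegral_const_mul _ (by fun_prop)]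
    gcongr
    refine (lintegral_mul_le_sqrt volume h₃.aemeasurable (by fun_prop)).trans_eq ?_
    congr 2
    have := lintegral_add_right_eq_self (μ := volume) (fun x => κ x ^ 2) (s₁ + s₂ + c)
    rw [← this]
    refine lintegral_congr fun s => ?_
    congr 2; ring
  calc modForm κ c f₁ f₂ f₃ ≤ ∫⁻ s₁, ∫⁻ s₂, f₁ s₁ *
      (f₂ s₂ * ((∫⁻ s, f₃ s ^ 2) ^ (1 / 2 : ℝ) * (∫⁻ x, κ x ^ 2) ^ (1 / 2 : ℝ))) := by
        unfold modForm; gcongr; apply e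
    _ = _ := by
        have e2 : ∀ s₁, ∫⁻ s₂, f₁ s₁ *
            (f₂ s₂ * ((∫⁻ s, f₃ s ^ 2) ^ (1 / 2 : ℝ) * (∫⁻ x, κ x ^ 2) ^ (1 / 2 : ℝ))) =
            f₁ s₁ * ((∫⁻ s, f₂ s) *
              ((∫⁻ s, f₃ s ^ 2) ^ (1 / 2 : ℝ) * (∫⁻ x, κ x ^ 2) ^ (1 / 2 : ℝ))) := fun s₁ => by
          rw [lintegral_const_mul _ (by fun_prop), lintegral_mul_const _ h₂]
        simp_rw [e2]
        rw [lintegral_mul_const _ h₁]; ring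

/-- The nonresonant splitting: if `|c| ≥ 6 L`, one of the modulations exceeds `L`, or the kernel is
evaluated at distance at least `3 L` from the origin. -/
lemma modForm_le_split {κ : ℝ → ℝ≥0∞} (hκ : Measurable κ) (c : ℝ) {f₁ f₂ f₃ : ℝ → ℝ≥0∞}
    (h₁ : Measurable f₁) (h₂ : Measurable f₂) (h₃ : Measurable f₃)
    {L : ℝ} {κ₀ : ℝ≥0∞} (hc : 6 * L ≤ |c|)
    (h : ∀ x, 3 * L ≤ |x| → κ x ≤ κ₀) :
    modForm κ c f₁ f₂ f₃ ≤ κ₀ * ((∫⁻ s, f₁ s) * (∫⁻ s, f₂ s) * (∫⁻ s, f₃ s)) +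
      (∫⁻ x, κ x ^ 2) ^ (1 / 2 : ℝ) *
        ((∫⁻ s in {s | L ≤ |s|}, f₁ s ^ 2) ^ (1 / 2 : ℝ) * (∫⁻ s, f₂ s) * (∫⁻ s, f₃ s) +
         (∫⁻ s, f₁ s) * (∫⁻ s in {s | L ≤ |s|}, f₂ s ^ 2) ^ (1 / 2 : ℝ) * (∫⁻ s, f₃ s) +
         (∫⁻ s, f₁ s) * (∫⁻ s, f₂ s) * (∫⁻ s in {s | L ≤ |s|}, f₃ s ^ 2) ^ (1 / 2 : ℝ)) := by
  set S : Set ℝ := {s | L ≤ |s|} with hS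
  have hSm : MeasurableSet S := measurableSet_le measurable_const (by fun_prop)
  have hsq : ∀ f : ℝ → ℝ≥0∞, ∫⁻ s in S, f s ^ 2 = ∫⁻ s, (S.indicator f s) ^ 2 := by
    intro f
    rw [← lintegral_indicator hSm]
    refine lintegral_congr fun s => ?_
    by_cases hs : s ∈ S <;> simp [hs]
  -- If all three modulations are below L, the argument of κ is at distance at least 6L - 3L from 0,
  -- and truncating κ at κ₀ changes nothing.
  have key : ∀ s₁ s₂ s₃, f₁ s₁ * f₂ s₂ * f₃ s₃ * κ (s₁ + s₂ + s₃ + c) ≤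
      f₁ s₁ * f₂ s₂ * f₃ s₃ * min κ₀ (κ (s₁ + s₂ + s₃ + c)) +
      (S.indicator f₁ s₁ * f₂ s₂ * f₃ s₃ * κ (s₁ + s₂ + s₃ + c) +
       (f₁ s₁ * S.indicator f₂ s₂ * f₃ s₃ * κ (s₁ + s₂ + s₃ + c) +
       f₁ s₁ * f₂ s₂ * S.indicator f₃ s₃ * κ (s₁ + s₂ + s₃ + c))) := by
    intro s₁ s₂ s₃
    by_cases a1 : s₁ ∈ S
    · rw [indicator_of_mem a1]
      exact le_add_left (le_add_right le_rfl)
    by_cases a2 : s₂ ∈ S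
    · rw [indicator_of_mem a2]
      exact le_add_left (le_add_left (le_add_right le_rfl))
    by_cases a3 : s₃ ∈ S
    · rw [indicator_of_mem a3]
      exact le_add_left (le_add_left (le_add_left le_rfl))
    simp only [hS, mem_ofPred_eq, not_le] at a1 a2 a3
    have hb : 3 * L ≤ |s₁ + s₂ + s₃ + c| := by
      rcases abs_cases s₁ with ⟨_, _⟩ | ⟨_, _⟩ <;> rcases abs_cases s₂ with ⟨_, _⟩ | ⟨_, _⟩ <;>
      rcases abs_cases s₃ with ⟨_, _⟩ | ⟨_, _⟩ <;> rcases abs_cases c with ⟨_, _⟩ | ⟨_, _⟩ <;>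
      rcases abs_cases (s₁ + s₂ + s₃ + c) with ⟨_, _⟩ | ⟨_, _⟩ <;> linarith
    refine le_add_right ?_
    rw [min_eq_right (h _ hb)]
  have i1 : Measurable (S.indicator f₁) := h₁.indicator hSm
  have i2 : Measurable (S.indicator f₂) := h₂.indicator hSm
  have i3 : Measurable (S.indicator f₃) := h₃.indicator hSm
  have step : modForm κ c f₁ f₂ f₃ ≤ modForm (fun x => min κ₀ (κ x)) c f₁ f₂ f₃ +
      (modForm κ c (S.indicator f₁) f₂ f₃ + (modForm κ c f₁ (S.indicator f₂) f₃ +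
        modForm κ c f₁ f₂ (S.indicator f₃))) := by
    have hadd : ∀ F G : ℝ → ℝ → ℝ → ℝ≥0∞, (Measurable fun z : (ℝ × ℝ) × ℝ => F z.1.1 z.1.2 z.2) →
        ∫⁻ s₁, ∫⁻ s₂, ∫⁻ s₃, (F s₁ s₂ s₃ + G s₁ s₂ s₃) =
          (∫⁻ s₁, ∫⁻ s₂, ∫⁻ s₃, F s₁ s₂ s₃) + ∫⁻ s₁, ∫⁻ s₂, ∫⁻ s₃, G s₁ s₂ s₃ := by
      intro F G hF
      have m2 : Measurable fun z : ℝ × ℝ => ∫⁻ s₃, F z.1 z.2 s₃ := hF.lintegral_prod_right'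
      have m1 : Measurable fun z : ℝ => ∫⁻ s₂, ∫⁻ s₃, F z s₂ s₃ := m2.lintegral_prod_right'
      rw [← lintegral_add_left m1]
      refine lintegral_congr fun s₁ => ?_
      have m2' : Measurable fun s₂ => ∫⁻ s₃, F s₁ s₂ s₃ := m2.comp measurable_prodMk_left
      rw [← lintegral_add_left m2']
      refine lintegral_congr fun s₂ => ?_
      have m3 : Measurable fun s₃ => F s₁ s₂ s₃ :=
        hF.comp (measurable_prodMk_left (x := (s₁, s₂)))
      rw [← lintegral_add_left m3]
    unfold modForm
    rw [← hadd _ _ (by fun_prop), ← hadd _ _ (by fun_prop), ← hadd _ _ (by fun_prop)]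
    gcongr
    apply key
  refine step.trans ?_
  gcongr
  · exact modForm_le_const c h₁ h₂ h₃ (fun x => min_le_left _ _)
  rw [hsq, hsq, hsq, mul_add, mul_add, add_assoc]
  gcongr
  -- The profile restricted to large modulations is moved to the last slot, the one measured in L².
  · rw [modForm_swap hκ c i1 h₂ h₃, modForm_swap_right hκ c i1 h₃]
    refine (modForm_le_sqrt hκ c h₂ h₃ i1).trans_eq ?_
    ring
  · rw [modForm_swap_right hκ c i2 h₃]
    refine (modForm_le_sqrt hκ c h₁ h₃ i2).trans_eq ?_
    ring
  · exact modForm_le_sqrt hκ c h₁ h₂ i3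

/-! ### The weights -/

lemma bracket_sq (x : ℝ) : bracket x ^ 2 = 1 + x ^ 2 := Real.sq_sqrt (by positivity)

lemma one_le_bracket (x : ℝ) : 1 ≤ bracket x := by
  rw [bracket, Real.one_le_sqrt]; nlinarith [sq_nonneg x]

lemma abs_le_bracket (x : ℝ) : |x| ≤ bracket x := by
  rw [bracket, ← Real.sqrt_sq_eq_abs]; exact Real.sqrt_le_sqrt (by linarith)

lemma one_le_weight (k : Freq) : 1 ≤ weight k := one_le_bracket _

lemma weight_pos (k : Freq) : 0 < weight k := zero_lt_one.trans_le (one_le_weight k)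

lemma omega_neg (k : Freq) : omega (-k) = -omega k := by
  simp only [omega, Pi.neg_apply, Int.cast_neg]
  ring

/-- The length scale of `weight` in the second frequency. -/
lemma weight_sq (k : Freq) :
    weight k ^ 2 = 1 + ((k 1 : ℝ) / ((1 + (k 0 : ℝ) ^ 2) * (k 0 : ℝ))) ^ 2 := by
  rw [weight, bracket_sq, bracket_sq]
  congr 2
  rw [div_eq_mul_inv, div_eq_mul_inv, mul_inv]; ring

lemma one_le_abs_intCast {m : ℤ} (hm : m ≠ 0) : (1 : ℝ) ≤ |(m : ℝ)| := by
  exact_mod_cast Int.one_le_abs hm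

/-- A nonzero integer m has ⟨m⟩² ≤ 2m², so the weight p measures n on the scale |m|³. -/
lemma abs_snd_le {k : Freq} (hk : k 0 ≠ 0) : |(k 1 : ℝ)| ≤ 2 * |(k 0 : ℝ)| ^ 3 * weight k := by
  have h1 := one_le_abs_intCast hk
  have h2 : |(bracket (k 0 : ℝ) ^ 2)⁻¹ * ((k 1 : ℝ) / (k 0 : ℝ))| ≤ weight k := abs_le_bracket _
  rw [bracket_sq, abs_mul, abs_div, abs_of_pos (by positivity : 0 < (1 + (k 0 : ℝ) ^ 2)⁻¹),
    inv_mul_le_iff₀ (by positivity), div_le_iff₀ (by positivity)] at h2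
  have h3 : (1 + (k 0 : ℝ) ^ 2) ≤ 2 * |(k 0 : ℝ)| ^ 2 := by
    rw [sq_abs, ← sq_abs]; nlinarith
  calc _ ≤ _ := h2
    _ ≤ 2 * |(k 0 : ℝ)| ^ 2 * weight k * |(k 0 : ℝ)| := by
        gcongr
        exact (weight_pos k).le
    _ = _ := by ring

/-- The bound telescopes: each summand is at most 2R²/(R+N) - 2R²/(R+N+1), because (R+N)(R+N+1) ≤
2(R² + (N+1)²). -/
lemma sum_range_inv_one_add_sq_le {R : ℝ} (hR : 0 < R) (N : ℕ) :
    ∑ i ∈ Finset.range N, (1 + (((i : ℝ) + 1) / R) ^ 2)⁻¹ ≤ 2 * R - 2 * R ^ 2 / (R + N) := by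
  induction N with
  | zero =>
    rw [Finset.sum_range_zero, Nat.cast_zero, add_zero]
    apply le_of_eq; field_simp; ring
  | succ N ih =>
    rw [Finset.sum_range_succ]
    have hN : (0 : ℝ) ≤ N := N.cast_nonneg
    have : (1 + (((N : ℝ) + 1) / R) ^ 2)⁻¹ ≤
        2 * R ^ 2 / (R + N) - 2 * R ^ 2 / (R + (N + 1 : ℕ)) := by
      have e1 : (1 + (((N : ℝ) + 1) / R) ^ 2)⁻¹ = R ^ 2 / (R ^ 2 + (N + 1) ^ 2) := by
        field_simp
      have e2 : 2 * R ^ 2 / (R + N) - 2 * R ^ 2 / (R + (N + 1 : ℕ)) =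
          2 * R ^ 2 / ((R + N) * (R + (N + 1))) := by
        push_cast; field_simp; ring
      rw [e1, e2, div_le_div_iff₀ (by positivity) (by positivity)]
      have : (R + N) * (R + (N + 1)) ≤ 2 * (R ^ 2 + (N + 1) ^ 2) := by
        nlinarith [sq_nonneg (R - (N + 1))]
      nlinarith [mul_le_mul_of_nonneg_left this (sq_nonneg R)]
    linarith

lemma tsum_int_eq (f : ℤ → ℝ≥0∞) :
    ∑' n : ℤ, f n = ∑' n : ℕ, f n + ∑' n : ℕ, f (-((n : ℤ) + 1)) := by
  rw [← Equiv.intEquivNatSumNat.symm.tsum_eq, Summable.tsum_sum ENNReal.summable ENNReal.summable]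
  congr 1

lemma tsum_inv_one_add_sq_le {R : ℝ} (hR : 1 ≤ R) :
    ∑' n : ℤ, ENNReal.ofReal (1 + ((n : ℝ) / R) ^ 2)⁻¹ ≤ ENNReal.ofReal (5 * R) := by
  have hR0 : 0 < R := by linarith
  have key : ∑' n : ℕ, ENNReal.ofReal (1 + (((n : ℝ) + 1) / R) ^ 2)⁻¹ ≤ ENNReal.ofReal (2 * R) := by
    refine ENNReal.tsum_le_of_sum_range_le fun N => ?_
    rw [← ENNReal.ofReal_sum_of_nonneg (fun i _ => by positivity)]
    refine ENNReal.ofReal_le_ofReal ((sum_range_inv_one_add_sq_le hR0 N).trans ?_)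
    have : 0 ≤ 2 * R ^ 2 / (R + N) := by positivity
    linarith
  rw [tsum_int_eq, tsum_eq_zero_add' ENNReal.summable]
  have e : ∀ n : ℕ, ENNReal.ofReal (1 + (((-((n : ℤ) + 1) : ℤ) : ℝ) / R) ^ 2)⁻¹ =
      ENNReal.ofReal (1 + (((n : ℝ) + 1) / R) ^ 2)⁻¹ := fun n => by
    congr 3; push_cast; rw [neg_div, neg_sq]
  simp_rw [e]
  push_cast
  calc _ ≤ ENNReal.ofReal 1 + ENNReal.ofReal (2 * R) + ENNReal.ofReal (2 * R) := by
        gcongr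
        simp
    _ = ENNReal.ofReal (1 + 2 * R + 2 * R) := by
        rw [ENNReal.ofReal_add (by positivity) (by positivity),
          ENNReal.ofReal_add (by positivity) (by positivity)]
    -- The term n = 0 contributes 1 ≤ R, each half-line at most 2R.
    _ ≤ _ := ENNReal.ofReal_le_ofReal (by linarith)

lemma tsum_freq (f : Freq → ℝ≥0∞) : ∑' k, f k = ∑' m : ℤ, ∑' n : ℤ, f ![m, n] := by
  rw [← (finTwoArrowEquiv ℤ).symm.tsum_eq, ENNReal.tsum_prod']
  rfl

/-- In the nonresonant interactions this is what makes the sum over the second frequency finite, at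
the price M³. The constant is 5 · 2 · (8/5)³ < 45. -/
lemma tsum_inv_weight_sq_le {m : ℤ} (hm : m ≠ 0) {M : ℝ} (hM : |(m : ℝ)| ≤ 8 / 5 * M) :
    ∑' n : ℤ, ENNReal.ofReal (weight ![m, n])⁻¹ ^ 2 ≤ ENNReal.ofReal (45 * M ^ 3) := by
  have h1 := one_le_abs_intCast hm
  have hR : 1 ≤ (1 + (m : ℝ) ^ 2) * |(m : ℝ)| := by nlinarith [sq_nonneg (m : ℝ)]
  calc _ = ∑' n : ℤ, ENNReal.ofReal (1 + ((n : ℝ) / ((1 + (m : ℝ) ^ 2) * |(m : ℝ)|)) ^ 2)⁻¹ := by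
        refine tsum_congr fun n => ?_
        rw [← ENNReal.ofReal_pow (inv_nonneg.2 (weight_pos _).le), inv_pow, weight_sq]
        congr 3
        simp only [Matrix.cons_val_zero, Matrix.cons_val_one, div_pow, mul_pow, sq_abs]
    _ ≤ _ := tsum_inv_one_add_sq_le hR
    _ ≤ _ := by
        refine ENNReal.ofReal_le_ofReal ?_
        have h3 : (1 + (m : ℝ) ^ 2) ≤ 2 * |(m : ℝ)| ^ 2 := by rw [sq_abs, ← sq_abs]; nlinarith
        have h4 : |(m : ℝ)| ^ 3 ≤ (8 / 5 * M) ^ 3 := by gcongr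
        have h5 : 0 ≤ M ^ 3 := by
          have : 0 ≤ M := by linarith
          positivity
        nlinarith [mul_le_mul_of_nonneg_right h3 (abs_nonneg (m : ℝ))]

/-- At most 2 · (8/5)M + 1 ≤ 5M values of m contribute, since M ≥ 1. -/
lemma tsum_freq_le {f : Freq → ℝ≥0∞} {M : ℝ} (hM : 1 ≤ M) {B : ℝ≥0∞}
    (hf : ∀ k : Freq, 8 / 5 * M < |(k 0 : ℝ)| → f k = 0)
    (hB : ∀ m : ℤ, ∑' n : ℤ, f ![m, n] ≤ B) :
    ∑' k, f k ≤ ENNReal.ofReal (5 * M) * B := by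
  rw [tsum_freq]
  set a : ℕ := ⌊8 / 5 * M⌋₊ with ha
  have ha' : (a : ℝ) ≤ 8 / 5 * M := Nat.floor_le (by positivity)
  rw [tsum_eq_sum (s := Finset.Icc (-(a : ℤ)) a)]
  · refine (Finset.sum_le_card_nsmul _ _ B fun m _ => hB m).trans ?_
    rw [nsmul_eq_mul]
    gcongr
    rw [← ENNReal.ofReal_natCast]
    refine ENNReal.ofReal_le_ofReal ?_
    rw [Int.card_Icc, show ((a : ℤ) + 1 - -(a : ℤ)).toNat = 2 * a + 1 by omega]
    push_cast
    linarith
  · intro m hm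
    rw [ENNReal.tsum_eq_zero]
    intro n
    apply hf
    simp only [Matrix.cons_val_zero]
    by_contra! h
    apply hm
    have h2 : (m.natAbs : ℝ) ≤ 8 / 5 * M := by rwa [Nat.cast_natAbs, Int.cast_abs]
    have : m.natAbs ≤ a := Nat.le_floor h2
    rw [Finset.mem_Icc]; omega

/-! ### The kernel in the modulation variable -/

/-- The square of the kernel `(A + |x|)^{-3/4}`. -/
def kerSq (A x : ℝ) : ℝ := (A + |x|) ^ (-(3 / 2) : ℝ)

lemma kerSq_nonneg {A : ℝ} (hA : 0 ≤ A) (x : ℝ) : 0 ≤ kerSq A x := by unfold kerSq; positivity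

/-- The kernel `(A + |x|)^{-3/4}`. -/
def ker (A x : ℝ) : ℝ≥0∞ := (ENNReal.ofReal (kerSq A x)) ^ (1 / 2 : ℝ)

lemma ker_sq (A x : ℝ) : ker A x ^ 2 = ENNReal.ofReal (kerSq A x) := rpow_half_sq _

lemma measurable_ker (A : ℝ) : Measurable (ker A) := by
  unfold ker kerSq; fun_prop

lemma kerSq_le_scaled {A c x y : ℝ} (hA : 0 < A) (hc : 0 < c) (hy : 0 ≤ y)
    (h : A * c * (1 + y) ≤ A + |x|) :
    kerSq A x ≤ (A * c) ^ (-(3 / 2) : ℝ) * (1 + y) ^ (-(3 / 2) : ℝ) := by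
  rw [kerSq, ← Real.mul_rpow (by positivity) (by positivity)]
  exact Real.rpow_le_rpow_of_nonpos (by positivity) h (by norm_num)

/-- The sum of `(1 + |j|)^{-3/2}` over the integers. -/
def kerSum : ℝ≥0∞ := ∑' j : ℤ, ENNReal.ofReal ((1 + |(j : ℝ)|) ^ (-(3 / 2) : ℝ))

lemma kerSum_ne_top : kerSum ≠ ⊤ := by
  have h : ∑' n : ℕ, ENNReal.ofReal (((n : ℝ) + 1) ^ (-(3 / 2) : ℝ)) ≠ ⊤ := by
    have h1 : Summable fun n : ℕ => (n : ℝ) ^ (-(3 / 2) : ℝ) :=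
      Real.summable_nat_rpow.2 (by norm_num)
    have h2 := (summable_nat_add_iff 1).2 h1
    push_cast at h2
    exact h2.tsum_ofReal_ne_top
  rw [kerSum, tsum_int_eq]
  refine ENNReal.add_ne_top.2 ⟨?_, ?_⟩
  · convert! h using 5 with n
    simp [add_comm]
  · refine ne_top_of_le_ne_top h (ENNReal.tsum_le_tsum fun n => ENNReal.ofReal_le_ofReal ?_)
    refine Real.rpow_le_rpow_of_nonpos (by positivity) ?_ (by norm_num)
    push_cast
    rw [abs_neg, abs_of_nonneg (by positivity)]
    linarith

/-- A sum of the kernel over separated points. -/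
lemma tsum_kerSq_le {A : ℝ} (hA : 0 < A) {x : ℤ → ℝ} {G : Set ℤ}
    (h : ∀ n ∈ G, ∀ n' ∈ G, A / 4 * |(n : ℝ) - n'| ≤ |x n - x n'|) :
    ∑' n : ℤ, G.indicator (fun n => ENNReal.ofReal (kerSq A (x n))) n ≤
      ENNReal.ofReal ((A * (1 / 8)) ^ (-(3 / 2) : ℝ)) * kerSum := by
  classical
  rw [ENNReal.tsum_eq_iSup_sum]
  refine iSup_le fun s => ?_
  rw [Finset.sum_indicator_eq_sum_filter]
  set t := s.filter (· ∈ G)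
  rcases t.eq_empty_or_nonempty with ht | ht
  · rw [ht, Finset.sum_empty]; exact zero_le
  -- The sum is recentred at a point where |x| is smallest. For every other n, |x n - x n₀| ≤ 2|x
  -- n|, hence |x n| ≥ (A/8)|n - n₀|. Finite subsums guarantee that a minimizer exists.
  obtain ⟨n₀, hn₀, hmin⟩ := t.exists_min_image (fun n => |x n|) ht
  have hG : ∀ n ∈ t, n ∈ G := fun n hn => (Finset.mem_filter.1 hn).2
  calc ∑ n ∈ t, ENNReal.ofReal (kerSq A (x n))
      ≤ ∑ n ∈ t, ENNReal.ofReal ((A * (1 / 8)) ^ (-(3 / 2) : ℝ)) *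
          ENNReal.ofReal ((1 + |((n - n₀ : ℤ) : ℝ)|) ^ (-(3 / 2) : ℝ)) := by
        refine Finset.sum_le_sum fun n hn => ?_
        rw [← ENNReal.ofReal_mul (by positivity)]
        refine ENNReal.ofReal_le_ofReal (kerSq_le_scaled hA (by norm_num) (abs_nonneg _) ?_)
        have h1 := h n (hG n hn) n₀ (hG n₀ hn₀)
        have h2 := hmin n hn
        have h3 : |x n - x n₀| ≤ |x n| + |x n₀| := abs_sub _ _
        push_cast
        nlinarith
    _ ≤ ∑' n : ℤ, ENNReal.ofReal ((A * (1 / 8)) ^ (-(3 / 2) : ℝ)) *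
          ENNReal.ofReal ((1 + |((n - n₀ : ℤ) : ℝ)|) ^ (-(3 / 2) : ℝ)) := ENNReal.sum_le_tsum _
    _ = _ := by
        rw [ENNReal.tsum_mul_left, kerSum]
        congr 1
        exact (Equiv.subRight n₀).tsum_eq
          (fun j : ℤ => ENNReal.ofReal ((1 + |(j : ℝ)|) ^ (-(3 / 2) : ℝ)))

/-- The integral of `(1 + |x|)^{-3/2}`. -/
def kerInt : ℝ≥0∞ := ∫⁻ x : ℝ, ENNReal.ofReal ((1 + |x|) ^ (-(3 / 2) : ℝ))

lemma kerInt_ne_top : kerInt ≠ ⊤ := by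
  have := finite_integral_one_add_norm (E := ℝ) (μ := volume) (r := 3 / 2)
    (by rw [Module.finrank_self]; norm_num)
  simpa only [Real.norm_eq_abs, kerInt] using this.ne

/-- By the scaling x = Ay, the Jacobian A against A^{-3/2} leaves A^{-1/2}. -/
lemma lintegral_ker_sq {A : ℝ} (hA : 0 < A) :
    ∫⁻ x, ker A x ^ 2 = ENNReal.ofReal (A ^ (-(1 / 2) : ℝ)) * kerInt := by
  simp_rw [ker_sq]
  have h : ∫⁻ x, ENNReal.ofReal (kerSq A x) =
      ENNReal.ofReal A * ∫⁻ x, ENNReal.ofReal (kerSq A (A * x)) := by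
    conv_lhs => rw [← Real.smul_map_volume_mul_left hA.ne', abs_of_pos hA]
    rw [lintegral_smul_measure, smul_eq_mul, lintegral_map _ (by fun_prop)]
    unfold kerSq; fun_prop
  have e : ∀ x, ENNReal.ofReal (kerSq A (A * x)) =
      ENNReal.ofReal (A ^ (-(3 / 2) : ℝ)) * ENNReal.ofReal ((1 + |x|) ^ (-(3 / 2) : ℝ)) := by
    intro x
    rw [← ENNReal.ofReal_mul (by positivity), ← Real.mul_rpow hA.le (by positivity), kerSq,
      abs_mul, abs_of_pos hA, mul_add, mul_one]
  simp_rw [e] at h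
  rw [h, lintegral_const_mul _ (by fun_prop), ← mul_assoc, ← ENNReal.ofReal_mul hA.le, kerInt]
  congr 2
  conv_lhs => rw [← Real.rpow_one A, ← Real.rpow_mul hA.le, ← Real.rpow_add hA]
  norm_num

/-- The exponent 3/2 of the squared kernel is split as 1/2 + 1. The resulting A^{-1/4} L^{-1/2}
matches the L² norm of the kernel times the gain L^{-1/2} of a modulation tail, so both nonresonant
alternatives have the same size. -/
lemma ker_le_of_le {A L x : ℝ} (hA : 0 < A) (hL : 0 < L) (hx : L ≤ |x|) :
    ker A x ≤ (ENNReal.ofReal (A ^ (-(1 / 2) : ℝ) * L⁻¹)) ^ (1 / 2 : ℝ) := by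
  refine rpow_half_mono (ENNReal.ofReal_le_ofReal ?_)
  rw [kerSq, show (-(3 / 2) : ℝ) = -(1 / 2) + -1 by norm_num, Real.rpow_add (by positivity),
    Real.rpow_neg_one]
  have h2 : (A + |x|) ^ (-(1 / 2) : ℝ) ≤ A ^ (-(1 / 2) : ℝ) :=
    Real.rpow_le_rpow_of_nonpos hA (by linarith [abs_nonneg x]) (by norm_num)
  gcongr
  linarith

/-! ### Disjoint dyadic blocks and the resonance function -/

/-- The disjoint dyadic blocks `4/5 · 2^j ≤ |m| < 8/5 · 2^j`. -/
def blk (j : ℕ) : Set ℤ := {m | 4 / 5 * (2 : ℝ) ^ j ≤ |(m : ℝ)| ∧ |(m : ℝ)| < 8 / 5 * (2 : ℝ) ^ j}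

lemma ne_zero_of_mem_blk {j : ℕ} {m : ℤ} (h : m ∈ blk j) : m ≠ 0 := by
  rintro rfl
  have := h.1
  have h2 : (0 : ℝ) < 2 ^ j := by positivity
  simp only [Int.cast_zero, abs_zero] at this
  linarith

/-- The indicator function of the triples of frequencies in given blocks. -/
def tripInd (j₁ j₂ j₃ : ℕ) (k₁ k₂ : Freq) : ℝ≥0∞ :=
  (blk j₁).indicator 1 (k₁ 0) * (blk j₂).indicator 1 (k₂ 0) * (blk j₃).indicator 1 ((-k₁ - k₂) 0)

lemma tripInd_cases (j₁ j₂ j₃ : ℕ) (k₁ k₂ : Freq) : tripInd j₁ j₂ j₃ k₁ k₂ = 0 ∨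
    (tripInd j₁ j₂ j₃ k₁ k₂ = 1 ∧ k₁ 0 ∈ blk j₁ ∧ k₂ 0 ∈ blk j₂ ∧ (-k₁ - k₂) 0 ∈ blk j₃) := by
  unfold tripInd
  by_cases h1 : k₁ 0 ∈ blk j₁ <;> by_cases h2 : k₂ 0 ∈ blk j₂ <;>
    by_cases h3 : (-k₁ - k₂) 0 ∈ blk j₃ <;> simp only [h1, h2, h3, indicator_of_mem,
      indicator_of_notMem, not_false_eq_true, Pi.one_apply, mul_one, mul_zero, true_or,
      and_self, or_true]

/-- The resonance function. -/
def resonance (k₁ k₂ : Freq) : ℝ := omega k₁ + omega k₂ + omega (-k₁ - k₂)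

/-- The difference of the slopes `n / m` of the first and the third frequency. -/
def slope (k₁ k₂ : Freq) : ℝ :=
  (k₁ 1 : ℝ) / (k₁ 0 : ℝ) - ((-k₁ - k₂) 1 : ℤ) / ((-k₁ - k₂) 0 : ℤ)

/-- The fifth powers give (5/2) m₁m₂m₃ (m₁² + m₂² + m₃²) when m₁ + m₂ + m₃ = 0, and the terms n²/m
combine to a square with the opposite sign. Hence resonances do occur, but only where the slope
difference is large. -/
lemma resonance_eq {k₁ k₂ : Freq} (h₁ : k₁ 0 ≠ 0) (h₂ : k₂ 0 ≠ 0) (h₃ : (-k₁ - k₂) 0 ≠ 0) :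
    resonance k₁ k₂ = (k₁ 0 : ℝ) * (k₂ 0 : ℝ) * ((-k₁ - k₂) 0 : ℤ) *
      (5 / 2 * ((k₁ 0 : ℝ) ^ 2 + (k₂ 0 : ℝ) ^ 2 + (((-k₁ - k₂) 0 : ℤ) : ℝ) ^ 2) -
        slope k₁ k₂ ^ 2 / (k₂ 0 : ℝ) ^ 2) := by
  have h1 : (k₁ 0 : ℝ) ≠ 0 := by exact_mod_cast h₁
  have h2 : (k₂ 0 : ℝ) ≠ 0 := by exact_mod_cast h₂
  have h3 : (-(k₁ 0 : ℝ) - (k₂ 0 : ℝ)) ≠ 0 := by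
    have : (((-k₁ - k₂) 0 : ℤ) : ℝ) ≠ 0 := by exact_mod_cast h₃
    simpa using this
  simp only [resonance, omega, slope, Pi.sub_apply, Pi.neg_apply, Int.cast_sub, Int.cast_neg]
  field_simp
  ring

/-- Three dyadic sizes at which a zero-sum triple can live: the two largest are comparable. -/
lemma le_four_mul {j₁ j₂ j₃ : ℕ} (h12 : j₁ ≤ j₂) {k₁ k₂ : Freq} (h₁ : k₁ 0 ∈ blk j₁)
    (h₂ : k₂ 0 ∈ blk j₂) (h₃ : (-k₁ - k₂) 0 ∈ blk j₃) : (2 : ℝ) ^ j₃ ≤ 4 * 2 ^ j₂ := by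
  have e : (2 : ℝ) ^ j₁ ≤ 2 ^ j₂ := pow_le_pow_right₀ (by norm_num) h12
  have h3 := h₃.1
  simp only [Pi.sub_apply, Pi.neg_apply, Int.cast_sub, Int.cast_neg] at h3
  have : |(-(k₁ 0 : ℝ) - (k₂ 0 : ℝ))| ≤ |(k₁ 0 : ℝ)| + |(k₂ 0 : ℝ)| := by
    rw [← abs_neg (k₁ 0 : ℝ)]; exact abs_sub _ _
  linarith [h₁.2, h₂.2]

/-- Off the resonant set the negative square is at most m₃², against at least (5/2) m₃² from the
fifth powers. The second size is at least a quarter of the third, so only the sizes with indices j₁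
and j₃ appear. The factor 6 is kept for the splitting of the modulations. -/
lemma le_abs_resonance {j₁ j₂ j₃ : ℕ} (h12 : j₁ ≤ j₂) {k₁ k₂ : Freq} (h₁ : k₁ 0 ∈ blk j₁)
    (h₂ : k₂ 0 ∈ blk j₂) (h₃ : (-k₁ - k₂) 0 ∈ blk j₃)
    (h : slope k₁ k₂ ^ 2 < (k₂ 0 : ℝ) ^ 2 * (((-k₁ - k₂) 0 : ℤ) : ℝ) ^ 2) :
    6 * ((2 : ℝ) ^ j₁ * ((2 : ℝ) ^ j₃) ^ 4 / 60) ≤ |resonance k₁ k₂| := by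
  have n1 := ne_zero_of_mem_blk h₁
  have n2 := ne_zero_of_mem_blk h₂
  have n3 := ne_zero_of_mem_blk h₃
  rw [resonance_eq n1 n2 n3]
  have h4 := le_four_mul h12 h₁ h₂ h₃
  have a1 := h₁.1
  have a2 := h₂.1
  have a3 := h₃.1
  set m₁ : ℝ := (k₁ 0 : ℝ)
  set m₂ : ℝ := (k₂ 0 : ℝ) with hm2
  set m₃ : ℝ := (((-k₁ - k₂) 0 : ℤ) : ℝ)
  set A := (2 : ℝ) ^ j₁
  set B := (2 : ℝ) ^ j₂
  set D := (2 : ℝ) ^ j₃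
  have hA : 0 < A := by positivity
  have hB : 0 < B := by positivity
  have hD : 0 < D := by positivity
  have m2p : 0 < m₂ ^ 2 := by
    have : m₂ ≠ 0 := by rw [hm2]; exact_mod_cast n2
    positivity
  have hs : slope k₁ k₂ ^ 2 / m₂ ^ 2 ≤ m₃ ^ 2 := by
    rw [div_le_iff₀ m2p]; linarith
  have hpos : 3 / 2 * |m₃| ^ 2 ≤
      5 / 2 * (m₁ ^ 2 + m₂ ^ 2 + m₃ ^ 2) - slope k₁ k₂ ^ 2 / m₂ ^ 2 := by
    rw [sq_abs]; nlinarith [sq_nonneg m₁]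
  rw [abs_mul, abs_mul, abs_mul]
  calc 6 * (A * D ^ 4 / 60) ≤ (4 / 5 * A) * (4 / 5 * (D / 4)) * (4 / 5 * D) *
        (3 / 2 * (4 / 5 * D) ^ 2) := by
        have : 0 < A * D ^ 4 := by positivity
        nlinarith
    _ ≤ |m₁| * |m₂| * |m₃| * (3 / 2 * |m₃| ^ 2) := by
        gcongr
        linarith
    _ ≤ _ := by
        gcongr
        exact hpos.trans (le_abs_self _)

/-- The resonant pairs. -/
def resSet : Set (Freq × Freq) :=
  {p | (p.2 0 : ℝ) ^ 2 * (((-p.1 - p.2) 0 : ℤ) : ℝ) ^ 2 ≤ slope p.1 p.2 ^ 2}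

/-- With m₁ and k₂ fixed, the resonance function is a quadratic polynomial in n₁ whose derivative is
twice the slope difference; its divided difference is the sum of the two slopes. -/
lemma resonance_sub (m n n' : ℤ) (k₂ : Freq) :
    resonance ![m, n] k₂ - resonance ![m, n'] k₂ =
      ((n : ℝ) - n') * (slope ![m, n] k₂ + slope ![m, n'] k₂) := by
  simp only [resonance, omega, slope, Pi.sub_apply, Pi.neg_apply, Matrix.cons_val_zero,
    Matrix.cons_val_one, Int.cast_sub, Int.cast_neg]
  simp only [div_eq_mul_inv]
  ring

/-- The number of resonant interactions, weighted by the kernel. -/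
lemma tsum_resonant_le {j₁ j₂ j₃ : ℕ} (h12 : j₁ ≤ j₂) {e : ℝ} (he : |e| = 1) (x : ℝ) (k₂ : Freq) :
    ∑' k₁, (tripInd j₁ j₂ j₃ k₁ k₂ * resSet.indicator 1 (k₁, k₂) *
        ker (((2 : ℝ) ^ j₃) ^ 2) (x + e * resonance k₁ k₂)) ^ 2 ≤
      ENNReal.ofReal (5 * (2 : ℝ) ^ j₁) *
        (2 * (ENNReal.ofReal ((((2 : ℝ) ^ j₃) ^ 2 * (1 / 8)) ^ (-(3 / 2) : ℝ)) * kerSum)) := by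
  set A : ℝ := ((2 : ℝ) ^ j₃) ^ 2 with hA
  have hA0 : 0 < A := by positivity
  refine tsum_freq_le (one_le_pow₀ (by norm_num)) ?_ ?_
  · intro k hk
    rcases tripInd_cases j₁ j₂ j₃ k k₂ with h | ⟨-, h, -⟩
    · simp [h]
    · exact absurd h.2 (not_lt.2 hk.le)
  · intro m
    set T : Set ℤ := {n | ![m, n] 0 ∈ blk j₁ ∧ k₂ 0 ∈ blk j₂ ∧ (-![m, n] - k₂) 0 ∈ blk j₃}
    -- r n is |m₂ m₃|, the threshold for the slope on the resonant set; its value does not depend on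
    -- n.
    set r : ℤ → ℝ := fun n => |(k₂ 0 : ℝ) * (((-![m, n] - k₂) 0 : ℤ) : ℝ)| with hr
    have hrA : ∀ n ∈ T, A / 8 ≤ r n := by
      rintro n ⟨h1, h2, h3⟩
      have h4 := le_four_mul h12 h1 h2 h3
      rw [hr, hA]
      simp only [abs_mul]
      have : 0 < (2 : ℝ) ^ j₃ := by positivity
      calc ((2 : ℝ) ^ j₃) ^ 2 / 8 ≤ 4 / 5 * ((2 : ℝ) ^ j₃ / 4) * (4 / 5 * (2 : ℝ) ^ j₃) := by
            nlinarith
        _ ≤ _ := by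
            gcongr
            · linarith [h2.1]
            · exact h3.1
    -- The resonant set is divided by the sign of the slope: within one part two slopes add without
    -- cancellation to at least A/8 + A/8, the separation A/4 required by `tsum_kerSq_le`.
    set G₁ : Set ℤ := {n | n ∈ T ∧ r n ≤ slope ![m, n] k₂}
    set G₂ : Set ℤ := {n | n ∈ T ∧ r n ≤ -slope ![m, n] k₂}
    have hsub : ∀ n n', |(x + e * resonance ![m, n] k₂) - (x + e * resonance ![m, n'] k₂)| =
        |(n : ℝ) - n'| * |slope ![m, n] k₂ + slope ![m, n'] k₂| := fun n n' => by
      rw [← abs_mul, ← resonance_sub, ← one_mul |resonance _ _ - _|, ← he, ← abs_mul]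
      congr 1; ring
    have b1 := tsum_kerSq_le hA0 (x := fun n => x + e * resonance ![m, n] k₂) (G := G₁) (by
      rintro n ⟨hn, h⟩ n' ⟨hn', h'⟩
      rw [hsub, mul_comm]
      gcongr
      refine le_trans ?_ (le_abs_self _)
      linarith [hrA n hn, hrA n' hn'])
    have b2 := tsum_kerSq_le hA0 (x := fun n => x + e * resonance ![m, n] k₂) (G := G₂) (by
      rintro n ⟨hn, h⟩ n' ⟨hn', h'⟩
      rw [hsub, mul_comm]
      gcongr
      refine le_trans ?_ (neg_le_abs _)
      linarith [hrA n hn, hrA n' hn'])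
    rw [two_mul]
    refine le_trans ?_ (add_le_add b1 b2)
    rw [← ENNReal.tsum_add]
    refine ENNReal.tsum_le_tsum fun n => ?_
    rcases tripInd_cases j₁ j₂ j₃ ![m, n] k₂ with h | ⟨h, hT⟩
    · simp [h]
    by_cases hres : (![m, n], k₂) ∈ resSet
    · rw [h, indicator_of_mem hres, Pi.one_apply, one_mul, one_mul, ker_sq]
      have hle : r n ≤ |slope ![m, n] k₂| := by
        simp only [resSet, mem_ofPred_eq, ← mul_pow] at hres
        exact sq_le_sq.1 hres
      rcases le_abs.1 hle with h' | h'
      · exact le_add_right (by rw [indicator_of_mem (show n ∈ G₁ from ⟨hT, h'⟩)])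
      · exact le_add_left (by rw [indicator_of_mem (show n ∈ G₂ from ⟨hT, h'⟩)])
    · simp [indicator_of_notMem hres]

/-! ### The trilinear estimate -/

/-- The square root of a real number, as an extended nonnegative real. -/
def esqrt (x : ℝ) : ℝ≥0∞ := (ENNReal.ofReal x) ^ (1 / 2 : ℝ)

lemma esqrt_mul {x : ℝ} (hx : 0 ≤ x) (y : ℝ) : esqrt x * esqrt y = esqrt (x * y) := by
  rw [esqrt, esqrt, esqrt, ← mul_rpow_half, ENNReal.ofReal_mul hx]

lemma esqrt_mono {x y : ℝ} (h : x ≤ y) : esqrt x ≤ esqrt y :=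
  rpow_half_mono (ENNReal.ofReal_le_ofReal h)

lemma esqrt_sq {x : ℝ} (hx : 0 ≤ x) : esqrt (x ^ 2) = ENNReal.ofReal x := by
  rw [esqrt, ENNReal.ofReal_pow hx, sq_rpow_half]

lemma esqrt_ne_top (x : ℝ) : esqrt x ≠ ⊤ :=
  ENNReal.rpow_ne_top_of_nonneg (by norm_num) ENNReal.ofReal_ne_top

/-- The bound for the symmetrized symbol, divided by the three weights. -/
def symBound (j₁ j₃ : ℕ) (k₁ k₂ : Freq) : ℝ≥0∞ :=
  ENNReal.ofReal (2 ^ j₁) * ENNReal.ofReal (weight k₁)⁻¹ +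
    ENNReal.ofReal ((2 ^ j₁) ^ 2 / 2 ^ j₃) *
      (ENNReal.ofReal (weight (-k₁ - k₂))⁻¹ + ENNReal.ofReal (weight k₂)⁻¹)

lemma ofReal_inv_weight_le_one (k : Freq) : ENNReal.ofReal (weight k)⁻¹ ≤ 1 := by
  rw [← ENNReal.ofReal_one]
  exact ENNReal.ofReal_le_ofReal (inv_le_one_of_one_le₀ (one_le_weight k))

/-- This crude bound serves the resonant interactions, where the kernel and not the weights provides
summability. -/
lemma symBound_le {j₁ j₃ : ℕ} (h13 : j₁ ≤ j₃) (k₁ k₂ : Freq) :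
    symBound j₁ j₃ k₁ k₂ ≤ 3 * ENNReal.ofReal (2 ^ j₁) := by
  have h : (2 : ℝ) ^ j₁ ≤ 2 ^ j₃ := pow_le_pow_right₀ (by norm_num) h13
  have h2 : ((2 : ℝ) ^ j₁) ^ 2 / 2 ^ j₃ ≤ 2 ^ j₁ := by
    rw [div_le_iff₀ (by positivity), sq]; gcongr
  unfold symBound
  calc _ ≤ ENNReal.ofReal (2 ^ j₁) * 1 + ENNReal.ofReal (2 ^ j₁) * (1 + 1) := by
        gcongr <;> exact ofReal_inv_weight_le_one _
    _ = _ := by ring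

lemma tripInd_le_one (j₁ j₂ j₃ : ℕ) (k₁ k₂ : Freq) : tripInd j₁ j₂ j₃ k₁ k₂ ≤ 1 := by
  rcases tripInd_cases j₁ j₂ j₃ k₁ k₂ with h | h
  · rw [h]; exact zero_le_one
  · rw [h.1]

lemma tsum_weight_first (j₁ j₂ j₃ : ℕ) (k₂ : Freq) :
    ∑' k₁, (tripInd j₁ j₂ j₃ k₁ k₂ * ENNReal.ofReal (weight k₁)⁻¹) ^ 2 ≤
      ENNReal.ofReal (225 * (2 ^ j₁) ^ 4) := by
  refine (tsum_freq_le (M := 2 ^ j₁) (B := ENNReal.ofReal (45 * ((2 : ℝ) ^ j₁) ^ 3))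
    (one_le_pow₀ (by norm_num)) ?_ ?_).trans_eq ?_
  · intro k hk
    rcases tripInd_cases j₁ j₂ j₃ k k₂ with h | ⟨-, h, -⟩
    · simp [h]
    · exact absurd h.2 (not_lt.2 hk.le)
  · intro m
    by_cases hm : m ∈ blk j₁
    · refine le_trans (ENNReal.tsum_le_tsum fun n => ?_)
        (tsum_inv_weight_sq_le (ne_zero_of_mem_blk hm) hm.2.le)
      gcongr
      exact mul_le_of_le_one_left' (tripInd_le_one _ _ _ _ _)
    · refine le_of_eq_of_le ?_ zero_le
      rw [ENNReal.tsum_eq_zero]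
      intro n
      rcases tripInd_cases j₁ j₂ j₃ ![m, n] k₂ with h | ⟨-, h, -⟩
      · simp [h]
      · exact absurd h hm
  · rw [← ENNReal.ofReal_mul (by positivity)]; congr 1; ring

/-- For fixed m₁ and k₂, the third second frequency runs through ℤ once as n₁ does. The number of m₁
is governed by the first size, the sum of the weights by the third. -/
lemma tsum_weight_third (j₁ j₂ j₃ : ℕ) (k₂ : Freq) :
    ∑' k₁, (tripInd j₁ j₂ j₃ k₁ k₂ * ENNReal.ofReal (weight (-k₁ - k₂))⁻¹) ^ 2 ≤
      ENNReal.ofReal (225 * (2 ^ j₁ * (2 ^ j₃) ^ 3)) := by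
  refine (tsum_freq_le (M := 2 ^ j₁) (B := ENNReal.ofReal (45 * ((2 : ℝ) ^ j₃) ^ 3))
    (one_le_pow₀ (by norm_num)) ?_ ?_).trans_eq ?_
  · intro k hk
    rcases tripInd_cases j₁ j₂ j₃ k k₂ with h | ⟨-, h, -⟩
    · simp [h]
    · exact absurd h.2 (not_lt.2 hk.le)
  · intro m
    have e : ∀ n, -![m, n] - k₂ = ![-m - k₂ 0, (Equiv.subLeft (-k₂ 1)) n] := by
      intro n; ext i; fin_cases i
      · simp
      · simp; ring
    by_cases hm : -m - k₂ 0 ∈ blk j₃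
    · refine le_trans ?_ (tsum_inv_weight_sq_le (ne_zero_of_mem_blk hm) hm.2.le)
      rw [← (Equiv.subLeft (-k₂ 1)).tsum_eq
        (fun n => ENNReal.ofReal (weight ![-m - k₂ 0, n])⁻¹ ^ 2)]
      refine ENNReal.tsum_le_tsum fun n => ?_
      rw [e]
      gcongr
      exact mul_le_of_le_one_left' (tripInd_le_one _ _ _ _ _)
    · refine le_of_eq_of_le ?_ zero_le
      rw [ENNReal.tsum_eq_zero]
      intro n
      rcases tripInd_cases j₁ j₂ j₃ ![m, n] k₂ with h | ⟨-, -, -, h⟩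
      · simp [h]
      · exact absurd (by simpa using h) hm
  · rw [← ENNReal.ofReal_mul (by positivity)]; congr 1; ring

lemma tripInd_swap_right (j₁ j₂ j₃ : ℕ) (k₁ k₂ : Freq) :
    tripInd j₁ j₂ j₃ k₁ (-k₁ - k₂) = tripInd j₁ j₃ j₂ k₁ k₂ := by
  unfold tripInd
  rw [sub_sub_cancel]
  ring

lemma tripInd_swap (j₁ j₂ j₃ : ℕ) (k₁ k₂ : Freq) :
    tripInd j₁ j₂ j₃ k₂ k₁ = tripInd j₂ j₁ j₃ k₁ k₂ := by
  unfold tripInd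
  rw [show -k₂ - k₁ = -k₁ - k₂ by abel]
  ring

/-- Schur's test is applied to each of the three terms of `symBound`. With a, b the sizes of index
j₁, j₃ they give 15a³ ≤ 15 (a⁵b)^{1/2} and twice (a²/b) · 15 (ab³)^{1/2} = 15 (a⁵b)^{1/2}. -/
lemma triForm_symBound_le {j₁ j₂ j₃ : ℕ} (h12 : j₁ ≤ j₂) (h23 : j₂ ≤ j₃) (g₁ g₂ g₃ : Freq → ℝ≥0∞) :
    triForm (fun k₁ k₂ => tripInd j₁ j₂ j₃ k₁ k₂ * symBound j₁ j₃ k₁ k₂) g₁ g₂ g₃ ≤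
      45 * esqrt ((2 ^ j₁) ^ 5 * 2 ^ j₃) * (l2 g₁ * l2 g₂ * l2 g₃) := by
  have h : (2 : ℝ) ^ j₁ ≤ 2 ^ j₃ := pow_le_pow_right₀ (by norm_num) (h12.trans h23)
  have h' : (2 : ℝ) ^ j₂ ≤ 2 ^ j₃ := pow_le_pow_right₀ (by norm_num) h23
  set a : ℝ := 2 ^ j₁
  set b : ℝ := 2 ^ j₃
  have ha : 0 < a := by positivity
  have hb : 0 < b := by positivity
  set X := l2 g₁ * l2 g₂ * l2 g₃
  have c15 : ENNReal.ofReal (225 : ℝ) ^ (1 / 2 : ℝ) = 15 := by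
    have := esqrt_sq (x := 15) (by norm_num)
    rw [esqrt] at this
    norm_num at this ⊢
    exact this
  have t1 : ENNReal.ofReal a * triForm (fun k₁ k₂ => tripInd j₁ j₂ j₃ k₁ k₂ *
      ENNReal.ofReal (weight k₁)⁻¹) g₁ g₂ g₃ ≤ 15 * esqrt (a ^ 5 * b) * X := by
    calc _ ≤ ENNReal.ofReal a * (esqrt (225 * a ^ 4) * X) := by
          gcongr; exact triForm_le (tsum_weight_first j₁ j₂ j₃) _ _ _
      _ = 15 * esqrt (a ^ 6) * X := by
          rw [← esqrt_sq ha.le, ← mul_assoc, esqrt_mul (by positivity),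
            show a ^ 2 * (225 * a ^ 4) = 225 * a ^ 6 by ring, ← esqrt_mul (by norm_num), esqrt, c15]
      _ ≤ _ := by
          gcongr
          apply esqrt_mono
          calc a ^ 6 = a ^ 5 * a := by ring
            _ ≤ _ := by gcongr
  have e2 : ENNReal.ofReal (a ^ 2 / b) * (esqrt (225 * (a * b ^ 3)) * X) =
      15 * esqrt (a ^ 5 * b) * X := by
    rw [← esqrt_sq (by positivity), ← mul_assoc, esqrt_mul (by positivity),
      show (a ^ 2 / b) ^ 2 * (225 * (a * b ^ 3)) = 225 * (a ^ 5 * b) by field_simp,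
      ← esqrt_mul (by norm_num), esqrt, c15]
  have t2 : ENNReal.ofReal (a ^ 2 / b) * triForm (fun k₁ k₂ => tripInd j₁ j₂ j₃ k₁ k₂ *
      ENNReal.ofReal (weight (-k₁ - k₂))⁻¹) g₁ g₂ g₃ ≤ 15 * esqrt (a ^ 5 * b) * X := by
    rw [← e2]
    gcongr; exact triForm_le (tsum_weight_third j₁ j₂ j₃) _ _ _
  have t3 : ENNReal.ofReal (a ^ 2 / b) * triForm (fun k₁ k₂ => tripInd j₁ j₂ j₃ k₁ k₂ *
      ENNReal.ofReal (weight k₂)⁻¹) g₁ g₂ g₃ ≤ 15 * esqrt (a ^ 5 * b) * X := by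
    rw [← e2]
    gcongr
    -- Here the weight sits at k₂, so k₃ is frozen instead.
    refine triForm_le' (fun k₃ => ?_) _ _ _
    simp_rw [tripInd_swap_right]
    refine (tsum_weight_third j₁ j₃ j₂ k₃).trans (ENNReal.ofReal_le_ofReal ?_)
    gcongr
  have e : (fun k₁ k₂ => tripInd j₁ j₂ j₃ k₁ k₂ * symBound j₁ j₃ k₁ k₂) = fun k₁ k₂ =>
      ENNReal.ofReal a * (tripInd j₁ j₂ j₃ k₁ k₂ * ENNReal.ofReal (weight k₁)⁻¹) +
      (ENNReal.ofReal (a ^ 2 / b) * (tripInd j₁ j₂ j₃ k₁ k₂ *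
        ENNReal.ofReal (weight (-k₁ - k₂))⁻¹) +
      ENNReal.ofReal (a ^ 2 / b) * (tripInd j₁ j₂ j₃ k₁ k₂ * ENNReal.ofReal (weight k₂)⁻¹)) := by
    ext k₁ k₂; unfold symBound; ring
  rw [e, triForm_add, triForm_add, triForm_const_mul, triForm_const_mul, triForm_const_mul]
  calc _ ≤ _ := add_le_add t1 (add_le_add t2 t3)
    _ = _ := by ring

/-- Conditions on the modulation profile of a function whose norm in `X_M` is at most `N`. -/
structure ModBound (g : ℝ → Freq → ℝ≥0∞) (N : ℝ≥0∞) : Prop where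
  measurable : ∀ k, Measurable fun s => g s k
  lintegral_le : ∫⁻ s, l2 (g s) ≤ N
  tail_le : ∀ L : ℝ, 0 < L → (∫⁻ s in {s | L ≤ |s|}, l2 (g s) ^ 2) ^ (1 / 2 : ℝ) ≤ esqrt L⁻¹ * N

lemma ModBound.l2_lintegral_le {g : ℝ → Freq → ℝ≥0∞} {N : ℝ≥0∞} (h : ModBound g N) :
    l2 (fun k => ∫⁻ s, g s k) ≤ N :=
  (KPOneFifth.l2_lintegral_le h.measurable).trans h.lintegral_le

lemma ModBound.l2_tail_le {g : ℝ → Freq → ℝ≥0∞} {N : ℝ≥0∞} (h : ModBound g N) {L : ℝ}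
    (hL : 0 < L) :
    l2 (fun k => (∫⁻ s in {s | L ≤ |s|}, g s k ^ 2) ^ (1 / 2 : ℝ)) ≤ esqrt L⁻¹ * N := by
  refine le_trans (le_of_eq ?_) (h.tail_le L hL)
  rw [l2]
  congr 1
  simp_rw [rpow_half_sq, l2_sq]
  rw [lintegral_tsum]
  exact fun k => ((h.measurable k).pow_const 2).aemeasurable

/-- The constant of the trilinear estimate. -/
def triConst : ℝ≥0∞ :=
  45 * (esqrt 20 + 3 * (kerInt ^ (1 / 2 : ℝ) * esqrt 60)) +
    3 * (10 * (ENNReal.ofReal ((1 / 8 : ℝ) ^ (-(3 / 2) : ℝ)) * kerSum)) ^ (1 / 2 : ℝ)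

lemma triConst_ne_top : triConst ≠ ⊤ := by
  have h1 : kerInt ^ (1 / 2 : ℝ) ≠ ⊤ := ENNReal.rpow_ne_top_of_nonneg (by norm_num) kerInt_ne_top
  have h2 : (10 * (ENNReal.ofReal ((1 / 8 : ℝ) ^ (-(3 / 2) : ℝ)) * kerSum)) ^ (1 / 2 : ℝ) ≠ ⊤ :=
    ENNReal.rpow_ne_top_of_nonneg (by norm_num)
      (ENNReal.mul_ne_top (by norm_num) (ENNReal.mul_ne_top ENNReal.ofReal_ne_top kerSum_ne_top))
  exact ENNReal.add_ne_top.2 ⟨ENNReal.mul_ne_top (by norm_num) (ENNReal.add_ne_top.2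
    ⟨esqrt_ne_top _, ENNReal.mul_ne_top (by norm_num) (ENNReal.mul_ne_top h1 (esqrt_ne_top _))⟩),
    ENNReal.mul_ne_top (by norm_num) h2⟩

/-- The resonant part of the trilinear form. -/
lemma tsum_resonant_modForm_le {j₁ j₂ j₃ : ℕ} (h12 : j₁ ≤ j₂) {e : ℝ} (he : |e| = 1)
    {g₁ g₂ g₃ : ℝ → Freq → ℝ≥0∞} {N₁ N₂ N₃ : ℝ≥0∞}
    (h₁ : ModBound g₁ N₁) (h₂ : ModBound g₂ N₂) (h₃ : ModBound g₃ N₃) :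
    ∑' k₁, ∑' k₂, tripInd j₁ j₂ j₃ k₁ k₂ * resSet.indicator 1 (k₁, k₂) *
      modForm (ker ((2 ^ j₃) ^ 2)) (e * resonance k₁ k₂)
        (fun s => g₁ s k₁) (fun s => g₂ s k₂) (fun s => g₃ s (-k₁ - k₂)) ≤
      (10 * (ENNReal.ofReal ((1 / 8 : ℝ) ^ (-(3 / 2) : ℝ)) * kerSum)) ^ (1 / 2 : ℝ) *
        esqrt (2 ^ j₁ / (2 ^ j₃) ^ 3) * (N₁ * N₂ * N₃) := by
  set κ := ker (((2 : ℝ) ^ j₃) ^ 2)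
  have hκ : Measurable κ := measurable_ker _
  set c : Freq → Freq → ℝ≥0∞ := fun k₁ k₂ => tripInd j₁ j₂ j₃ k₁ k₂ * resSet.indicator 1 (k₁, k₂)
  set K : ℝ≥0∞ := (10 * (ENNReal.ofReal ((1 / 8 : ℝ) ^ (-(3 / 2) : ℝ)) * kerSum)) ^ (1 / 2 : ℝ) *
        esqrt (2 ^ j₁ / (2 ^ j₃) ^ 3)
  have m1 := h₁.measurable
  have m2 := h₂.measurable
  have m3 := h₃.measurable
  have meas : ∀ {g : ℝ → Freq → ℝ≥0∞}, (∀ k, Measurable fun s => g s k) →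
      Measurable fun s => l2 (g s) := fun hg => by
    unfold l2
    exact (Measurable.tsum fun k => (hg k).pow_const 2).pow_const _
  -- The frequency sums are moved inside the modulation integrals: Schur's test is then uniform in
  -- (s₁, s₂, s₃), and only the L¹ in modulation, ℓ² in frequency norms are needed.
  have swap : ∑' k₁, ∑' k₂, c k₁ k₂ * modForm κ (e * resonance k₁ k₂)
        (fun s => g₁ s k₁) (fun s => g₂ s k₂) (fun s => g₃ s (-k₁ - k₂)) =
      ∫⁻ s₁, ∫⁻ s₂, ∫⁻ s₃, triForm
        (fun k₁ k₂ => c k₁ k₂ * κ (s₁ + s₂ + s₃ + e * resonance k₁ k₂)) (g₁ s₁) (g₂ s₂) (g₃ s₃) := by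
    have hF : ∀ p : Freq × Freq, Measurable fun z : (ℝ × ℝ) × ℝ =>
        c p.1 p.2 * (g₁ z.1.1 p.1 * g₂ z.1.2 p.2 * g₃ z.2 (-p.1 - p.2) *
          κ (z.1.1 + z.1.2 + z.2 + e * resonance p.1 p.2)) := fun p => by
      have i1 := m1 p.1
      have i2 := m2 p.2
      have i3 := m3 (-p.1 - p.2)
      fun_prop
    have hF2 : ∀ p : Freq × Freq, Measurable fun z : ℝ × ℝ => ∫⁻ s₃,
        c p.1 p.2 * (g₁ z.1 p.1 * g₂ z.2 p.2 * g₃ s₃ (-p.1 - p.2) *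
          κ (z.1 + z.2 + s₃ + e * resonance p.1 p.2)) := fun p => (hF p).lintegral_prod_right'
    have hF1 : ∀ p : Freq × Freq, Measurable fun z : ℝ => ∫⁻ s₂, ∫⁻ s₃,
        c p.1 p.2 * (g₁ z p.1 * g₂ s₂ p.2 * g₃ s₃ (-p.1 - p.2) *
          κ (z + s₂ + s₃ + e * resonance p.1 p.2)) := fun p => (hF2 p).lintegral_prod_right'
    have l1 : ∀ p : Freq × Freq, c p.1 p.2 * modForm κ (e * resonance p.1 p.2)
        (fun s => g₁ s p.1) (fun s => g₂ s p.2) (fun s => g₃ s (-p.1 - p.2)) =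
        ∫⁻ s₁, ∫⁻ s₂, ∫⁻ s₃, c p.1 p.2 * (g₁ s₁ p.1 * g₂ s₂ p.2 * g₃ s₃ (-p.1 - p.2) *
          κ (s₁ + s₂ + s₃ + e * resonance p.1 p.2)) := by
      intro p
      have hc : c p.1 p.2 ≠ ⊤ := by
        refine ne_top_of_le_ne_top ENNReal.one_ne_top ?_
        refine mul_le_one' (tripInd_le_one _ _ _ _ _) ?_
        exact indicator_le_self' (fun _ _ => zero_le) _
      unfold modForm
      simp_rw [lintegral_const_mul' _ _ hc]
    rw [← ENNReal.tsum_prod (f := fun k₁ k₂ => c k₁ k₂ * modForm κ (e * resonance k₁ k₂)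
        (fun s => g₁ s k₁) (fun s => g₂ s k₂) (fun s => g₃ s (-k₁ - k₂)))]
    rw [tsum_congr l1, ← lintegral_tsum fun p => (hF1 p).aemeasurable]
    refine lintegral_congr fun s₁ => ?_
    refine (lintegral_tsum fun p =>
      ((hF2 p).comp (measurable_prodMk_left (x := s₁))).aemeasurable).symm.trans ?_
    refine lintegral_congr fun s₂ => ?_
    refine (lintegral_tsum fun p =>
      ((hF p).comp (measurable_prodMk_left (x := (s₁, s₂)))).aemeasurable).symm.trans ?_
    refine lintegral_congr fun s₃ => ?_
    rw [triForm, ENNReal.tsum_prod']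
    refine tsum_congr fun k₁ => tsum_congr fun k₂ => ?_
    simp only [Function.comp_apply]
    ring
  rw [swap]
  have hK : (ENNReal.ofReal (5 * (2 : ℝ) ^ j₁) * (2 * (ENNReal.ofReal
      ((((2 : ℝ) ^ j₃) ^ 2 * (1 / 8)) ^ (-(3 / 2) : ℝ)) * kerSum))) ^ (1 / 2 : ℝ) = K := by
    simp only [K, esqrt]
    rw [← mul_rpow_half]
    congr 1
    have hb : (0 : ℝ) < 2 ^ j₃ := by positivity
    rw [Real.mul_rpow (by positivity) (by norm_num), ← Real.rpow_natCast ((2 : ℝ) ^ j₃) 2,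
      ← Real.rpow_mul hb.le, show ((2 : ℕ) : ℝ) * (-(3 / 2)) = -(3 : ℕ) by norm_num,
      Real.rpow_neg hb.le, Real.rpow_natCast, ENNReal.ofReal_mul (by positivity),
      ENNReal.ofReal_mul (by positivity), div_eq_mul_inv ((2 : ℝ) ^ j₁), ENNReal.ofReal_mul (by positivity)]
    norm_num
    ring
  calc _ ≤ ∫⁻ s₁, ∫⁻ s₂, ∫⁻ s₃, K * (l2 (g₁ s₁) * l2 (g₂ s₂) * l2 (g₃ s₃)) := by
        gcongr with s₁ s₂ s₃
        rw [← hK]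
        exact triForm_le (fun k₂ => tsum_resonant_le h12 he _ _) _ _ _
    _ = K * ((∫⁻ s, l2 (g₁ s)) * (∫⁻ s, l2 (g₂ s)) * (∫⁻ s, l2 (g₃ s))) := by
        have e1 : ∀ s₁ s₂, ∫⁻ s₃, K * (l2 (g₁ s₁) * l2 (g₂ s₂) * l2 (g₃ s₃)) =
            K * l2 (g₁ s₁) * (l2 (g₂ s₂) * ∫⁻ s, l2 (g₃ s)) := fun s₁ s₂ => by
          simp_rw [← mul_assoc]
          rw [lintegral_const_mul _ (meas m3)]
        simp_rw [e1]
        have e2 : ∀ s₁, ∫⁻ s₂, K * l2 (g₁ s₁) * (l2 (g₂ s₂) * ∫⁻ s, l2 (g₃ s)) =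
            K * (l2 (g₁ s₁) * ((∫⁻ s, l2 (g₂ s)) * ∫⁻ s, l2 (g₃ s))) := fun s₁ => by
          rw [lintegral_const_mul _ ((meas m2).mul_const _), lintegral_mul_const _ (meas m2),
            mul_assoc]
        simp_rw [e2]
        rw [lintegral_const_mul _ ((meas m1).mul_const _), lintegral_mul_const _ (meas m1)]
        ring
    _ ≤ _ := by
        gcongr
        · exact h₁.lintegral_le
        · exact h₂.lintegral_le
        · exact h₃.lintegral_le

/-- The trilinear estimate on a short time window. -/
lemma tsum_modForm_le {j₁ j₂ j₃ : ℕ} (h12 : j₁ ≤ j₂) (h23 : j₂ ≤ j₃) {e : ℝ} (he : |e| = 1)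
    {g₁ g₂ g₃ : ℝ → Freq → ℝ≥0∞} {N₁ N₂ N₃ : ℝ≥0∞}
    (h₁ : ModBound g₁ N₁) (h₂ : ModBound g₂ N₂) (h₃ : ModBound g₃ N₃) :
    ∑' k₁, ∑' k₂, tripInd j₁ j₂ j₃ k₁ k₂ * symBound j₁ j₃ k₁ k₂ *
      modForm (ker ((2 ^ j₃) ^ 2)) (e * resonance k₁ k₂)
        (fun s => g₁ s k₁) (fun s => g₂ s k₂) (fun s => g₃ s (-k₁ - k₂)) ≤
      triConst * esqrt ((2 ^ j₁) ^ 3 / (2 ^ j₃) ^ 3) * (N₁ * N₂ * N₃) := by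
  have hab : (2 : ℝ) ^ j₁ ≤ 2 ^ j₃ := pow_le_pow_right₀ (by norm_num) (h12.trans h23)
  have ha1 : (1 : ℝ) ≤ 2 ^ j₁ := one_le_pow₀ (by norm_num)
  set κ := ker (((2 : ℝ) ^ j₃) ^ 2)
  have hκ : Measurable κ := measurable_ker _
  -- One sixth of the lower bound for the resonance function in `le_abs_resonance`.
  set L : ℝ := (2 : ℝ) ^ j₁ * ((2 : ℝ) ^ j₃) ^ 4 / 60
  have hL : 0 < L := by positivity
  set q : (ℝ → Freq → ℝ≥0∞) → Freq → ℝ≥0∞ := fun g k => ∫⁻ s, g s k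
  set h : (ℝ → Freq → ℝ≥0∞) → Freq → ℝ≥0∞ :=
    fun g k => (∫⁻ s in {s | L ≤ |s|}, g s k ^ 2) ^ (1 / 2 : ℝ)
  set κ₀ : ℝ≥0∞ := esqrt ((((2 : ℝ) ^ j₃) ^ 2) ^ (-(1 / 2) : ℝ) * (3 * L)⁻¹)
  set K : ℝ≥0∞ := (∫⁻ x, κ x ^ 2) ^ (1 / 2 : ℝ)
  set c : Freq → Freq → ℝ≥0∞ := fun k₁ k₂ => tripInd j₁ j₂ j₃ k₁ k₂ * symBound j₁ j₃ k₁ k₂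
  set R : Freq → Freq → ℝ≥0∞ := fun k₁ k₂ => tripInd j₁ j₂ j₃ k₁ k₂ *
    resSet.indicator 1 (k₁, k₂) * modForm κ (e * resonance k₁ k₂)
        (fun s => g₁ s k₁) (fun s => g₂ s k₂) (fun s => g₃ s (-k₁ - k₂))
  -- On the resonant set the symbol is bounded crudely and the modulation form is kept; off it the
  -- symbol is kept and the modulation form is split.
  have pointwise : ∀ k₁ k₂, c k₁ k₂ * modForm κ (e * resonance k₁ k₂)
        (fun s => g₁ s k₁) (fun s => g₂ s k₂) (fun s => g₃ s (-k₁ - k₂)) ≤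
      3 * ENNReal.ofReal (2 ^ j₁) * R k₁ k₂ +
      c k₁ k₂ * (κ₀ * (q g₁ k₁ * q g₂ k₂ * q g₃ (-k₁ - k₂)) + K *
        (h g₁ k₁ * q g₂ k₂ * q g₃ (-k₁ - k₂) + q g₁ k₁ * h g₂ k₂ * q g₃ (-k₁ - k₂) +
          q g₁ k₁ * q g₂ k₂ * h g₃ (-k₁ - k₂))) := by
    intro k₁ k₂
    rcases tripInd_cases j₁ j₂ j₃ k₁ k₂ with h0 | ⟨h0, b1, b2, b3⟩
    · simp [c, h0]
    by_cases hres : (k₁, k₂) ∈ resSet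
    · refine le_add_right ?_
      simp only [c, R, h0, indicator_of_mem hres, Pi.one_apply, one_mul]
      gcongr
      exact symBound_le (h12.trans h23) k₁ k₂
    · refine le_add_left ?_
      gcongr
      refine modForm_le_split hκ _ (h₁.measurable k₁) (h₂.measurable k₂) (h₃.measurable _) ?_ ?_
      · rw [abs_mul, he, one_mul]
        refine le_abs_resonance h12 b1 b2 b3 ?_
        simpa [resSet] using hres
      · intro x hx
        exact ker_le_of_le (by positivity) (by positivity) hx
  have T : ∀ a₁ a₂ a₃ : Freq → ℝ≥0∞, triForm c a₁ a₂ a₃ ≤ _ :=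
    fun a₁ a₂ a₃ => triForm_symBound_le h12 h23 a₁ a₂ a₃
  have sumeq : ∑' k₁, ∑' k₂, (3 * ENNReal.ofReal (2 ^ j₁) * R k₁ k₂ +
      c k₁ k₂ * (κ₀ * (q g₁ k₁ * q g₂ k₂ * q g₃ (-k₁ - k₂)) + K *
        (h g₁ k₁ * q g₂ k₂ * q g₃ (-k₁ - k₂) + q g₁ k₁ * h g₂ k₂ * q g₃ (-k₁ - k₂) +
          q g₁ k₁ * q g₂ k₂ * h g₃ (-k₁ - k₂)))) =
      3 * ENNReal.ofReal (2 ^ j₁) * (∑' k₁, ∑' k₂, R k₁ k₂) +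
      (κ₀ * triForm c (q g₁) (q g₂) (q g₃) + K * (triForm c (h g₁) (q g₂) (q g₃) +
        triForm c (q g₁) (h g₂) (q g₃) + triForm c (q g₁) (q g₂) (h g₃))) := by
    simp only [triForm, ← ENNReal.tsum_mul_left, ← ENNReal.tsum_add]
    refine tsum_congr fun k₁ => tsum_congr fun k₂ => by ring
  refine (ENNReal.tsum_le_tsum fun k₁ => ENNReal.tsum_le_tsum fun k₂ => pointwise k₁ k₂).trans ?_
  rw [sumeq]
  have q1 : l2 (q g₁) ≤ N₁ := h₁.l2_lintegral_le
  have q2 : l2 (q g₂) ≤ N₂ := h₂.l2_lintegral_le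
  have q3 : l2 (q g₃) ≤ N₃ := h₃.l2_lintegral_le
  have t1 : l2 (h g₁) ≤ esqrt L⁻¹ * N₁ := h₁.l2_tail_le hL
  have t2 : l2 (h g₂) ≤ esqrt L⁻¹ * N₂ := h₂.l2_tail_le hL
  have t3 : l2 (h g₃) ≤ esqrt L⁻¹ * N₃ := h₃.l2_tail_le hL
  set S : ℝ≥0∞ := esqrt ((2 ^ j₁) ^ 5 * 2 ^ j₃)
  set X := N₁ * N₂ * N₃
  have hb : (0 : ℝ) < 2 ^ j₃ := by positivity
  have hpow : (((2 : ℝ) ^ j₃) ^ 2) ^ (-(1 / 2) : ℝ) = ((2 : ℝ) ^ j₃)⁻¹ := by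
    rw [← Real.rpow_natCast ((2 : ℝ) ^ j₃) 2, ← Real.rpow_mul hb.le,
      show ((2 : ℕ) : ℝ) * (-(1 / 2)) = -1 by norm_num, Real.rpow_neg_one]
  -- The nonresonant terms have the better factor (a/b)² in place of (a/b)^{3/2}; the resonant term
  -- dictates the final power.
  have base : ((2 : ℝ) ^ j₁) ^ 4 / (2 ^ j₃) ^ 4 ≤ (2 ^ j₁) ^ 3 / (2 ^ j₃) ^ 3 := by
    rw [← div_pow, ← div_pow]
    refine pow_le_pow_of_le_one (by positivity) ?_ (by norm_num)
    rw [div_le_one hb]; exact hab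
  have A1 : κ₀ * S ≤ esqrt 20 * esqrt ((2 ^ j₁) ^ 3 / (2 ^ j₃) ^ 3) := by
    simp only [κ₀, S]
    rw [esqrt_mul (by positivity), esqrt_mul (by positivity)]
    refine esqrt_mono ?_
    rw [hpow]
    calc _ = 20 * (((2 : ℝ) ^ j₁) ^ 4 / (2 ^ j₃) ^ 4) := by
          simp only [L]; field_simp; norm_num
      _ ≤ _ := by gcongr
  have A2 : K * (esqrt L⁻¹ * S) ≤
      kerInt ^ (1 / 2 : ℝ) * esqrt 60 * esqrt ((2 ^ j₁) ^ 3 / (2 ^ j₃) ^ 3) := by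
    simp only [K, S, κ]
    rw [lintegral_ker_sq (by positivity), hpow, mul_rpow_half, mul_comm _ (kerInt ^ (1 / 2 : ℝ)),
      mul_assoc, mul_assoc]
    refine mul_le_mul' le_rfl ?_
    change esqrt _ * _ ≤ _
    rw [esqrt_mul (by positivity), esqrt_mul (by positivity), esqrt_mul (by positivity)]
    refine esqrt_mono ?_
    calc _ = 60 * (((2 : ℝ) ^ j₁) ^ 4 / (2 ^ j₃) ^ 4) := by
          simp only [L]; field_simp
      _ ≤ _ := by gcongr
  have A3 : ENNReal.ofReal (2 ^ j₁) * esqrt (2 ^ j₁ / (2 ^ j₃) ^ 3) =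
      esqrt ((2 ^ j₁) ^ 3 / (2 ^ j₃) ^ 3) := by
    rw [← esqrt_sq (by positivity), esqrt_mul (by positivity)]
    congr 1; ring
  have hR := tsum_resonant_modForm_le (j₃ := j₃) h12 he h₁ h₂ h₃
  set Z := (10 * (ENNReal.ofReal ((1 / 8 : ℝ) ^ (-(3 / 2) : ℝ)) * kerSum)) ^ (1 / 2 : ℝ) with hZ
  set Y := esqrt (((2 : ℝ) ^ j₁) ^ 3 / (2 ^ j₃) ^ 3)
  calc _ ≤ 3 * ENNReal.ofReal (2 ^ j₁) * (Z * esqrt (2 ^ j₁ / (2 ^ j₃) ^ 3) * X) +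
        (κ₀ * (45 * S * (N₁ * N₂ * N₃)) + K * (45 * S * (esqrt L⁻¹ * N₁ * N₂ * N₃) +
          45 * S * (N₁ * (esqrt L⁻¹ * N₂) * N₃) + 45 * S * (N₁ * N₂ * (esqrt L⁻¹ * N₃)))) := by
        gcongr
        · exact (T _ _ _).trans (by gcongr)
        · exact (T _ _ _).trans (by gcongr)
        · exact (T _ _ _).trans (by gcongr)
        · exact (T _ _ _).trans (by gcongr)
    _ = 3 * Z * (ENNReal.ofReal (2 ^ j₁) * esqrt (2 ^ j₁ / (2 ^ j₃) ^ 3)) * X +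
        (45 * (κ₀ * S) + 45 * 3 * (K * (esqrt L⁻¹ * S))) * X := by ring
    _ ≤ 3 * Z * Y * X + (45 * (esqrt 20 * Y) +
          45 * 3 * (kerInt ^ (1 / 2 : ℝ) * esqrt 60 * Y)) * X := by
        rw [A3]; gcongr
    _ = _ := by rw [triConst]; ring

/-! ### The energy weights and their symmetrization -/

/-- A tent function, supported in `[1/2, 2]`. -/
def tent (r : ℝ) : ℝ := max 0 (3 / 4 - |r - 5 / 4|)

lemma tent_lipschitz (x y : ℝ) : |tent x - tent y| ≤ |x - y| := by
  refine (abs_max_sub_max_le_max _ _ _ _).trans ?_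
  rw [sub_zero, abs_zero, max_eq_right (abs_nonneg _)]
  have := abs_abs_sub_abs_le_abs_sub (y - 5 / 4) (x - 5 / 4)
  rw [show y - 5 / 4 - (x - 5 / 4) = y - x by ring, abs_sub_comm y x] at this
  rwa [show 3 / 4 - |x - 5 / 4| - (3 / 4 - |y - 5 / 4|) = |y - 5 / 4| - |x - 5 / 4| by ring]

lemma tent_nonneg (r : ℝ) : 0 ≤ tent r := le_max_left _ _

lemma tent_eq_zero_of_le {r : ℝ} (h : r ≤ 1 / 2) : tent r = 0 :=
  max_eq_left (by rw [abs_of_nonpos (by linarith)]; linarith)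

lemma tent_eq_zero_of_ge {r : ℝ} (h : 2 ≤ r) : tent r = 0 :=
  max_eq_left (by rw [abs_of_nonneg (by linarith)]; linarith)

lemma le_tent {r : ℝ} (h : 5 / 8 ≤ r) (h' : r ≤ 8 / 5) : 1 / 8 ≤ tent r := by
  refine le_max_of_le_right ?_
  rcases abs_cases (r - 5 / 4) with ⟨h1, _⟩ | ⟨h1, _⟩ <;> rw [h1] <;> linarith

/-- An odd Lipschitz function localizing to `M / 2 ≤ |x| ≤ 2 M`. -/
def oddCut (M x : ℝ) : ℝ := M * (tent (x / M) - tent (-x / M))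

lemma oddCut_neg (M x : ℝ) : oddCut M (-x) = -oddCut M x := by
  unfold oddCut; rw [neg_neg]; ring

/-- The prefactor M undoes the dilation, so the constant does not depend on M. With oddness this
bounds |oddCut m₂ + oddCut m₃| by 2|m₁| when m₁ + m₂ + m₃ = 0: the derivative passes from the high
to the low frequency. -/
lemma oddCut_lipschitz {M : ℝ} (hM : 0 < M) (x y : ℝ) :
    |oddCut M x - oddCut M y| ≤ 2 * |x - y| := by
  have e : oddCut M x - oddCut M y =
      M * ((tent (x / M) - tent (y / M)) - (tent (-x / M) - tent (-y / M))) := by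
    unfold oddCut; ring
  have h1 := tent_lipschitz (x / M) (y / M)
  have h2 := tent_lipschitz (-x / M) (-y / M)
  rw [← sub_div, abs_div, abs_of_pos hM] at h1
  rw [← sub_div, show -x - -y = -(x - y) by ring, abs_div, abs_neg, abs_of_pos hM] at h2
  rw [e, abs_mul, abs_of_pos hM]
  calc _ ≤ M * (|x - y| / M + |x - y| / M) := by
        gcongr; exact (abs_sub _ _).trans (add_le_add h1 h2)
    _ = _ := by field_simp; ring

lemma abs_oddCut_le {M : ℝ} (hM : 0 < M) (x : ℝ) : |oddCut M x| ≤ 2 * |x| := by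
  have h0 : oddCut M 0 = 0 := by simp [oddCut]
  simpa [h0] using oddCut_lipschitz hM x 0

lemma oddCut_support {M x : ℝ} (hM : 0 < M) (h : oddCut M x ≠ 0) : M / 2 < |x| ∧ |x| < 2 * M := by
  wlog hx : 0 ≤ x generalizing x
  · have := this (x := -x) (by rw [oddCut_neg]; exact neg_ne_zero.2 h) (by linarith)
    rwa [abs_neg] at this
  rw [abs_of_nonneg hx]
  have h2 : tent (-x / M) = 0 := tent_eq_zero_of_le (by
    have : 0 ≤ x / M := by positivity
    rw [neg_div]; linarith)
  constructor
  · by_contra! hc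
    apply h
    rw [oddCut, h2, tent_eq_zero_of_le (by rw [div_le_iff₀ hM]; linarith)]
    ring
  · by_contra! hc
    apply h
    rw [oddCut, h2, tent_eq_zero_of_ge (by rw [le_div_iff₀ hM]; linarith)]
    ring

lemma oddCut_div_nonneg {M : ℝ} (hM : 0 < M) (x : ℝ) : 0 ≤ oddCut M x / x := by
  wlog hx : 0 ≤ x generalizing x
  · have := this (-x) (by linarith)
    rwa [oddCut_neg, neg_div_neg_eq] at this
  have h2 : tent (-x / M) = 0 := tent_eq_zero_of_le (by
    have : 0 ≤ x / M := by positivity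
    rw [neg_div]; linarith)
  rw [oddCut, h2, sub_zero]
  have := tent_nonneg (x / M)
  positivity

/-- The constant is the minimum 1/8 of the tent on [5/8, 8/5] divided by 8/5. -/
lemma le_oddCut_div {M x : ℝ} (hM : 0 < M) (h : 5 / 8 * M ≤ |x|) (h' : |x| ≤ 8 / 5 * M) :
    5 / 64 ≤ oddCut M x / x := by
  wlog hx : 0 ≤ x generalizing x
  · have := this (x := -x) (by rwa [abs_neg]) (by rwa [abs_neg]) (by linarith)
    rwa [oddCut_neg, neg_div_neg_eq] at this
  rw [abs_of_nonneg hx] at h h'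
  have hx' : 0 < x := by linarith
  have h2 : tent (-x / M) = 0 := tent_eq_zero_of_le (by
    have : 0 ≤ x / M := by positivity
    rw [neg_div]; linarith)
  have h3 := le_tent (r := x / M) (by rwa [le_div_iff₀ hM]) (by rwa [div_le_iff₀ hM])
  rw [oddCut, h2, sub_zero, le_div_iff₀ hx']
  calc 5 / 64 * x ≤ 5 / 64 * (8 / 5 * M) := by gcongr
    _ = M * (1 / 8) := by ring
    _ ≤ _ := by gcongr

/-- The weight of the localized energy at the dyadic frequency `2^j`. -/
def enWeight (σ : ℝ) (j : ℕ) (k : Freq) : ℝ :=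
  ((2 : ℝ) ^ j) ^ (2 * σ) * (oddCut (2 ^ j) (k 0) / (k 0 : ℝ)) * (1 + (k 1 : ℝ) ^ 2 / (2 ^ j) ^ 6)

lemma enWeight_nonneg (σ : ℝ) (j : ℕ) (k : Freq) : 0 ≤ enWeight σ j k := by
  have := oddCut_div_nonneg (M := 2 ^ j) (by positivity) (k 0)
  unfold enWeight; positivity

lemma enWeight_neg (σ : ℝ) (j : ℕ) (k : Freq) : enWeight σ j (-k) = enWeight σ j k := by
  simp only [enWeight, Pi.neg_apply, Int.cast_neg, oddCut_neg, neg_div_neg_eq, neg_sq]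

/-- The energy weight times the first frequency. -/
def enMul (σ : ℝ) (j : ℕ) (k : Freq) : ℝ := enWeight σ j k * (k 0 : ℝ)

lemma enMul_eq {σ : ℝ} {j : ℕ} {k : Freq} (hk : k 0 ≠ 0) : enMul σ j k =
    ((2 : ℝ) ^ j) ^ (2 * σ) * (oddCut (2 ^ j) (k 0) * (1 + (k 1 : ℝ) ^ 2 / (2 ^ j) ^ 6)) := by
  have : (k 0 : ℝ) ≠ 0 := by exact_mod_cast hk
  unfold enMul enWeight
  field_simp

/-- The symmetrized symbol of the energy estimate. -/
def symbol (σ : ℝ) (j : ℕ) (k₁ k₂ : Freq) : ℝ :=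
  enMul σ j k₁ + enMul σ j k₂ + enMul σ j (-k₁ - k₂)

/-- The indicator function of neighbouring dyadic indices. -/
def near (j a : ℕ) : ℝ≥0∞ := if j ≤ a + 1 ∧ a ≤ j + 1 then 1 else 0

lemma tsum_near_le (a : ℕ) : ∑' j, near j a ≤ 3 := by
  have h : ∀ j ∉ Finset.Icc (a - 1) (a + 1), near j a = 0 := fun j hj => by
    rw [near, if_neg]
    rintro ⟨h1, h2⟩
    exact hj (Finset.mem_Icc.2 ⟨by omega, h1⟩)
  rw [tsum_eq_sum h]
  have h2 : ∀ j ∈ Finset.Icc (a - 1) (a + 1), near j a ≤ 1 := fun j _ => by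
    unfold near; split_ifs <;> simp
  refine (Finset.sum_le_card_nsmul _ _ _ h2).trans ?_
  rw [Nat.card_Icc, nsmul_one]
  have : a + 1 + 1 - (a - 1) ≤ 3 := by omega
  exact_mod_cast this

lemma near_eq_one_of_blk {j a : ℕ} {m : ℤ} (hm : m ∈ blk a) (h1 : (2 : ℝ) ^ j / 2 < |(m : ℝ)|)
    (h2 : |(m : ℝ)| < 2 * 2 ^ j) : near j a = 1 := by
  have e1 : (2 : ℝ) ^ j < 2 ^ (a + 2) := by rw [pow_add]; linarith [hm.2]
  have e2 : (2 : ℝ) ^ a < 2 ^ (j + 2) := by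
    have : (0 : ℝ) < 2 ^ j := by positivity
    rw [pow_add]; linarith [hm.1]
  rw [pow_lt_pow_iff_right₀ (by norm_num)] at e1 e2
  rw [near, if_pos ⟨by omega, by omega⟩]

/-- Since n₁ = -n₂ - n₃, one has a₂n₂² + a₃n₃² = -(a₂ + a₃) n₂n₃ - n₁(a₂n₂ + a₃n₃). Each term thus
carries either a low first frequency or the low second frequency n₁. -/
lemma abs_quadratic_le {m₁ m₂ m₃ n₁ n₂ n₃ a₁ a₂ a₃ : ℝ} (hn : n₁ + n₂ + n₃ = 0)
    (h₁ : |a₁| ≤ 2 * |m₁|) (h₂ : |a₂| ≤ 2 * |m₂|) (h₃ : |a₃| ≤ 2 * |m₃|)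
    (h₂₃ : |a₂ + a₃| ≤ 2 * |m₁|) :
    |a₁ * n₁ ^ 2 + a₂ * n₂ ^ 2 + a₃ * n₃ ^ 2| ≤ 2 * |m₁| * (|n₂| * |n₃|) +
      |n₁| * (2 * |m₁| * (|n₂| + |n₃|) + 2 * |m₂| * |n₂| + 2 * |m₃| * |n₃|) := by
  have e : a₁ * n₁ ^ 2 + a₂ * n₂ ^ 2 + a₃ * n₃ ^ 2 =
      -((a₂ + a₃) * (n₂ * n₃)) + -(n₁ * (a₁ * (n₂ + n₃) + a₂ * n₂ + a₃ * n₃)) := by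
    obtain rfl : n₁ = -n₂ - n₃ := by linarith
    ring
  rw [e]
  refine (abs_add_le _ _).trans ?_
  rw [abs_neg, abs_neg, abs_mul, abs_mul, abs_mul n₁]
  gcongr
  refine (abs_add_three _ _ _).trans ?_
  rw [abs_mul, abs_mul, abs_mul]
  gcongr
  exact abs_add_le _ _

/-- The case in which the cutoff sees only the lowest frequency; the zeros are the two vanishing
cutoffs. In n₁² one factor is bounded by its own weight and the other through |n₁| ≤ |n₂| + |n₃|,
which loses (D/A)³. The hypothesis `hpow2` gains (A/D)⁴ and leaves the factor A²/D. -/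
lemma low_symbol_le {σ A D M p₁ p₂ p₃ a₁ n₁ n₂ n₃ : ℝ} (hA0 : 0 < A) (hD0 : 0 < D) (hM0 : 0 < M)
    (hAM : 2 / 5 * A ≤ M) (hP : 1 ≤ p₂ * p₃) (w1 : 1 ≤ p₁) (w2 : 1 ≤ p₂) (w3 : 1 ≤ p₃)
    (hpow : M ^ (2 * σ) ≤ 4 ^ (2 * σ) * A ^ (2 * σ)) (hpow1 : A ^ (2 * σ) ≤ D ^ (2 * σ))
    (hpow2 : A ^ (2 * σ) ≤ D ^ (2 * σ) * (A ^ 4 / D ^ 4)) (ha : |a₁| ≤ 16 / 5 * A)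
    (sn : n₁ + n₂ + n₃ = 0) (q1 : |n₁| ≤ 9 * A ^ 3 * p₁) (q2 : |n₂| ≤ 9 * D ^ 3 * p₂)
    (q3 : |n₃| ≤ 9 * D ^ 3 * p₃) :
    M ^ (2 * σ) * |a₁ + (0 + 0) + (a₁ * n₁ ^ 2 + 0 * n₂ ^ 2 + 0 * n₃ ^ 2) / M ^ 6| ≤
      10 ^ 9 * 4 ^ (2 * σ) * D ^ (2 * σ) *
        (A * (p₂ * p₃) + A ^ 2 / D * (p₁ * (p₂ + p₃))) := by
  have hn1 : n₁ ^ 2 ≤ 81 * (A ^ 3 * D ^ 3) * (p₁ * (p₂ + p₃)) := by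
    have : |n₁| ≤ |n₂| + |n₃| := by
      rw [show n₁ = -n₂ + -n₃ by linarith]
      refine (abs_add_le _ _).trans ?_
      rw [abs_neg, abs_neg]
    calc n₁ ^ 2 = |n₁| * |n₁| := by rw [← sq, sq_abs]
      _ ≤ (9 * A ^ 3 * p₁) * (9 * D ^ 3 * p₂ + 9 * D ^ 3 * p₃) := by
          gcongr
          linarith
      _ = _ := by ring
  have hM6 : A ^ 6 / M ^ 6 ≤ (5 / 2) ^ 6 := by
    rw [← div_pow]
    refine pow_le_pow_left₀ (by positivity) ?_ 6
    rw [div_le_iff₀ hM0]; linarith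
  set X := A ^ (2 * σ) with hX
  set Y := D ^ (2 * σ) with hY
  set Z := (4 : ℝ) ^ (2 * σ) with hZ
  have hX0 : 0 < X := by positivity
  have hY0 : 0 < Y := by positivity
  have hZ0 : 0 < Z := by positivity
  have hQ : 0 ≤ p₁ * (p₂ + p₃) := by positivity
  have step1 : M ^ (2 * σ) * |a₁ + (0 + 0) + (a₁ * n₁ ^ 2 + 0 * n₂ ^ 2 + 0 * n₃ ^ 2) / M ^ 6| ≤
      (Z * X) * ((16 / 5 * A) * (1 + (81 * (A ^ 3 * D ^ 3) * (p₁ * (p₂ + p₃))) / M ^ 6)) := by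
    have e : |a₁ * (1 + n₁ ^ 2 / M ^ 6)| = |a₁| * (1 + n₁ ^ 2 / M ^ 6) := by
      rw [abs_mul, abs_of_nonneg (a := 1 + n₁ ^ 2 / M ^ 6) (by positivity)]
    rw [show a₁ + (0 + 0) + (a₁ * n₁ ^ 2 + 0 * n₂ ^ 2 + 0 * n₃ ^ 2) / M ^ 6 =
      a₁ * (1 + n₁ ^ 2 / M ^ 6) by ring, e]
    gcongr
  have step2 : (Z * X) * ((16 / 5 * A) * (1 + (81 * (A ^ 3 * D ^ 3) * (p₁ * (p₂ + p₃))) / M ^ 6)) =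
      Z * (16 / 5 * A) * (X * 1 + X * (81 * (D ^ 3 / A ^ 3) *
        (p₁ * (p₂ + p₃)) * (A ^ 6 / M ^ 6))) := by
    field_simp
  have step3 : X * 1 + X * (81 * (D ^ 3 / A ^ 3) * (p₁ * (p₂ + p₃)) * (A ^ 6 / M ^ 6)) ≤
      Y * (p₂ * p₃) + (Y * (A ^ 4 / D ^ 4)) *
        (81 * (D ^ 3 / A ^ 3) * (p₁ * (p₂ + p₃)) * (5 / 2) ^ 6) := by
    have c : 0 ≤ 81 * (D ^ 3 / A ^ 3) * (p₁ * (p₂ + p₃)) := by positivity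
    exact add_le_add (mul_le_mul hpow1 hP zero_le_one hY0.le)
      (mul_le_mul hpow2 (mul_le_mul_of_nonneg_left hM6 c) (by positivity) (by positivity))
  refine step1.trans (step2.trans_le ((mul_le_mul_of_nonneg_left step3 (by positivity)).trans ?_))
  have step4 : Z * (16 / 5 * A) * (Y * (p₂ * p₃) + (Y * (A ^ 4 / D ^ 4)) *
        (81 * (D ^ 3 / A ^ 3) * (p₁ * (p₂ + p₃)) * (5 / 2) ^ 6)) =
      Z * Y * (16 / 5 * (A * (p₂ * p₃)) +
        16 / 5 * 81 * (5 / 2) ^ 6 * (A ^ 2 / D * (p₁ * (p₂ + p₃)))) := by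
    field_simp
  have x1 : 0 ≤ A * (p₂ * p₃) := by positivity
  have x2 : 0 ≤ A ^ 2 / D * (p₁ * (p₂ + p₃)) := by positivity
  rw [step4]
  calc _ ≤ Z * Y * (10 ^ 9 * (A * (p₂ * p₃) + A ^ 2 / D * (p₁ * (p₂ + p₃)))) := by
        refine mul_le_mul_of_nonneg_left ?_ (by positivity)
        linarith
    _ = _ := by ring

/-- The support and the size of the symmetrized symbol. -/
lemma abs_symbol_le {σ : ℝ} (hσ : 2 ≤ σ) (j : ℕ) {j₁ j₂ j₃ : ℕ} (h12 : j₁ ≤ j₂) (h23 : j₂ ≤ j₃)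
    {k₁ k₂ : Freq} (b₁ : k₁ 0 ∈ blk j₁) (b₂ : k₂ 0 ∈ blk j₂) (b₃ : (-k₁ - k₂) 0 ∈ blk j₃) :
    |symbol σ j k₁ k₂| ≤ 10 ^ 9 * (4 : ℝ) ^ (2 * σ) * ((2 : ℝ) ^ j₃) ^ (2 * σ) *
      (2 ^ j₁ * (weight k₂ * weight (-k₁ - k₂)) +
        (2 ^ j₁) ^ 2 / 2 ^ j₃ * (weight k₁ * (weight k₂ + weight (-k₁ - k₂)))) := by
  have z1 := ne_zero_of_mem_blk b₁
  have z2 := ne_zero_of_mem_blk b₂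
  have z3 := ne_zero_of_mem_blk b₃
  have w1 := one_le_weight k₁
  have w2 := one_le_weight k₂
  have w3 := one_le_weight (-k₁ - k₂)
  have N1 := abs_snd_le z1
  have N2 := abs_snd_le z2
  have N3 := abs_snd_le z3
  have h43 := le_four_mul h12 b₁ b₂ b₃
  have u1 := b₁.2.le
  have u2 := b₂.2.le
  have u3 := b₃.2.le
  have l1 := b₁.1
  have l2 := b₂.1
  have l3 := b₃.1
  rw [symbol, enMul_eq z1, enMul_eq z2, enMul_eq z3]
  have sm : (k₁ 0 : ℝ) + (k₂ 0 : ℝ) + (((-k₁ - k₂) 0 : ℤ) : ℝ) = 0 := by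
    simp only [Pi.sub_apply, Pi.neg_apply]; push_cast; ring
  have sn : (k₁ 1 : ℝ) + (k₂ 1 : ℝ) + (((-k₁ - k₂) 1 : ℤ) : ℝ) = 0 := by
    simp only [Pi.sub_apply, Pi.neg_apply]; push_cast; ring
  have hM0 : (0 : ℝ) < 2 ^ j := by positivity
  have hA0 : (0 : ℝ) < 2 ^ j₁ := by positivity
  have hB0 : (0 : ℝ) < 2 ^ j₂ := by positivity
  have hD0 : (0 : ℝ) < 2 ^ j₃ := by positivity
  have hA1 : (1 : ℝ) ≤ 2 ^ j₁ := one_le_pow₀ (by norm_num)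
  have hAB : (2 : ℝ) ^ j₁ ≤ 2 ^ j₂ := pow_le_pow_right₀ (by norm_num) h12
  have hBD : (2 : ℝ) ^ j₂ ≤ 2 ^ j₃ := pow_le_pow_right₀ (by norm_num) h23
  generalize weight k₁ = p₁ at *
  generalize weight k₂ = p₂ at *
  generalize weight (-k₁ - k₂) = p₃ at *
  generalize (k₁ 0 : ℝ) = m₁ at *
  generalize (k₂ 0 : ℝ) = m₂ at *
  generalize (((-k₁ - k₂) 0 : ℤ) : ℝ) = m₃ at *
  generalize (k₁ 1 : ℝ) = n₁ at *
  generalize (k₂ 1 : ℝ) = n₂ at *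
  generalize (((-k₁ - k₂) 1 : ℤ) : ℝ) = n₃ at *
  generalize (2 : ℝ) ^ j = M at *
  generalize (2 : ℝ) ^ j₁ = A at *
  generalize (2 : ℝ) ^ j₂ = B at *
  generalize (2 : ℝ) ^ j₃ = D at *
  have q1 : |n₁| ≤ 9 * A ^ 3 * p₁ := N1.trans (by
    have : |m₁| ^ 3 ≤ (8 / 5 * A) ^ 3 := by gcongr
    refine mul_le_mul_of_nonneg_right ?_ (by linarith)
    nlinarith [pow_pos hA0 3])
  have q2 : |n₂| ≤ 9 * D ^ 3 * p₂ := N2.trans (by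
    have : |m₂| ^ 3 ≤ (8 / 5 * D) ^ 3 := by gcongr; linarith
    refine mul_le_mul_of_nonneg_right ?_ (by linarith)
    nlinarith [pow_pos hD0 3])
  have q3 : |n₃| ≤ 9 * D ^ 3 * p₃ := N3.trans (by
    have : |m₃| ^ 3 ≤ (8 / 5 * D) ^ 3 := by gcongr
    refine mul_le_mul_of_nonneg_right ?_ (by linarith)
    nlinarith [pow_pos hD0 3])
  set a₁ := oddCut M m₁ with ha1
  set a₂ := oddCut M m₂ with ha2
  set a₃ := oddCut M m₃ with ha3
  have e1 : |a₁| ≤ 2 * |m₁| := abs_oddCut_le hM0 _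
  have e2 : |a₂| ≤ 2 * |m₂| := abs_oddCut_le hM0 _
  have e3 : |a₃| ≤ 2 * |m₃| := abs_oddCut_le hM0 _
  have e23 : |a₂ + a₃| ≤ 2 * |m₁| := by
    have := oddCut_lipschitz hM0 m₂ (-m₃)
    rw [oddCut_neg, sub_neg_eq_add, sub_neg_eq_add] at this
    rwa [show m₂ + m₃ = -m₁ by linarith, abs_neg] at this
  have efact : M ^ (2 * σ) * (a₁ * (1 + n₁ ^ 2 / M ^ 6)) + M ^ (2 * σ) * (a₂ * (1 + n₂ ^ 2 / M ^ 6)) +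
      M ^ (2 * σ) * (a₃ * (1 + n₃ ^ 2 / M ^ 6)) = M ^ (2 * σ) * ((a₁ + (a₂ + a₃)) +
        (a₁ * n₁ ^ 2 + a₂ * n₂ ^ 2 + a₃ * n₃ ^ 2) / M ^ 6) := by ring
  rw [efact, abs_mul, abs_of_nonneg (by positivity : 0 ≤ M ^ (2 * σ))]
  have hP : 1 ≤ p₂ * p₃ := one_le_mul_of_one_le_of_one_le w2 w3
  -- For M < D/10 the two larger frequencies, both at least D/5 in size, lie outside the support of
  -- the cutoff.
  by_cases hMD : D / 10 ≤ M
  · by_cases hz : a₁ = 0 ∧ a₂ = 0 ∧ a₃ = 0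
    · obtain ⟨h1, h2, h3⟩ := hz
      rw [h1, h2, h3]
      simp only [zero_mul, add_zero, zero_div, abs_zero, mul_zero]
      positivity
    -- Otherwise M/2 exceeds all three frequencies and every cutoff vanishes.
    have hM4 : M ≤ 4 * D := by
      by_contra! hc
      apply hz
      refine ⟨?_, ?_, ?_⟩ <;> by_contra h <;> have := (oddCut_support hM0 h).1 <;> linarith
    have hpow : M ^ (2 * σ) ≤ 4 ^ (2 * σ) * D ^ (2 * σ) := by
      rw [← Real.mul_rpow (by norm_num) hD0.le]
      exact Real.rpow_le_rpow hM0.le hM4 (by linarith)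
    have hlin : |a₁ + (a₂ + a₃)| ≤ 8 * A * (p₂ * p₃) := by
      refine (abs_add_le _ _).trans ?_
      calc _ ≤ 8 * A * 1 := by linarith
        _ ≤ _ := by gcongr
    have hquad := abs_quadratic_le sn e1 e2 e3 e23
    have hquad2 : 2 * |m₁| * (|n₂| * |n₃|) +
        |n₁| * (2 * |m₁| * (|n₂| + |n₃|) + 2 * |m₂| * |n₂| + 2 * |m₃| * |n₃|) ≤
        (519 * A * (p₂ * p₃) + 519 * (A ^ 3 / D ^ 2) * (p₁ * (p₂ + p₃))) * D ^ 6 := by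
      have m1D : |m₁| ≤ 8 / 5 * D := by linarith
      have m2D : |m₂| ≤ 8 / 5 * D := by linarith
      calc _ ≤ 2 * (8 / 5 * A) * ((9 * D ^ 3 * p₂) * (9 * D ^ 3 * p₃)) + (9 * A ^ 3 * p₁) *
            (2 * (8 / 5 * D) * ((9 * D ^ 3 * p₂) + (9 * D ^ 3 * p₃)) +
              2 * (8 / 5 * D) * (9 * D ^ 3 * p₂) + 2 * (8 / 5 * D) * (9 * D ^ 3 * p₃)) := by
            gcongr
        _ = (1296 / 5 * A * (p₂ * p₃) + 2592 / 5 * (A ^ 3 / D ^ 2) * (p₁ * (p₂ + p₃))) * D ^ 6 := by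
            field_simp; ring
        _ ≤ _ := by gcongr <;> norm_num
    have hA3 : A ^ 3 / D ^ 2 ≤ A ^ 2 / D := by
      rw [div_le_div_iff₀ (by positivity) hD0]
      have : A ≤ D := hAB.trans hBD
      calc A ^ 3 * D = A ^ 2 * D * A := by ring
        _ ≤ A ^ 2 * D * D := by gcongr
        _ = _ := by ring
    have hM6 : D ^ 6 / M ^ 6 ≤ 10 ^ 6 := by
      rw [← div_pow]
      gcongr
      rw [div_le_iff₀ hM0]; linarith
    calc M ^ (2 * σ) * |a₁ + (a₂ + a₃) + (a₁ * n₁ ^ 2 + a₂ * n₂ ^ 2 + a₃ * n₃ ^ 2) / M ^ 6|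
        ≤ (4 ^ (2 * σ) * D ^ (2 * σ)) * (8 * A * (p₂ * p₃) +
          ((519 * A * (p₂ * p₃) + 519 * (A ^ 3 / D ^ 2) * (p₁ * (p₂ + p₃))) * D ^ 6) / M ^ 6) := by
          gcongr
          refine (abs_add_le _ _).trans ?_
          rw [abs_div, abs_of_pos (by positivity : 0 < M ^ 6)]
          gcongr
          exact hquad.trans hquad2
      _ ≤ (4 ^ (2 * σ) * D ^ (2 * σ)) * (8 * A * (p₂ * p₃) +
          (519 * A * (p₂ * p₃) + 519 * (A ^ 2 / D) * (p₁ * (p₂ + p₃))) * 10 ^ 6) := by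
          rw [mul_div_assoc]
          gcongr
      -- 10⁹ absorbs 8 + 519 · 10⁶.
      _ ≤ (4 ^ (2 * σ) * D ^ (2 * σ)) * (10 ^ 9 * (A * (p₂ * p₃) +
            A ^ 2 / D * (p₁ * (p₂ + p₃)))) := by
          have x1 : 0 ≤ A * (p₂ * p₃) := by positivity
          have x2 : 0 ≤ A ^ 2 / D * (p₁ * (p₂ + p₃)) := by positivity
          gcongr
          linarith
      _ = _ := by ring
  · push Not at hMD
    have y2 : a₂ = 0 := by
      by_contra h
      have := (oddCut_support hM0 h).2
      linarith
    have y3 : a₃ = 0 := by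
      by_contra h
      have := (oddCut_support hM0 h).2
      linarith
    rw [y2, y3]
    by_cases y1 : a₁ = 0
    · rw [y1]
      simp only [zero_mul, add_zero, zero_div, abs_zero, mul_zero]
      positivity
    obtain ⟨s1, s2⟩ := oddCut_support hM0 y1
    have hMA : M ≤ 4 * A := by linarith
    have hAM : 2 / 5 * A ≤ M := by linarith
    have hpow : M ^ (2 * σ) ≤ 4 ^ (2 * σ) * A ^ (2 * σ) := by
      rw [← Real.mul_rpow (by norm_num) hA0.le]
      exact Real.rpow_le_rpow hM0.le hMA (by linarith)
    have hAD : A / D ≤ 1 := by rw [div_le_one hD0]; linarith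
    have hpow1 : A ^ (2 * σ) ≤ D ^ (2 * σ) :=
      Real.rpow_le_rpow hA0.le (hAB.trans hBD) (by linarith)
    -- Here σ ≥ 2 matters: (A/D)^{2σ} ≤ (A/D)⁴ because A ≤ D.
    have hpow2 : A ^ (2 * σ) ≤ D ^ (2 * σ) * (A ^ 4 / D ^ 4) := by
      have h1 : (A / D) ^ (2 * σ) ≤ (A / D) ^ (4 : ℝ) :=
        Real.rpow_le_rpow_of_exponent_ge (by positivity) hAD (by linarith)
      rw [Real.div_rpow hA0.le hD0.le, show (4 : ℝ) = (4 : ℕ) by norm_num, Real.rpow_natCast,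
        div_pow, div_le_iff₀ (by positivity)] at h1
      linarith
    have ha : |a₁| ≤ 16 / 5 * A := by linarith
    exact low_symbol_le hA0 hD0 hM0 hAM hP w1 w2 w3 hpow hpow1 hpow2 ha sn q1 q2 q3

lemma symbol_eq_zero {σ : ℝ} {j j₁ j₂ j₃ : ℕ}
    {k₁ k₂ : Freq} (b₁ : k₁ 0 ∈ blk j₁) (b₂ : k₂ 0 ∈ blk j₂) (b₃ : (-k₁ - k₂) 0 ∈ blk j₃)
    (h₁ : near j j₁ = 0) (h₂ : near j j₂ = 0) (h₃ : near j j₃ = 0) : symbol σ j k₁ k₂ = 0 := by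
  have key : ∀ (a : ℕ) (k : Freq), k 0 ∈ blk a → near j a = 0 → enMul σ j k = 0 := by
    intro a k hk hn
    rw [enMul_eq (ne_zero_of_mem_blk hk)]
    by_cases h : oddCut (2 ^ j) (k 0 : ℝ) = 0
    · rw [h, zero_mul, mul_zero]
    · obtain ⟨s1, s2⟩ := oddCut_support (by positivity) h
      rw [near_eq_one_of_blk hk s1 s2] at hn
      exact absurd hn one_ne_zero
  rw [symbol, key _ _ b₁ h₁, key _ _ b₂ h₂, key _ _ b₃ h₃, add_zero, add_zero]

/-- The constant in the bound for the symmetrized symbol. -/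
def symConst (σ : ℝ) : ℝ≥0∞ := ENNReal.ofReal (10 ^ 9 * (4 : ℝ) ^ (2 * σ))

/-- The factors `near` record that the energy of index j only feels triples with a block next to j;
they make the later sum over j finite. The weights p are split off to be absorbed by the functions.
-/
lemma enorm_symbol_le {σ : ℝ} (hσ : 2 ≤ σ) (j : ℕ) {j₁ j₂ j₃ : ℕ} (h12 : j₁ ≤ j₂) (h23 : j₂ ≤ j₃)
    (k₁ k₂ : Freq) :
    tripInd j₁ j₂ j₃ k₁ k₂ * ‖symbol σ j k₁ k₂‖ₑ ≤ (near j j₁ + near j j₂ + near j j₃) *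
      (symConst σ * ENNReal.ofReal (((2 : ℝ) ^ j₃) ^ (2 * σ))) *
      (tripInd j₁ j₂ j₃ k₁ k₂ * symBound j₁ j₃ k₁ k₂ * (ENNReal.ofReal (weight k₁) *
        ENNReal.ofReal (weight k₂) * ENNReal.ofReal (weight (-k₁ - k₂)))) := by
  rcases tripInd_cases j₁ j₂ j₃ k₁ k₂ with h | ⟨h, b₁, b₂, b₃⟩
  · simp [h]
  rw [h, one_mul, one_mul]
  by_cases hn : near j j₁ + near j j₂ + near j j₃ = 0
  · simp only [add_eq_zero] at hn
    rw [symbol_eq_zero b₁ b₂ b₃ hn.1.1 hn.1.2 hn.2]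
    simp
  have h1 : 1 ≤ near j j₁ + near j j₂ + near j j₃ := by
    simp only [add_eq_zero, not_and_or] at hn
    have hc : ∀ a, near j a ≠ 0 → near j a = 1 := fun a ha => by
      unfold near at ha ⊢; split_ifs at ha ⊢ <;> simp_all
    rcases hn with (h | h) | h <;> rw [hc _ h]
    · exact le_add_right (le_add_right le_rfl)
    · exact le_add_right (le_add_left le_rfl)
    · exact le_add_left le_rfl
  have p1 := weight_pos k₁
  have p2 := weight_pos k₂
  have p3 := weight_pos (-k₁ - k₂)
  have e : symBound j₁ j₃ k₁ k₂ * (ENNReal.ofReal (weight k₁) *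
        ENNReal.ofReal (weight k₂) * ENNReal.ofReal (weight (-k₁ - k₂))) =
      ENNReal.ofReal (2 ^ j₁ * (weight k₂ * weight (-k₁ - k₂)) +
        (2 ^ j₁) ^ 2 / 2 ^ j₃ * (weight k₁ * (weight k₂ + weight (-k₁ - k₂)))) := by
    rw [symBound, ← ENNReal.ofReal_mul (by positivity), ← ENNReal.ofReal_add (by positivity)
      (by positivity), ← ENNReal.ofReal_mul (by positivity), ← ENNReal.ofReal_add (by positivity)
      (by positivity), ← ENNReal.ofReal_mul (by positivity), ← ENNReal.ofReal_mul (by positivity),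
      ← ENNReal.ofReal_mul (by positivity)]
    congr 1
    field_simp
  rw [e]
  calc ‖symbol σ j k₁ k₂‖ₑ = ENNReal.ofReal |symbol σ j k₁ k₂| := Real.enorm_eq_ofReal_abs _
    _ ≤ _ := ENNReal.ofReal_le_ofReal (abs_symbol_le hσ j h12 h23 b₁ b₂ b₃)
    _ = 1 * (symConst σ * ENNReal.ofReal (((2 : ℝ) ^ j₃) ^ (2 * σ))) * _ := by
        rw [ENNReal.ofReal_mul (by positivity), ENNReal.ofReal_mul (by positivity), symConst,
          one_mul]
    _ ≤ _ := by gcongr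

/-! ### Comparison of the energy weights with the norms -/

/-- On the block the cutoff quotient is at least 5/64 and 1 + n²/M⁶ is comparable to p². The
constants come from (8/5)⁶ < 17 and 218 · 5/64 > 17. -/
lemma sq_weight_le_enWeight {σ : ℝ} (hσ : 2 ≤ σ) {j : ℕ} {k : Freq} (hk : k 0 ∈ freqBlock j) :
    (bracket (k 0 : ℝ) ^ σ * weight k) ^ 2 ≤ 218 * (3 : ℝ) ^ (2 * σ) * enWeight σ j k := by
  obtain ⟨h1, h2⟩ := hk
  have hM0 : (0 : ℝ) < 2 ^ j := by positivity
  have hm : k 0 ≠ 0 := by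
    intro h
    rw [h, Int.cast_zero, abs_zero] at h1
    linarith
  have hm1 := one_le_abs_intCast hm
  have hlow := le_oddCut_div hM0 h1 h2
  rw [mul_pow, weight_sq, enWeight]
  set M : ℝ := 2 ^ j
  set m : ℝ := (k 0 : ℝ)
  set n : ℝ := (k 1 : ℝ)
  have hb : bracket m ≤ 3 * M := by
    have h3 : bracket m ^ 2 ≤ (3 * M) ^ 2 := by
      rw [bracket_sq, ← sq_abs]; nlinarith
    exact le_of_sq_le_sq h3 (by positivity)
  have hb0 : 0 ≤ bracket m := zero_le_one.trans (one_le_bracket m)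
  have hbσ : (bracket m ^ σ) ^ 2 ≤ (3 : ℝ) ^ (2 * σ) * M ^ (2 * σ) := by
    rw [← Real.mul_rpow (by norm_num) hM0.le, ← Real.rpow_natCast, ← Real.rpow_mul hb0,
      mul_comm σ]
    exact Real.rpow_le_rpow hb0 hb (by simp; linarith)
  have hn : (n / ((1 + m ^ 2) * m)) ^ 2 ≤ 17 * (n ^ 2 / M ^ 6) := by
    have h4 : M ^ 6 ≤ 17 * ((1 + m ^ 2) * m) ^ 2 := by
      have h5 : (5 / 8 * M) ^ 6 ≤ |m| ^ 6 := by gcongr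
      have h6 : |m| ^ 6 = (m ^ 2 * m) ^ 2 := by
        rw [← abs_pow, show (m ^ 2 * m) ^ 2 = m ^ 6 by ring, abs_of_nonneg (by positivity)]
      have h7 : (m ^ 2 * m) ^ 2 ≤ ((1 + m ^ 2) * m) ^ 2 := by
        rw [mul_pow, mul_pow _ m]; gcongr; linarith
      have h8 : 0 < M ^ 6 := by positivity
      nlinarith
    have hpos : 0 < ((1 + m ^ 2) * m) ^ 2 := by
      have : m ≠ 0 := by intro h; rw [h, abs_zero] at hm1; linarith
      positivity
    rw [div_pow, ← mul_div_assoc, div_le_div_iff₀ hpos (by positivity)]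
    nlinarith [mul_le_mul_of_nonneg_left h4 (sq_nonneg n)]
  calc _ ≤ ((3 : ℝ) ^ (2 * σ) * M ^ (2 * σ)) * (1 + 17 * (n ^ 2 / M ^ 6)) := by gcongr
    _ ≤ ((3 : ℝ) ^ (2 * σ) * M ^ (2 * σ)) * (218 * ((5 / 64) * (1 + n ^ 2 / M ^ 6))) := by
        have : 0 ≤ n ^ 2 / M ^ 6 := by positivity
        gcongr; linarith
    _ ≤ ((3 : ℝ) ^ (2 * σ) * M ^ (2 * σ)) * (218 * ((oddCut M m / m) * (1 + n ^ 2 / M ^ 6))) := by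
        gcongr
    _ = _ := by ring

lemma enWeight_le {σ : ℝ} (hσ : 2 ≤ σ) (j : ℕ) {k : Freq} {a : ℕ} (hk : k 0 ∈ blk a) :
    ENNReal.ofReal (enWeight σ j k) ≤ near j a * (ENNReal.ofReal (512 * (2 : ℝ) ^ (2 * σ)) *
      ENNReal.ofReal (bracket (k 0 : ℝ) ^ σ * weight k) ^ 2) := by
  have hM0 : (0 : ℝ) < 2 ^ j := by positivity
  have hm := ne_zero_of_mem_blk hk
  by_cases hz : oddCut (2 ^ j) (k 0 : ℝ) = 0
  · simp [enWeight, hz]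
  obtain ⟨s1, s2⟩ := oddCut_support hM0 hz
  have hb0 : 0 ≤ bracket (k 0 : ℝ) := zero_le_one.trans (one_le_bracket _)
  rw [near_eq_one_of_blk hk s1 s2, one_mul, ← ENNReal.ofReal_pow
    (mul_nonneg (by positivity) (weight_pos k).le), ← ENNReal.ofReal_mul (by positivity)]
  refine ENNReal.ofReal_le_ofReal ?_
  have hm1 := one_le_abs_intCast hm
  have habs := abs_oddCut_le hM0 (k 0 : ℝ)
  have hlb := abs_le_bracket (k 0 : ℝ)
  have hnn := oddCut_div_nonneg hM0 (k 0 : ℝ)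
  rw [mul_pow, weight_sq, enWeight]
  set M : ℝ := 2 ^ j
  set m : ℝ := (k 0 : ℝ)
  set n : ℝ := (k 1 : ℝ)
  have hm0 : m ≠ 0 := by intro h; rw [h, abs_zero] at hm1; linarith
  have hbσ : M ^ (2 * σ) ≤ (2 : ℝ) ^ (2 * σ) * (bracket m ^ σ) ^ 2 := by
    rw [← Real.rpow_natCast, ← Real.rpow_mul hb0, mul_comm σ, Nat.cast_ofNat,
      ← Real.mul_rpow (by norm_num) hb0]
    exact Real.rpow_le_rpow hM0.le (by linarith) (by linarith)
  have hq : oddCut M m / m ≤ 2 := by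
    rw [← abs_of_nonneg hnn, abs_div, div_le_iff₀ (by positivity)]
    exact habs
  have hn : n ^ 2 / M ^ 6 ≤ 256 * (n / ((1 + m ^ 2) * m)) ^ 2 := by
    have h4 : ((1 + m ^ 2) * m) ^ 2 ≤ 256 * M ^ 6 := by
      have h5 : |m| ^ 6 ≤ (2 * M) ^ 6 := by gcongr
      have h6 : |m| ^ 6 = (m ^ 2 * m) ^ 2 := by
        rw [← abs_pow, show (m ^ 2 * m) ^ 2 = m ^ 6 by ring, abs_of_nonneg (by positivity)]
      have h7 : ((1 + m ^ 2) * m) ^ 2 ≤ (2 * m ^ 2 * m) ^ 2 := by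
        have : 1 + m ^ 2 ≤ 2 * m ^ 2 := by rw [← sq_abs]; nlinarith
        rw [mul_pow, mul_pow _ m]; gcongr
      calc _ ≤ _ := h7
        _ = 4 * |m| ^ 6 := by rw [h6]; ring
        _ ≤ 4 * (2 * M) ^ 6 := by gcongr
        _ = _ := by ring
    have hpos : 0 < ((1 + m ^ 2) * m) ^ 2 := by positivity
    rw [div_pow, ← mul_div_assoc, div_le_div_iff₀ (by positivity) hpos]
    nlinarith [mul_le_mul_of_nonneg_left h4 (sq_nonneg n)]
  calc M ^ (2 * σ) * (oddCut M m / m) * (1 + n ^ 2 / M ^ 6)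
      ≤ ((2 : ℝ) ^ (2 * σ) * (bracket m ^ σ) ^ 2) * 2 *
        (1 + 256 * (n / ((1 + m ^ 2) * m)) ^ 2) := by
        gcongr
    _ ≤ ((2 : ℝ) ^ (2 * σ) * (bracket m ^ σ) ^ 2) * 2 *
        (256 * (1 + (n / ((1 + m ^ 2) * m)) ^ 2)) := by
        gcongr; linarith
    _ = _ := by ring

/-- The index of the dyadic block that contains a given frequency. -/
def blkIndex (m : ℤ) : ℕ := Nat.log 2 (5 * m.natAbs / 4)

lemma mem_blk_blkIndex {m : ℤ} (hm : m ≠ 0) : m ∈ blk (blkIndex m) := by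
  have h1 : 1 ≤ m.natAbs := Int.natAbs_pos.2 hm
  have h2 : 5 * m.natAbs / 4 ≠ 0 := by omega
  have h3 := Nat.pow_log_le_self 2 h2
  have h4 := Nat.lt_pow_succ_log_self (b := 2) (by norm_num) (5 * m.natAbs / 4)
  rw [show Nat.log 2 (5 * m.natAbs / 4) = blkIndex m from rfl] at h3 h4
  -- Rounding down in 5|m|/4 is harmless, since it is compared with integers.
  have h5 : 4 * 2 ^ blkIndex m ≤ 5 * m.natAbs := by omega
  have h6 : 5 * m.natAbs < 8 * 2 ^ blkIndex m := by rw [pow_succ] at h4; omega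
  have e : |(m : ℝ)| = (m.natAbs : ℝ) := by rw [Nat.cast_natAbs, Int.cast_abs]
  have h5' : (4 : ℝ) * 2 ^ blkIndex m ≤ 5 * m.natAbs := by exact_mod_cast h5
  have h6' : (5 : ℝ) * m.natAbs < 8 * 2 ^ blkIndex m := by exact_mod_cast h6
  constructor <;> rw [e] <;> linarith

lemma blk_subset_freqBlock (j : ℕ) : blk j ⊆ freqBlock j := fun m hm =>
  ⟨by have : (0 : ℝ) < 2 ^ j := by positivity
      linarith [hm.1], hm.2.le⟩

/-! ### The modulation profile of functions with finite `X_M` norm -/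

lemma IsCutoff.eq_zero {χ : ℝ → ℝ} (hχ : IsCutoff χ) {x : ℝ} (hx : 8 / 5 < |x|) : χ x = 0 := by
  refine image_eq_zero_of_notMem_tsupport fun h => ?_
  have := abs_le.2 (mem_Icc.1 (hχ.supp h))
  linarith

lemma IsCutoff.eq_one_of_abs {χ : ℝ → ℝ} (hχ : IsCutoff χ) {x : ℝ} (hx : |x| ≤ 5 / 4) :
    χ x = 1 := hχ.eq_one x (abs_le.1 hx)

lemma IsCutoff.continuous {χ : ℝ → ℝ} (hχ : IsCutoff χ) : Continuous χ := hχ.smooth.continuous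

lemma continuous_eta {χ : ℝ → ℝ} (hχ : IsCutoff χ) (l : ℕ) : Continuous (eta χ l) := by
  have := hχ.continuous
  unfold eta
  split_ifs <;> fun_prop

lemma eta_eq_zero {χ : ℝ → ℝ} (hχ : IsCutoff χ) {l : ℕ} {x : ℝ} (hx : 8 / 5 * 2 ^ l < |x|) :
    eta χ l x = 0 := by
  have h2 : (0 : ℝ) < 2 ^ l := by positivity
  unfold eta
  split_ifs with h
  · subst h
    exact hχ.eq_zero (by simpa using hx)
  · rw [hχ.eq_zero, hχ.eq_zero, sub_zero]
    · rw [abs_div, abs_of_pos h2, lt_div_iff₀ h2, abs_mul, abs_two]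
      linarith [abs_nonneg x]
    · rwa [abs_div, abs_of_pos h2, lt_div_iff₀ h2]

/-- Take the first l with |x| ≤ (5/4) 2^l. If l > 0, the functions of index l - 1 and l take the
values χ(y) and 1 - χ(y) with y = x/2^{l-1}, and one of them is at least 1/2. -/
lemma exists_half_le_eta {χ : ℝ → ℝ} (hχ : IsCutoff χ) (x : ℝ) : ∃ l, 1 / 2 ≤ |eta χ l x| := by
  have hex : ∃ l : ℕ, |x| ≤ 5 / 4 * 2 ^ l := by
    obtain ⟨l, hl⟩ := pow_unbounded_of_one_lt |x| (one_lt_two (α := ℝ))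
    exact ⟨l, by linarith [abs_nonneg x]⟩
  classical
  have h1 := Nat.find_spec hex
  have hmin := fun m => Nat.find_min hex (m := m)
  set l := Nat.find hex
  rcases Nat.eq_zero_or_pos l with h0 | hpos
  · refine ⟨0, ?_⟩
    rw [h0] at h1
    rw [eta, if_pos rfl, hχ.eq_one_of_abs (by simpa using h1)]
    norm_num
  obtain ⟨m, hm⟩ : ∃ m, l = m + 1 := ⟨l - 1, by omega⟩
  have h2 := hmin m (by omega)
  rw [not_le] at h2
  have hp : (0 : ℝ) < 2 ^ m := by positivity
  have e1 : eta χ (m + 1) x = 1 - χ (x / 2 ^ m) := by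
    rw [eta, if_neg (by omega), hχ.eq_one_of_abs]
    · congr 2
      rw [pow_succ]; field_simp
    · rw [hm] at h1
      rw [abs_div, abs_of_pos (by positivity : (0 : ℝ) < 2 ^ (m + 1)), div_le_iff₀ (by positivity)]
      exact h1
  have e2 : eta χ m x = χ (x / 2 ^ m) := by
    unfold eta
    split_ifs with h
    · rw [h]; simp
    · rw [hχ.eq_zero (x := 2 * x / 2 ^ m), sub_zero]
      rw [abs_div, abs_of_pos hp, lt_div_iff₀ hp, abs_mul, abs_two]
      linarith
  rcases le_total (1 / 2) (χ (x / 2 ^ m)) with h | h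
  · exact ⟨m, by rw [e2]; exact h.trans (le_abs_self _)⟩
  · exact ⟨m + 1, by rw [e1]; exact le_trans (by linarith) (le_abs_self _)⟩

/-- After the substitution τ = s - εω(k) the dyadic cutoff depends on the modulation s alone, and
the sum over k can be taken first. -/
lemma xNorm_eq {χ : ℝ → ℝ} (hχ : IsCutoff χ) (ε : ℝ) {F : ℝ → Freq → ℂ}
    (hF : ∀ k, Measurable fun τ => F τ k) :
    xNorm χ ε F = ∑' l : ℕ, (2 : ℝ≥0∞) ^ ((l : ℝ) / 2) *
      (∫⁻ s, (‖eta χ l s‖ₑ * l2 (fun k => ‖F (s - ε * omega k) k‖ₑ)) ^ 2) ^ (1 / 2 : ℝ) := by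
  unfold xNorm
  refine tsum_congr fun l => ?_
  congr 2
  have hη := continuous_eta hχ l
  have e : ∀ k : Freq, ∫⁻ τ : ℝ, (‖(eta χ l (τ + ε * omega k) : ℂ) * F τ k‖ₑ) ^ 2 =
      ∫⁻ s : ℝ, ‖eta χ l s‖ₑ ^ 2 * ‖F (s - ε * omega k) k‖ₑ ^ 2 := by
    intro k
    rw [← lintegral_sub_right_eq_self _ (ε * omega k)]
    refine lintegral_congr fun s => ?_
    rw [sub_add_cancel, enorm_mul, mul_pow]
    congr 2
    rw [← ofReal_norm, ← ofReal_norm, Complex.norm_real]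
  simp_rw [e, mul_pow, l2_sq, ← ENNReal.tsum_mul_left]
  rw [lintegral_tsum]
  intro k
  have := hF k
  refine Measurable.aemeasurable ?_
  have h2 : Measurable fun s => F (s - ε * omega k) k := (hF k).comp (by fun_prop)
  fun_prop

/-- Every s lies in a shell where some η_l is at least 1/2 and |s| ≤ (8/5) 2^l. Cauchy–Schwarz on
that shell costs its length to the power 1/2, which is the factor 2^{l/2} of the X_M norm. In the
tail |s| ≥ L only shells with 2^l ≥ 5L/8 occur, so the same factor yields L^{-1/2}. -/
lemma modBound_of_xNorm {χ : ℝ → ℝ} (hχ : IsCutoff χ) (ε : ℝ) {F : ℝ → Freq → ℂ}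
    (hF : ∀ k, Measurable fun τ => F τ k) :
    ModBound (fun s k => ‖F (s - ε * omega k) k‖ₑ) (4 * xNorm χ ε F) := by
  set G : ℝ → ℝ≥0∞ := fun s => l2 (fun k => ‖F (s - ε * omega k) k‖ₑ) with hG
  have hgm : ∀ k, Measurable fun s => ‖F (s - ε * omega k) k‖ₑ := fun k =>
    ((hF k).comp (by fun_prop : Measurable fun s : ℝ => s - ε * omega k)).enorm
  have hGm : Measurable G := by
    simp only [hG]
    unfold l2
    exact (Measurable.tsum fun k => (hgm k).pow_const 2).pow_const _
  have hηm : ∀ l, Measurable fun s => ‖eta χ l s‖ₑ := fun l =>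
    (continuous_eta hχ l).measurable.enorm
  have hηG : ∀ l, Measurable fun s => ‖eta χ l s‖ₑ * G s := fun l => (hηm l).mul hGm
  set a : ℕ → ℝ≥0∞ := fun l => (∫⁻ s, (‖eta χ l s‖ₑ * G s) ^ 2) ^ (1 / 2 : ℝ) with ha
  have hx : xNorm χ ε F = ∑' l : ℕ, (2 : ℝ≥0∞) ^ ((l : ℝ) / 2) * a l := xNorm_eq hχ ε hF
  have hpow : ∀ l : ℕ, ((2 : ℝ≥0∞) ^ ((l : ℝ) / 2)) ^ 2 = 2 ^ l := fun l => by
    rw [← ENNReal.rpow_natCast, ← ENNReal.rpow_mul, ← ENNReal.rpow_natCast]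
    congr 1; push_cast; ring
  have half : ∀ s, ∃ l, 1 ≤ 2 * ‖eta χ l s‖ₑ ∧ |s| ≤ 8 / 5 * 2 ^ l := by
    intro s
    obtain ⟨l, hl⟩ := exists_half_le_eta hχ s
    refine ⟨l, ?_, ?_⟩
    · rw [Real.enorm_eq_ofReal_abs, ← ENNReal.ofReal_ofNat, ← ENNReal.ofReal_mul (by norm_num),
        ← ENNReal.ofReal_one]
      exact ENNReal.ofReal_le_ofReal (by linarith)
    · by_contra! h
      rw [eta_eq_zero hχ h, abs_zero] at hl
      norm_num at hl
  refine ⟨hgm, ?_, ?_⟩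
  · have h1 : ∀ s, G s ≤ ∑' l, 2 * (‖eta χ l s‖ₑ * G s) := by
      intro s
      obtain ⟨l, hl, -⟩ := half s
      calc G s = 1 * G s := (one_mul _).symm
        _ ≤ 2 * ‖eta χ l s‖ₑ * G s := by gcongr
        _ = 2 * (‖eta χ l s‖ₑ * G s) := mul_assoc _ _ _
        _ ≤ _ := ENNReal.le_tsum (f := fun l => 2 * (‖eta χ l s‖ₑ * G s)) l
    have h2 : ∀ l, ∫⁻ s, ‖eta χ l s‖ₑ * G s ≤ 2 * ((2 : ℝ≥0∞) ^ ((l : ℝ) / 2) * a l) := by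
      intro l
      set S : Set ℝ := Icc (-(8 / 5 * 2 ^ l)) (8 / 5 * 2 ^ l) with hS
      have hSm : MeasurableSet S := measurableSet_Icc
      have e1 : ∀ s, ‖eta χ l s‖ₑ * G s = S.indicator 1 s * (‖eta χ l s‖ₑ * G s) := by
        intro s
        by_cases hs : s ∈ S
        · rw [indicator_of_mem hs, Pi.one_apply, one_mul]
        · rw [indicator_of_notMem hs, zero_mul, eta_eq_zero hχ, enorm_zero, zero_mul]
          by_contra! h
          exact hs (abs_le.1 h)
      -- The shell has length (16/5) 2^l ≤ 4 · 2^l.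
      have e2 : (∫⁻ s, (S.indicator 1 s : ℝ≥0∞) ^ 2) ^ (1 / 2 : ℝ) ≤
          2 * (2 : ℝ≥0∞) ^ ((l : ℝ) / 2) := by
        rw [rpow_half_le_iff, mul_pow, hpow]
        have : ∀ s, (S.indicator (1 : ℝ → ℝ≥0∞) s) ^ 2 = S.indicator 1 s := fun s => by
          by_cases hs : s ∈ S <;> simp [hs]
        simp_rw [this]
        rw [lintegral_indicator_one hSm, hS, Real.volume_Icc]
        calc _ ≤ ENNReal.ofReal (2 ^ 2 * 2 ^ l) := by
              refine ENNReal.ofReal_le_ofReal ?_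
              have : (0 : ℝ) < 2 ^ l := by positivity
              linarith
          _ = _ := by
              rw [ENNReal.ofReal_mul (by norm_num), ENNReal.ofReal_pow (by norm_num),
                ENNReal.ofReal_pow (by norm_num), ENNReal.ofReal_ofNat]
      rw [lintegral_congr e1]
      refine (lintegral_mul_le_sqrt volume (measurable_one.indicator hSm).aemeasurable
        (hηG l).aemeasurable).trans ?_
      rw [← mul_assoc]
      exact mul_le_mul' e2 le_rfl
    calc ∫⁻ s, G s ≤ ∫⁻ s, ∑' l, 2 * (‖eta χ l s‖ₑ * G s) := lintegral_mono h1
      _ = ∑' l, 2 * ∫⁻ s, ‖eta χ l s‖ₑ * G s := by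
          rw [lintegral_tsum fun l => ((hηG l).const_mul 2).aemeasurable]
          exact tsum_congr fun l => lintegral_const_mul _ (hηG l)
      _ ≤ ∑' l : ℕ, 2 * (2 * ((2 : ℝ≥0∞) ^ ((l : ℝ) / 2) * a l)) := by
          gcongr with l
          exact h2 l
      _ = _ := by
          rw [ENNReal.tsum_mul_left, ENNReal.tsum_mul_left, ← mul_assoc, hx]
          norm_num
  · intro L hL
    rw [rpow_half_le_iff, mul_pow, esqrt, rpow_half_sq]
    set S : Set ℝ := {s | L ≤ |s|}
    have hSm : MeasurableSet S := measurableSet_le measurable_const (by fun_prop)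
    have h1 : ∀ s ∈ S, G s ^ 2 ≤ ∑' l, ENNReal.ofReal (32 / 5 * L⁻¹) *
        (2 ^ l * (‖eta χ l s‖ₑ * G s) ^ 2) := by
      intro s hs
      obtain ⟨l, hl, hl2⟩ := half s
      have hsl : 1 ≤ ENNReal.ofReal (8 / 5 * L⁻¹) * 2 ^ l := by
        rw [← ENNReal.ofReal_ofNat, ← ENNReal.ofReal_pow (by norm_num),
          ← ENNReal.ofReal_mul (by positivity), ← ENNReal.ofReal_one]
        refine ENNReal.ofReal_le_ofReal ?_
        have : L ≤ 8 / 5 * 2 ^ l := le_trans hs hl2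
        rw [mul_right_comm, ← div_eq_mul_inv, le_div_iff₀ hL]
        linarith
      calc G s ^ 2 = 1 * (1 ^ 2 * G s ^ 2) := by ring
        _ ≤ ENNReal.ofReal (8 / 5 * L⁻¹) * 2 ^ l * ((2 * ‖eta χ l s‖ₑ) ^ 2 * G s ^ 2) := by
            gcongr
        _ = 4 * ENNReal.ofReal (8 / 5 * L⁻¹) * (2 ^ l * (‖eta χ l s‖ₑ * G s) ^ 2) := by ring
        _ = ENNReal.ofReal (32 / 5 * L⁻¹) * (2 ^ l * (‖eta χ l s‖ₑ * G s) ^ 2) := by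
            rw [← ENNReal.ofReal_ofNat, ← ENNReal.ofReal_mul (by norm_num)]
            congr 2; ring
        _ ≤ _ := ENNReal.le_tsum (f := fun l => ENNReal.ofReal (32 / 5 * L⁻¹) *
            (2 ^ l * (‖eta χ l s‖ₑ * G s) ^ 2)) l
    have hm : ∀ l : ℕ, Measurable fun s => (2 : ℝ≥0∞) ^ l * (‖eta χ l s‖ₑ * G s) ^ 2 := fun l =>
      ((hηG l).pow_const 2).const_mul _
    calc ∫⁻ s in S, G s ^ 2 ≤ ∫⁻ s in S, ∑' l, ENNReal.ofReal (32 / 5 * L⁻¹) *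
        (2 ^ l * (‖eta χ l s‖ₑ * G s) ^ 2) := setLIntegral_mono' hSm h1
      _ ≤ ∫⁻ s, ∑' l, ENNReal.ofReal (32 / 5 * L⁻¹) *
        (2 ^ l * (‖eta χ l s‖ₑ * G s) ^ 2) := setLIntegral_le_lintegral _ _
      _ = ∑' l : ℕ, ENNReal.ofReal (32 / 5 * L⁻¹) * ((2 : ℝ≥0∞) ^ ((l : ℝ) / 2) * a l) ^ 2 := by
          rw [lintegral_tsum fun l => ((hm l).const_mul _).aemeasurable]
          refine tsum_congr fun l => ?_
          rw [lintegral_const_mul _ (hm l), lintegral_const_mul _ ((hηG l).pow_const 2),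
            mul_pow, hpow, ha, rpow_half_sq]
      _ ≤ ENNReal.ofReal (32 / 5 * L⁻¹) * (xNorm χ ε F) ^ 2 := by
          rw [ENNReal.tsum_mul_left, hx]
          gcongr
          exact tsum_sq_le_sq_tsum _
      _ ≤ ENNReal.ofReal (16 * L⁻¹) * (xNorm χ ε F) ^ 2 := by
          gcongr
          norm_num
      _ = _ := by
          rw [ENNReal.ofReal_mul (by norm_num), mul_pow, ENNReal.ofReal_ofNat]
          ring

/-! ### Fourier inversion in time -/

lemma timeFourier_eq_fourier (w : ℝ → ℂ) (τ : ℝ) :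
    timeFourier w τ = FourierTransform.fourier w (τ / (2 * Real.pi)) := by
  rw [timeFourier, Real.fourier_real_eq_integral_exp_smul]
  refine integral_congr_ae (Eventually.of_forall fun t => ?_)
  simp only [smul_eq_mul]
  congr 2
  have : (Real.pi : ℂ) ≠ 0 := by exact_mod_cast Real.pi_ne_zero
  push_cast
  field_simp

lemma continuous_timeFourier {w : ℝ → ℂ} (hw : Integrable w) : Continuous (timeFourier w) := by
  have h : Continuous (FourierTransform.fourier w) :=
    VectorFourier.fourierIntegral_continuous Real.continuous_fourierChar continuous_inner hw
  simp_rw [funext (timeFourier_eq_fourier w)]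
  exact h.comp (by fun_prop)

/-- The shift by c makes the integration variable the modulation, with c playing the role of εω(k).
-/
lemma timeFourier_inversion {w : ℝ → ℂ} (hc : Continuous w) (hw : Integrable w)
    (hf : Integrable (timeFourier w)) (c t : ℝ) :
    w t = (2 * Real.pi : ℂ)⁻¹ *
      ∫ s : ℝ, Complex.exp (Complex.I * t * (s - c)) * timeFourier w (s - c) := by
  have hpi : (0 : ℝ) < 2 * Real.pi := by positivity
  have h1 : Integrable (FourierTransform.fourier w) := by
    have := hf.comp_mul_right' hpi.ne'
    refine this.congr (Eventually.of_forall fun x => ?_)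
    simp only [timeFourier_eq_fourier]
    field_simp
  have h2 := congr_fun (hc.fourierInv_fourier_eq hw h1) t
  rw [← h2, Real.fourierInv_eq']
  have h3 : ∫ s : ℝ, Complex.exp (Complex.I * t * (s - c)) * timeFourier w (s - c) =
      ∫ s : ℝ, Complex.exp (Complex.I * t * s) * timeFourier w s := by
    rw [← integral_sub_right_eq_self (fun s : ℝ =>
      Complex.exp (Complex.I * t * s) * timeFourier w s) c]
    push_cast
    rfl
  rw [h3]
  have h4 := Measure.integral_comp_mul_left
    (fun s : ℝ => Complex.exp (Complex.I * t * s) * timeFourier w s) (2 * Real.pi)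
  rw [abs_of_pos (by positivity)] at h4
  have h5 : (2 * Real.pi : ℂ)⁻¹ * ∫ s : ℝ, Complex.exp (Complex.I * t * s) * timeFourier w s =
      (2 * Real.pi)⁻¹ • ∫ s : ℝ, Complex.exp (Complex.I * t * s) * timeFourier w s := by
    rw [Complex.real_smul]; push_cast; rfl
  rw [h5, ← h4]
  refine integral_congr_ae (Eventually.of_forall fun x => ?_)
  simp only [timeFourier_eq_fourier, smul_eq_mul]
  congr 2
  · simp only [RCLike.inner_apply, conj_trivial]
    push_cast; ring
  · field_simp

/-! ### Products of three functions on a short window -/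

/-- A superposition of the oscillations `exp (i t (s - c))`. -/
def superpose (f : ℝ → ℂ) (c t : ℝ) : ℂ := ∫ s : ℝ, Complex.exp (Complex.I * t * (s - c)) * f s

/-- By Fubini the product of the three superpositions is an integral over (s₁, s₂, s₃), and the time
integral then falls on the exponentials alone. -/
lemma enorm_integral_superpose_le {f₁ f₂ f₃ : ℝ → ℂ} (h₁ : Integrable f₁) (h₂ : Integrable f₂)
    (h₃ : Integrable f₃) (c₁ c₂ c₃ a b : ℝ) :
    ‖∫ t in a..b, superpose f₁ c₁ t * superpose f₂ c₂ t * superpose f₃ c₃ t‖ₑ ≤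
      ∫⁻ z : (ℝ × ℝ) × ℝ, ‖f₁ z.1.1‖ₑ * ‖f₂ z.1.2‖ₑ * ‖f₃ z.2‖ₑ *
        ‖∫ t in a..b, Complex.exp (Complex.I * t * ((z.1.1 + z.1.2 + z.2 - (c₁ + c₂ + c₃) : ℝ)))‖ₑ := by
  set F : (ℝ × ℝ) × ℝ → ℂ := fun z => f₁ z.1.1 * f₂ z.1.2 * f₃ z.2 with hF
  set E : ℝ → (ℝ × ℝ) × ℝ → ℂ := fun t z =>
    Complex.exp (Complex.I * t * ((z.1.1 + z.1.2 + z.2 - (c₁ + c₂ + c₃) : ℝ))) with hE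
  have hFi : Integrable F := (h₁.mul_prod h₂).mul_prod h₃
  have hEc : Continuous fun p : ℝ × ((ℝ × ℝ) × ℝ) => E p.1 p.2 := by
    simp only [hE]; fun_prop
  have hEn : ∀ t z, ‖E t z‖ = 1 := fun t z => by
    simp only [hE]
    rw [show Complex.I * (t : ℂ) * ((z.1.1 + z.1.2 + z.2 - (c₁ + c₂ + c₃) : ℝ)) =
      ((t * (z.1.1 + z.1.2 + z.2 - (c₁ + c₂ + c₃)) : ℝ) : ℂ) * Complex.I by push_cast; ring]
    exact Complex.norm_exp_ofReal_mul_I _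
  have hprod : ∀ t, superpose f₁ c₁ t * superpose f₂ c₂ t * superpose f₃ c₃ t =
      ∫ z, E t z * F z := by
    intro t
    unfold superpose
    rw [← integral_prod_mul, ← integral_prod_mul]
    refine integral_congr_ae (Eventually.of_forall fun z => ?_)
    simp only [hE, hF]
    rw [show Complex.I * (t : ℂ) * ((z.1.1 + z.1.2 + z.2 - (c₁ + c₂ + c₃) : ℝ)) =
      Complex.I * t * (z.1.1 - c₁) + Complex.I * t * (z.1.2 - c₂) + Complex.I * t * (z.2 - c₃) by
        push_cast; ring, Complex.exp_add, Complex.exp_add]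
    ring
  have hint : Integrable (Function.uncurry fun t z => E t z * F z)
      ((volume.restrict (uIoc a b)).prod volume) := by
    have hfin : IsFiniteMeasure (volume.restrict (uIoc a b)) := by
      unfold uIoc; infer_instance
    have h0 : Integrable (fun p : ℝ × ((ℝ × ℝ) × ℝ) => (1 : ℂ) * F p.2)
        ((volume.restrict (uIoc a b)).prod volume) := (integrable_const (1 : ℂ)).mul_prod hFi
    refine h0.mono (hEc.aestronglyMeasurable.mul (by simpa using h0.aestronglyMeasurable))
      (Eventually.of_forall fun p => ?_)
    simp [Function.uncurry, hEn]
  have hswap : ∫ t in uIoc a b, ∫ z, E t z * F z = ∫ z, ∫ t in uIoc a b, E t z * F z :=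
    integral_integral_swap hint
  simp_rw [hprod]
  have e1 : ∀ g : ℝ → ℂ, ‖∫ t in a..b, g t‖ₑ = ‖∫ t in uIoc a b, g t‖ₑ := fun g => by
    rw [← ofReal_norm, ← ofReal_norm, intervalIntegral.norm_intervalIntegral_eq]
  rw [e1, hswap]
  refine (enorm_integral_le_lintegral_enorm _).trans_eq (lintegral_congr fun z => ?_)
  rw [integral_mul_const, enorm_mul, ← e1, mul_comm]
  simp only [hF, enorm_mul]
  rfl

/-- Interpolation between the trivial bound |b - a| and the oscillatory bound 2/|Φ|. A quarter power
of the length of the window is kept and becomes the power of T in the theorem; the remaining 3/4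
gives a square integrable kernel. -/
lemma enorm_integral_exp_le {a b A : ℝ} (hA : 0 < A) (hab : |b - a| ≤ A⁻¹) (Φ : ℝ) :
    ‖∫ t in a..b, Complex.exp (Complex.I * t * (Φ : ℝ))‖ₑ ≤
      esqrt (Real.sqrt (27 * |b - a|)) * ker A Φ := by
  set X := ‖∫ t in a..b, Complex.exp (Complex.I * t * (Φ : ℝ))‖ with hX
  set δ := |b - a| with hδ
  have hδ0 : 0 ≤ δ := abs_nonneg _
  have hX0 : 0 ≤ X := norm_nonneg _
  have hn : ∀ t : ℝ, ‖Complex.exp (Complex.I * t * (Φ : ℝ))‖ = 1 := fun t => by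
    rw [show Complex.I * (t : ℂ) * (Φ : ℝ) = ((t * Φ : ℝ) : ℂ) * Complex.I by push_cast; ring]
    exact Complex.norm_exp_ofReal_mul_I _
  have b1 : X ≤ δ := by
    have := intervalIntegral.norm_integral_le_of_norm_le_const (a := a) (b := b) (C := 1)
      (f := fun t : ℝ => Complex.exp (Complex.I * t * (Φ : ℝ))) (fun t _ => (hn t).le)
    simpa using this
  have b2 : X * |Φ| ≤ 2 := by
    rcases eq_or_ne Φ 0 with h | h
    · rw [h]; simp
    have hc : Complex.I * (Φ : ℂ) ≠ 0 := mul_ne_zero Complex.I_ne_zero (by exact_mod_cast h)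
    have e : ∫ t in a..b, Complex.exp (Complex.I * t * (Φ : ℝ)) =
        (Complex.exp (Complex.I * b * (Φ : ℝ)) - Complex.exp (Complex.I * a * (Φ : ℝ))) /
          (Complex.I * Φ) := by
      have := integral_exp_mul_complex (a := a) (b := b) hc
      simp_rw [mul_right_comm Complex.I _ (Φ : ℂ)]
      exact this
    rw [hX, e, norm_div, norm_mul, Complex.norm_I, one_mul, Complex.norm_real, Real.norm_eq_abs,
      div_mul_cancel₀ _ (abs_ne_zero.2 h)]
    refine (norm_sub_le _ _).trans ?_
    rw [hn, hn]; norm_num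
  have b3 : X * (A + |Φ|) ≤ 3 := by
    have : X * A ≤ 1 := by
      calc X * A ≤ A⁻¹ * A := by gcongr; exact b1.trans hab
        _ = 1 := inv_mul_cancel₀ hA.ne'
    linarith
  set Y := A + |Φ| with hY
  have hY0 : 0 < Y := by positivity
  -- One of the four factors X is bounded by δ, the other three by 3/Y.
  have b4 : X ^ 4 * Y ^ 3 ≤ 27 * δ := by
    calc X ^ 4 * Y ^ 3 = X * (X * Y) ^ 3 := by ring
      _ ≤ δ * 3 ^ 3 := by gcongr
      _ = _ := by ring
  have hk : kerSq A Φ ^ 2 = (Y ^ 3)⁻¹ := by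
    rw [kerSq, ← hY, ← Real.rpow_natCast, ← Real.rpow_mul hY0.le, ← Real.rpow_natCast,
      ← Real.rpow_neg hY0.le]
    norm_num
  have b5 : X ^ 2 ≤ Real.sqrt (27 * δ) * kerSq A Φ := by
    refine le_of_sq_le_sq ?_ (mul_nonneg (Real.sqrt_nonneg _) (kerSq_nonneg hA.le _))
    rw [mul_pow, Real.sq_sqrt (by positivity), hk, ← div_eq_mul_inv, le_div_iff₀ (by positivity)]
    calc (X ^ 2) ^ 2 * Y ^ 3 = X ^ 4 * Y ^ 3 := by ring
      _ ≤ _ := b4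
  calc ‖∫ t in a..b, Complex.exp (Complex.I * t * (Φ : ℝ))‖ₑ = ENNReal.ofReal X := by
        rw [hX, ofReal_norm]
    _ = esqrt (X ^ 2) := (esqrt_sq hX0).symm
    _ ≤ esqrt (Real.sqrt (27 * δ) * kerSq A Φ) := esqrt_mono b5
    _ = esqrt (Real.sqrt (27 * δ)) * esqrt (kerSq A Φ) := (esqrt_mul (Real.sqrt_nonneg _) _).symm
    _ = _ := rfl

lemma enorm_integral_superpose_le_modForm {f₁ f₂ f₃ : ℝ → ℂ} (h₁ : Integrable f₁)
    (h₂ : Integrable f₂) (h₃ : Integrable f₃) (m₁ : Measurable f₁) (m₂ : Measurable f₂)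
    (m₃ : Measurable f₃) (c₁ c₂ c₃ : ℝ) {a b A : ℝ} (hA : 0 < A) (hab : |b - a| ≤ A⁻¹) :
    ‖∫ t in a..b, superpose f₁ c₁ t * superpose f₂ c₂ t * superpose f₃ c₃ t‖ₑ ≤
      esqrt (Real.sqrt (27 * |b - a|)) * modForm (ker A) (-(c₁ + c₂ + c₃))
        (fun s => ‖f₁ s‖ₑ) (fun s => ‖f₂ s‖ₑ) (fun s => ‖f₃ s‖ₑ) := by
  refine (enorm_integral_superpose_le h₁ h₂ h₃ c₁ c₂ c₃ a b).trans ?_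
  have hk := measurable_ker A
  have hm : Measurable fun z : (ℝ × ℝ) × ℝ => ‖f₁ z.1.1‖ₑ * ‖f₂ z.1.2‖ₑ * ‖f₃ z.2‖ₑ *
      ker A (z.1.1 + z.1.2 + z.2 + -(c₁ + c₂ + c₃)) := by fun_prop
  calc _ ≤ ∫⁻ z : (ℝ × ℝ) × ℝ, esqrt (Real.sqrt (27 * |b - a|)) *
        (‖f₁ z.1.1‖ₑ * ‖f₂ z.1.2‖ₑ * ‖f₃ z.2‖ₑ *
          ker A (z.1.1 + z.1.2 + z.2 + -(c₁ + c₂ + c₃))) := by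
        refine lintegral_mono fun z => ?_
        rw [mul_left_comm]
        refine mul_le_mul' le_rfl ?_
        rw [← sub_eq_add_neg]
        exact enorm_integral_exp_le hA hab _
    _ = _ := by
        rw [lintegral_const_mul _ hm, Measure.volume_eq_prod, lintegral_prod _ hm.aemeasurable,
          Measure.volume_eq_prod, lintegral_prod _ hm.lintegral_prod_right'.aemeasurable]
        rfl

/-! ### The energy identity -/

/-- The Fourier coefficients `a` of a solution on `[-T, T]`, with `q` those of its square. -/
structure FourierFlow (T : ℝ) (a q : ℝ → Freq → ℂ) : Prop where
  eq_zero : ∀ s ∈ Icc (-T) T, ∀ k : Freq, k 0 = 0 → a s k = 0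
  conj : ∀ s ∈ Icc (-T) T, ∀ k, (starRingEnd ℂ) (a s k) = a s (-k)
  continuousOn : ∀ k, ContinuousOn (fun s => a s k) (Icc (-T) T)
  bounded : ∀ σ : ℝ, 2 ≤ σ → ∃ B : ℝ≥0, ∀ s ∈ Icc (-T) T, energyNorm σ (a s) ≤ B
  hasSum : ∀ s ∈ Icc (-T) T, ∀ k, HasSum (fun i => a s i * a s (k - i)) (q s k)
  deriv : ∀ s ∈ Icc (-T) T, ∀ k, HasDerivWithinAt (fun s => a s k)
    (Complex.I * omega k * a s k - Complex.I * (k 0 : ℂ) / 2 * q s k) (Icc (-T) T) s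

/-- The time integral of the product of three coefficients whose frequencies add up to zero. -/
def tripInt (a : ℝ → Freq → ℂ) (t : ℝ) (k₁ k₂ : Freq) : ℂ :=
  ∫ s in (0 : ℝ)..t, a s k₁ * a s k₂ * a s (-k₁ - k₂)

lemma tripInt_swap (a : ℝ → Freq → ℂ) (t : ℝ) (k₁ k₂ : Freq) :
    tripInt a t k₂ k₁ = tripInt a t k₁ k₂ := by
  unfold tripInt
  simp_rw [show -k₂ - k₁ = -k₁ - k₂ by abel, mul_comm (a _ k₂) (a _ k₁)]

lemma tripInt_swap_right (a : ℝ → Freq → ℂ) (t : ℝ) (k₁ k₂ : Freq) :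
    tripInt a t k₁ (-k₁ - k₂) = tripInt a t k₁ k₂ := by
  unfold tripInt
  simp_rw [sub_sub_cancel, mul_right_comm]

lemma energyNorm_eq (σ : ℝ) (a : Freq → ℂ) : energyNorm σ a =
    l2 (fun k => ENNReal.ofReal (bracket (k 0 : ℝ) ^ σ * weight k) * ‖a k‖ₑ) := rfl

lemma one_le_energyWeight {σ : ℝ} (hσ : 0 ≤ σ) (k : Freq) :
    1 ≤ ENNReal.ofReal (bracket (k 0 : ℝ) ^ σ * weight k) := by
  rw [← ENNReal.ofReal_one]
  exact ENNReal.ofReal_le_ofReal (one_le_mul_of_one_le_of_one_le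
    (Real.one_le_rpow (one_le_bracket _) hσ) (one_le_weight k))

lemma enorm_le_energyNorm {σ : ℝ} (hσ : 0 ≤ σ) (a : Freq → ℂ) (k : Freq) :
    ‖a k‖ₑ ≤ energyNorm σ a := by
  calc ‖a k‖ₑ = 1 * ‖a k‖ₑ := (one_mul _).symm
    _ ≤ ENNReal.ofReal (bracket (k 0 : ℝ) ^ σ * weight k) * ‖a k‖ₑ := by
        gcongr; exact one_le_energyWeight hσ k
    _ ≤ _ := le_l2 (fun k => ENNReal.ofReal (bracket (k 0 : ℝ) ^ σ * weight k) * ‖a k‖ₑ) k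

lemma l2_enorm_le_energyNorm {σ : ℝ} (hσ : 0 ≤ σ) (a : Freq → ℂ) :
    l2 (fun k => ‖a k‖ₑ) ≤ energyNorm σ a := by
  rw [energyNorm_eq]
  exact l2_mono fun k => le_mul_of_one_le_left' (one_le_energyWeight hσ k)

/-- The size `(1 + |m|) (1 + |n|)` of a frequency. -/
def freqSize (k : Freq) : ℝ := (1 + |(k 0 : ℝ)|) * (1 + |(k 1 : ℝ)|)

lemma one_le_freqSize (k : Freq) : 1 ≤ freqSize k :=
  one_le_mul_of_one_le_of_one_le (by linarith [abs_nonneg (k 0 : ℝ)])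
    (by linarith [abs_nonneg (k 1 : ℝ)])

/-- The E⁴ norm dominates a product weight whose inverse is square summable over ℤ². This serves
only for the absolute convergence of the sums in the energy identity. -/
lemma freqSize_le {k : Freq} (hk : k 0 ≠ 0) :
    freqSize k ≤ 6 * (bracket (k 0 : ℝ) ^ (4 : ℝ) * weight k) := by
  have h1 := one_le_abs_intCast hk
  have h2 := abs_snd_le hk
  have h3 := one_le_weight k
  have h4 := abs_le_bracket (k 0 : ℝ)
  rw [show (4 : ℝ) = (4 : ℕ) by norm_num, Real.rpow_natCast]
  set m := |(k 0 : ℝ)|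
  set n := |(k 1 : ℝ)|
  have h5 : 1 ≤ m ^ 3 * weight k := one_le_mul_of_one_le_of_one_le (one_le_pow₀ h1) h3
  calc freqSize k = (1 + m) * (1 + n) := rfl
    _ ≤ (2 * m) * (3 * (m ^ 3 * weight k)) := by
        gcongr
        · linarith
        · linarith
    _ = 6 * (m ^ 4 * weight k) := by ring
    _ ≤ _ := by gcongr

lemma l2_freqSize_le {a : Freq → ℂ} (ha : ∀ k : Freq, k 0 = 0 → a k = 0) :
    l2 (fun k => ENNReal.ofReal (freqSize k) * ‖a k‖ₑ) ≤ 6 * energyNorm 4 a := by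
  rw [energyNorm_eq, ← l2_const_mul]
  refine l2_mono fun k => ?_
  by_cases hk : k 0 = 0
  · simp [ha k hk]
  · rw [← mul_assoc, ← ENNReal.ofReal_ofNat, ← ENNReal.ofReal_mul (by norm_num)]
    gcongr
    exact freqSize_le hk

/-- The sum of the inverse squared sizes of the frequencies. -/
def freqSum : ℝ≥0∞ := ∑' k : Freq, ENNReal.ofReal (freqSize k)⁻¹ ^ 2

lemma freqSum_ne_top : freqSum ≠ ⊤ := by
  have h1 : ∑' n : ℤ, ENNReal.ofReal ((1 + |(n : ℝ)|)⁻¹ ^ 2) ≠ ⊤ := by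
    refine ne_top_of_le_ne_top (ENNReal.ofReal_ne_top (r := 5 * 1))
      (le_trans (ENNReal.tsum_le_tsum fun n => ENNReal.ofReal_le_ofReal ?_)
        (tsum_inv_one_add_sq_le (R := 1) le_rfl))
    rw [inv_pow]
    apply inv_anti₀ (by positivity)
    rw [div_one, ← sq_abs (n : ℝ)]
    nlinarith [abs_nonneg (n : ℝ)]
  rw [freqSum, tsum_freq]
  have e : ∀ m n : ℤ, ENNReal.ofReal (freqSize ![m, n])⁻¹ ^ 2 =
      ENNReal.ofReal ((1 + |(m : ℝ)|)⁻¹ ^ 2) * ENNReal.ofReal ((1 + |(n : ℝ)|)⁻¹ ^ 2) := by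
    intro m n
    rw [← ENNReal.ofReal_pow (inv_nonneg.2 (zero_le_one.trans (one_le_freqSize _))),
      ← ENNReal.ofReal_mul (by positivity), freqSize, mul_inv, mul_pow]
    rfl
  simp_rw [e, ENNReal.tsum_mul_left, ENNReal.tsum_mul_right]
  exact ENNReal.mul_ne_top h1 h1

lemma abs_enMul_le (σ : ℝ) (j : ℕ) (k : Freq) :
    |enMul σ j k| ≤ ((2 : ℝ) ^ j) ^ (2 * σ) * (4 * 2 ^ j) * (1 + (k 1 : ℝ) ^ 2) := by
  have hM0 : (0 : ℝ) < 2 ^ j := by positivity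
  by_cases hk : k 0 = 0
  · rw [enMul, hk]
    simp only [Int.cast_zero, mul_zero, abs_zero]
    positivity
  rw [enMul_eq hk]
  have hM1 : (1 : ℝ) ≤ (2 ^ j) ^ 6 := one_le_pow₀ (one_le_pow₀ (by norm_num))
  have h1 : |oddCut (2 ^ j) (k 0 : ℝ)| ≤ 4 * 2 ^ j := by
    by_cases h : oddCut (2 ^ j) (k 0 : ℝ) = 0
    · rw [h, abs_zero]; positivity
    · linarith [abs_oddCut_le hM0 (k 0 : ℝ), (oddCut_support hM0 h).2]
  rw [abs_mul, abs_mul, abs_of_nonneg (by positivity : (0 : ℝ) ≤ ((2 : ℝ) ^ j) ^ (2 * σ)),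
    abs_of_nonneg (by positivity : (0 : ℝ) ≤ 1 + (k 1 : ℝ) ^ 2 / (2 ^ j) ^ 6), mul_assoc]
  gcongr
  exact div_le_self (sq_nonneg _) hM1

/-- The quadratic growth in n₃ is shared: one factor is charged to k₃, the other to k₁ or k₂ by the
triangle inequality. Only one of the three functions is left without weight, as Schur's test allows.
-/
lemma one_add_sq_le_freqSize (k₁ k₂ : Freq) : 1 + ((-k₁ - k₂) 1 : ℝ) ^ 2 ≤
    freqSize (-k₁ - k₂) * (freqSize k₁ + freqSize k₂) := by
  have h : |(((-k₁ - k₂) 1 : ℤ) : ℝ)| ≤ |(k₁ 1 : ℝ)| + |(k₂ 1 : ℝ)| := by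
    simp only [Pi.sub_apply, Pi.neg_apply, Int.cast_sub, Int.cast_neg]
    rw [← abs_neg (k₁ 1 : ℝ)]; exact abs_sub _ _
  have h2 : ∀ k : Freq, 1 + |(k 1 : ℝ)| ≤ freqSize k := fun k =>
    le_mul_of_one_le_left (by positivity) (by linarith [abs_nonneg (k 0 : ℝ)])
  rw [← sq_abs]
  set x := |(((-k₁ - k₂) 1 : ℤ) : ℝ)|
  have hx : 0 ≤ x := abs_nonneg _
  calc 1 + x ^ 2 ≤ (1 + x) * (1 + |(k₁ 1 : ℝ)| + (1 + |(k₂ 1 : ℝ)|)) := by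
        nlinarith [abs_nonneg (k₁ 1 : ℝ), abs_nonneg (k₂ 1 : ℝ)]
    _ ≤ _ := by
        have h3 := zero_le_one.trans (one_le_freqSize (-k₁ - k₂))
        exact mul_le_mul (h2 _) (add_le_add (h2 _) (h2 _)) (by positivity) h3

/-- Absolute convergence of the cubic sum in the energy identity. -/
lemma tsum_enMul_le (σ : ℝ) (j : ℕ) {a : Freq → ℂ} (ha : ∀ k : Freq, k 0 = 0 → a k = 0) :
    ∑' k₁, ∑' k₂, ‖enMul σ j (-k₁ - k₂)‖ₑ * (‖a k₁‖ₑ * ‖a k₂‖ₑ * ‖a (-k₁ - k₂)‖ₑ) ≤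
      ENNReal.ofReal (((2 : ℝ) ^ j) ^ (2 * σ) * (4 * 2 ^ j)) *
        (2 * (freqSum ^ (1 / 2 : ℝ) * (6 * energyNorm 4 a) ^ 3)) := by
  set K := ((2 : ℝ) ^ j) ^ (2 * σ) * (4 * 2 ^ j) with hK
  have hK0 : 0 ≤ K := by positivity
  set g : Freq → ℝ≥0∞ := fun k => ENNReal.ofReal (freqSize k) * ‖a k‖ₑ
  have hpos : ∀ k, 0 < freqSize k := fun k => zero_lt_one.trans_le (one_le_freqSize k)
  have hg : ∀ k, ‖a k‖ₑ = ENNReal.ofReal (freqSize k)⁻¹ * g k := fun k => by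
    simp only [g]
    rw [← mul_assoc, ← ENNReal.ofReal_mul (inv_nonneg.2 (hpos k).le),
      inv_mul_cancel₀ (hpos k).ne', ENNReal.ofReal_one, one_mul]
  have h1 : ∀ k₁ k₂, ‖enMul σ j (-k₁ - k₂)‖ₑ * (‖a k₁‖ₑ * ‖a k₂‖ₑ * ‖a (-k₁ - k₂)‖ₑ) ≤
      ENNReal.ofReal K * ((ENNReal.ofReal (freqSize k₂)⁻¹ + ENNReal.ofReal (freqSize k₁)⁻¹) *
        (g k₁ * g k₂ * g (-k₁ - k₂))) := by
    intro k₁ k₂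
    have e1 : ‖enMul σ j (-k₁ - k₂)‖ₑ ≤ ENNReal.ofReal K * (ENNReal.ofReal (freqSize (-k₁ - k₂)) *
        (ENNReal.ofReal (freqSize k₁) + ENNReal.ofReal (freqSize k₂))) := by
      rw [Real.enorm_eq_ofReal_abs, ← ENNReal.ofReal_add (hpos _).le (hpos _).le,
        ← ENNReal.ofReal_mul (hpos _).le, ← ENNReal.ofReal_mul hK0]
      refine ENNReal.ofReal_le_ofReal ((abs_enMul_le _ _ _).trans ?_)
      gcongr
      exact one_add_sq_le_freqSize k₁ k₂
    calc _ ≤ ENNReal.ofReal K * (ENNReal.ofReal (freqSize (-k₁ - k₂)) *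
        (ENNReal.ofReal (freqSize k₁) + ENNReal.ofReal (freqSize k₂))) *
        (‖a k₁‖ₑ * ‖a k₂‖ₑ * ‖a (-k₁ - k₂)‖ₑ) := by gcongr
      _ = ENNReal.ofReal K * ((g k₁ * ‖a k₂‖ₑ + ‖a k₁‖ₑ * g k₂) * g (-k₁ - k₂)) := by
          simp only [g]; ring
      _ = _ := by rw [hg k₁, hg k₂]; ring
  have c1 : triForm (fun k₁ _ => ENNReal.ofReal (freqSize k₁)⁻¹) g g g ≤
      freqSum ^ (1 / 2 : ℝ) * (l2 g * l2 g * l2 g) := triForm_le (fun k₂ => le_rfl) _ _ _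
  have c2 : triForm (fun _ k₂ => ENNReal.ofReal (freqSize k₂)⁻¹) g g g ≤
      freqSum ^ (1 / 2 : ℝ) * (l2 g * l2 g * l2 g) := by rw [triForm_swap]; exact c1
  have hl : l2 g ≤ 6 * energyNorm 4 a := l2_freqSize_le ha
  calc _ ≤ ∑' k₁, ∑' k₂, ENNReal.ofReal K * ((ENNReal.ofReal (freqSize k₂)⁻¹ +
        ENNReal.ofReal (freqSize k₁)⁻¹) * (g k₁ * g k₂ * g (-k₁ - k₂))) :=
        ENNReal.tsum_le_tsum fun k₁ => ENNReal.tsum_le_tsum fun k₂ => h1 k₁ k₂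
    _ = ENNReal.ofReal K * (triForm (fun _ k₂ => ENNReal.ofReal (freqSize k₂)⁻¹) g g g +
          triForm (fun k₁ _ => ENNReal.ofReal (freqSize k₁)⁻¹) g g g) := by
        rw [← triForm_add]
        simp only [triForm, ENNReal.tsum_mul_left]
    _ ≤ ENNReal.ofReal K * (freqSum ^ (1 / 2 : ℝ) * (l2 g * l2 g * l2 g) +
          freqSum ^ (1 / 2 : ℝ) * (l2 g * l2 g * l2 g)) := by gcongr
    _ ≤ ENNReal.ofReal K * (2 * (freqSum ^ (1 / 2 : ℝ) * (6 * energyNorm 4 a) ^ 3)) := by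
        rw [← two_mul, show l2 g * l2 g * l2 g = l2 g ^ 3 by ring]
        gcongr

lemma uIoc_subset_Icc {T t : ℝ} (hT : 0 ≤ T) (ht : t ∈ Icc (-T) T) : uIoc 0 t ⊆ Icc (-T) T :=
  uIoc_subset_uIcc.trans (uIcc_subset_Icc ⟨by linarith, hT⟩ ht)

lemma FourierFlow.aestronglyMeasurable {T : ℝ} {a q : ℝ → Freq → ℂ} (h : FourierFlow T a q) {t : ℝ} (hT : 0 ≤ T)
    (ht : t ∈ Icc (-T) T) (k : Freq) :
    AEStronglyMeasurable (fun s => a s k) (volume.restrict (uIoc 0 t)) :=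
  (((h.continuousOn k).mono (uIoc_subset_Icc hT ht)).aestronglyMeasurable measurableSet_uIoc)

lemma FourierFlow.intervalIntegrable_trip {T : ℝ} {a q : ℝ → Freq → ℂ} (h : FourierFlow T a q) {t : ℝ} (hT : 0 ≤ T)
    (ht : t ∈ Icc (-T) T) (k₁ k₂ k₃ : Freq) :
    IntegrableOn (fun s => a s k₁ * a s k₂ * a s k₃) (uIoc 0 t) := by
  have hc : ContinuousOn (fun s => a s k₁ * a s k₂ * a s k₃) (uIcc 0 t) :=
    (((h.continuousOn k₁).mul (h.continuousOn k₂)).mul (h.continuousOn k₃)).mono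
      (uIcc_subset_Icc ⟨by linarith, hT⟩ ht)
  exact (hc.integrableOn_uIcc).mono_set uIoc_subset_uIcc

/-- The sum of the time integrals is the time integral of the sum. -/
lemma FourierFlow.hasSum_tripInt {T : ℝ} {a q : ℝ → Freq → ℂ} (h : FourierFlow T a q) {t : ℝ} (hT : 0 ≤ T)
    (ht : t ∈ Icc (-T) T) (k : Freq) :
    IntervalIntegrable (fun s => q s (-k) * a s k) volume 0 t ∧
    HasSum (fun i => tripInt a t i (-k - i)) (∫ s in (0 : ℝ)..t, q s (-k) * a s k) := by
  obtain ⟨B, hB⟩ := h.bounded 2 le_rfl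
  set F : Freq → ℝ → ℂ := fun i s => a s i * a s (-k - i) * a s k with hF
  set μ := (volume : Measure ℝ).restrict (uIoc 0 t) with hμ
  have hmem : ∀ᵐ s ∂μ, s ∈ Icc (-T) T :=
    (ae_restrict_mem measurableSet_uIoc).mono fun s hs => uIoc_subset_Icc hT ht hs
  have hFi : ∀ i, Integrable (F i) μ := fun i => h.intervalIntegrable_trip hT ht i (-k - i) k
  have hsum : ∀ᵐ s ∂μ, HasSum (fun i => F i s) (q s (-k) * a s k) := by
    filter_upwards [hmem] with s hs
    exact (h.hasSum s hs (-k)).mul_right _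
  -- The series is dominated uniformly in s, which justifies exchanging it with the time integral.
  have hpt : ∀ s ∈ Icc (-T) T, ∑' i, ‖F i s‖ₑ ≤ (B : ℝ≥0∞) ^ 3 := by
    intro s hs
    have hb := hB s hs
    have hl := (l2_enorm_le_energyNorm (σ := 2) (by norm_num) (a s)).trans hb
    have hk := (enorm_le_energyNorm (σ := 2) (by norm_num) (a s) k).trans hb
    calc ∑' i, ‖F i s‖ₑ = (∑' i, ‖a s i‖ₑ * ‖a s (-k - i)‖ₑ) * ‖a s k‖ₑ := by
          simp only [hF, enorm_mul, ENNReal.tsum_mul_right]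
      _ ≤ (l2 (fun i => ‖a s i‖ₑ) * l2 (fun i => ‖a s (-k - i)‖ₑ)) * ‖a s k‖ₑ := by
          gcongr; exact tsum_mul_le_l2 _ _
      _ = (l2 (fun i => ‖a s i‖ₑ) * l2 (fun i => ‖a s i‖ₑ)) * ‖a s k‖ₑ := by
          congr 2
          unfold l2
          congr 1
          exact (thirdEquiv k).tsum_eq (fun i => ‖a s i‖ₑ ^ 2)
      _ ≤ B * B * B := by gcongr
      _ = _ := by ring
  have hfin : ∑' i, ∫⁻ s, ‖F i s‖ₑ ∂μ ≠ ⊤ := by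
    rw [← lintegral_tsum fun i => (hFi i).aestronglyMeasurable.enorm]
    refine ne_top_of_le_ne_top ?_ (lintegral_mono_ae (g := fun _ => (B : ℝ≥0∞) ^ 3)
      (hmem.mono fun s hs => hpt s hs))
    rw [lintegral_const, hμ, Measure.restrict_apply_univ]
    refine ENNReal.mul_ne_top (by simp) ?_
    rw [uIoc, Real.volume_Ioc]; exact ENNReal.ofReal_ne_top
  have hsummable : Summable fun i => ∫ s, ‖F i s‖ ∂μ := by
    have := ENNReal.summable_toReal hfin
    refine this.congr fun i => ?_
    rw [integral_norm_eq_lintegral_enorm (hFi i).aestronglyMeasurable]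
  -- Nothing is assumed on the regularity of q in time; it is measurable as a limit of finite sums.
  have hmeas : AEStronglyMeasurable (fun s => q s (-k) * a s k) μ :=
    aestronglyMeasurable_of_tendsto_ae (u := atTop) (f := fun (S : Finset Freq) s => ∑ i ∈ S, F i s)
      (fun S => Finset.aestronglyMeasurable_fun_sum S fun i _ => (hFi i).aestronglyMeasurable) hsum
  have hint : IntegrableOn (fun s => q s (-k) * a s k) (uIoc 0 t) := by
    refine ⟨hmeas, ?_⟩
    refine lt_of_le_of_lt (lintegral_mono_ae (g := fun s => ∑' i, ‖F i s‖ₑ) ?_) ?_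
    · filter_upwards [hsum] with s hs
      rw [← hs.tsum_eq]
      exact enorm_tsum_le_tsum_enorm
    · rw [lintegral_tsum fun i => (hFi i).aestronglyMeasurable.enorm]
      exact hfin.lt_top
  refine ⟨intervalIntegrable_iff.2 hint, ?_⟩
  have hs := hasSum_integral_of_summable_integral_norm hFi hsummable
  have e1 : ∫ s, ∑' i, F i s ∂μ = ∫ s, q s (-k) * a s k ∂μ :=
    integral_congr_ae (hsum.mono fun s hs => hs.tsum_eq)
  rw [e1] at hs
  have key : ∀ i s, a s i * a s (-k - i) * a s (-i - (-k - i)) = F i s := fun i s => by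
    rw [show -i - (-k - i) = k by abel]
  -- The sign accounts for the orientation of the integral when t < 0.
  have hs2 := hs.const_smul (if (0 : ℝ) ≤ t then (1 : ℝ) else -1)
  convert! hs2 using 1
  · ext i
    rw [tripInt, intervalIntegral.intervalIntegral_eq_integral_uIoc]
    simp_rw [key]
    rfl
  · rw [intervalIntegral.intervalIntegral_eq_integral_uIoc]

/-- The energy balance at a single frequency. -/
lemma FourierFlow.sub_eq {T : ℝ} {a q : ℝ → Freq → ℂ} (h : FourierFlow T a q) {t : ℝ} (hT : 0 ≤ T) (ht : t ∈ Icc (-T) T)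
    (k : Freq) : a t k * a t (-k) - a 0 k * a 0 (-k) =
      Complex.I / 2 * ((k 0 : ℂ) * (∑' i, tripInt a t i (-k - i)) +
        (-k 0 : ℂ) * (∑' i, tripInt a t i (- -k - i))) := by
  have s1 := h.hasSum_tripInt hT ht k
  have s2 := h.hasSum_tripInt hT ht (-k)
  rw [s1.2.tsum_eq, s2.2.tsum_eq]
  have hsub : uIcc 0 t ⊆ Icc (-T) T := uIcc_subset_Icc ⟨by linarith, hT⟩ ht
  have hftc := intervalIntegral.integral_eq_sub_of_hasDeriv_right (a := 0) (b := t)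
    (f := fun s => a s k * a s (-k))
    (f' := fun s => Complex.I / 2 * ((k 0 : ℂ) * (q s (-k) * a s k) +
      (-k 0 : ℂ) * (q s (- -k) * a s (-k))))
    (((h.continuousOn k).mul (h.continuousOn (-k))).mono hsub) ?_
    (((s1.1.const_mul _).add (s2.1.const_mul _)).const_mul _)
  · rw [← hftc, intervalIntegral.integral_const_mul, intervalIntegral.integral_add
      (s1.1.const_mul _) (s2.1.const_mul _), intervalIntegral.integral_const_mul,
      intervalIntegral.integral_const_mul]
  · intro x hx
    have hx1 : x ∈ Icc (-T) T := hsub (Ioo_subset_Icc_self hx)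
    have hnhds : Icc (-T) T ∈ 𝓝 x :=
      mem_of_superset (isOpen_Ioo.mem_nhds hx) (Ioo_subset_Icc_self.trans hsub)
    have d1 := (h.deriv x hx1 k).hasDerivAt hnhds
    have d2 := (h.deriv x hx1 (-k)).hasDerivAt hnhds
    have := (d1.mul d2).hasDerivWithinAt (s := Ioi x)
    convert! this using 1
    -- The dispersive terms of k and -k cancel because ω is odd.
    rw [neg_neg, omega_neg]
    simp only [Pi.neg_apply]
    push_cast
    ring

lemma enorm_complex_ofReal (x : ℝ) : ‖(x : ℂ)‖ₑ = ‖x‖ₑ := by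
  rw [← ofReal_norm, ← ofReal_norm, Complex.norm_real]

/-- Absolute summability of the cubic sum in the energy identity. -/
lemma FourierFlow.summable_enMul {T : ℝ} {a q : ℝ → Freq → ℂ} (h : FourierFlow T a q)
    (σ : ℝ) (j : ℕ) {t : ℝ} (hT : 0 ≤ T) (ht : t ∈ Icc (-T) T) :
    Summable fun p : Freq × Freq => (enMul σ j (-p.1 - p.2) : ℂ) * tripInt a t p.1 p.2 := by
  obtain ⟨B, hB⟩ := h.bounded 4 (by norm_num)
  set μ := (volume : Measure ℝ).restrict (uIoc 0 t) with hμ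
  have hmem : ∀ᵐ s ∂μ, s ∈ Icc (-T) T :=
    (ae_restrict_mem measurableSet_uIoc).mono fun s hs => uIoc_subset_Icc hT ht hs
  set G : Freq × Freq → ℝ → ℝ≥0∞ := fun p s => ‖enMul σ j (-p.1 - p.2)‖ₑ *
    (‖a s p.1‖ₑ * ‖a s p.2‖ₑ * ‖a s (-p.1 - p.2)‖ₑ) with hG
  have hm : ∀ p, AEMeasurable (G p) μ := fun p =>
    ((((h.aestronglyMeasurable hT ht p.1).enorm).mul
      ((h.aestronglyMeasurable hT ht p.2).enorm)).mul
        ((h.aestronglyMeasurable hT ht _).enorm)).const_mul _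
  set D : ℝ≥0∞ := ENNReal.ofReal (((2 : ℝ) ^ j) ^ (2 * σ) * (4 * 2 ^ j)) *
        (2 * (freqSum ^ (1 / 2 : ℝ) * (6 * B) ^ 3)) with hD
  have hDtop : D ≠ ⊤ := by
    refine ENNReal.mul_ne_top ENNReal.ofReal_ne_top (ENNReal.mul_ne_top (by simp)
      (ENNReal.mul_ne_top (ENNReal.rpow_ne_top_of_nonneg (by norm_num) freqSum_ne_top)
        (ENNReal.pow_ne_top (ENNReal.mul_ne_top (by simp) (by simp)))))
  have hfin : ∑' p : Freq × Freq,
      ‖(enMul σ j (-p.1 - p.2) : ℂ) * tripInt a t p.1 p.2‖ₑ ≠ ⊤ := by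
    refine ne_top_of_le_ne_top (b := ∫⁻ _, D ∂μ) ?_ ?_
    · rw [lintegral_const, hμ, Measure.restrict_apply_univ, uIoc, Real.volume_Ioc]
      exact ENNReal.mul_ne_top hDtop ENNReal.ofReal_ne_top
    calc ∑' p : Freq × Freq, ‖(enMul σ j (-p.1 - p.2) : ℂ) * tripInt a t p.1 p.2‖ₑ
        ≤ ∑' p, ∫⁻ s, G p s ∂μ := by
          refine ENNReal.tsum_le_tsum fun p => ?_
          simp only [hG]
          rw [lintegral_const_mul' _ _ enorm_ne_top, enorm_mul, enorm_complex_ofReal]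
          gcongr
          rw [tripInt, intervalIntegral.intervalIntegral_eq_integral_uIoc, enorm_smul]
          have h1 : ‖(if (0 : ℝ) ≤ t then (1 : ℝ) else -1)‖ₑ = 1 := by split_ifs <;> simp
          rw [h1, one_mul]
          refine (enorm_integral_le_lintegral_enorm _).trans (le_of_eq ?_)
          simp only [enorm_mul, hμ]
      _ = ∫⁻ s, ∑' p, G p s ∂μ := (lintegral_tsum hm).symm
      _ ≤ _ := by
          refine lintegral_mono_ae (hmem.mono fun s hs => ?_)
          rw [ENNReal.tsum_prod' (f := fun p => G p s)]
          refine (tsum_enMul_le σ j (h.eq_zero s hs)).trans ?_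
          rw [hD]
          gcongr
          exact hB s hs
  exact Summable.of_norm ((ENNReal.summable_toReal hfin).congr fun p => by simp)

/-- As u is real, |û(k)|² = û(k) û(-k). The symmetry of `tripInt` brings k, which carries the
multiplier, to the first slot. -/
lemma FourierFlow.enWeight_mul_sub_eq {T : ℝ} {a q : ℝ → Freq → ℂ} (h : FourierFlow T a q)
    (σ : ℝ) (j : ℕ) {t : ℝ} (hT : 0 ≤ T) (ht : t ∈ Icc (-T) T) (k : Freq) :
    ((enWeight σ j k * ‖a t k‖ ^ 2 - enWeight σ j k * ‖a 0 k‖ ^ 2 : ℝ) : ℂ) =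
      Complex.I / 2 * ((∑' i, (enMul σ j k : ℂ) * tripInt a t k i) +
        ∑' i, (enMul σ j (-k) : ℂ) * tripInt a t (-k) i) := by
  have hP : ∀ s ∈ Icc (-T) T, a s k * a s (-k) = ((‖a s k‖ ^ 2 : ℝ) : ℂ) := fun s hs => by
    rw [← h.conj s hs, Complex.mul_conj, Complex.normSq_eq_norm_sq]
  have hτ : ∀ k i, tripInt a t i (-k - i) = tripInt a t k i := fun k i => by
    rw [show -k - i = -i - k by abel, tripInt_swap_right, tripInt_swap]
  have := h.sub_eq hT ht k
  rw [hP t ht, hP 0 ⟨by linarith, hT⟩] at this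
  simp_rw [hτ] at this
  rw [← mul_sub, Complex.ofReal_mul, Complex.ofReal_sub, this, tsum_mul_left, tsum_mul_left]
  have e : enMul σ j (-k) = -(enWeight σ j k * (k 0 : ℝ)) := by
    rw [enMul, enWeight_neg]; simp
  rw [e, enMul]
  push_cast
  ring

/-- The energy inequality for the localized weights. -/
lemma FourierFlow.energy_le {T : ℝ} {a q : ℝ → Freq → ℂ} (h : FourierFlow T a q) (σ : ℝ) (j : ℕ)
    {t : ℝ} (hT : 0 ≤ T) (ht : t ∈ Icc (-T) T) :
    ∑' k, ENNReal.ofReal (enWeight σ j k) * ‖a t k‖ₑ ^ 2 ≤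
      ∑' k, ENNReal.ofReal (enWeight σ j k) * ‖a 0 k‖ₑ ^ 2 +
        ∑' k₁, ∑' k₂, ‖symbol σ j k₁ k₂‖ₑ * ‖tripInt a t k₁ k₂‖ₑ := by
  have hE : ∀ s, ∑' k, ENNReal.ofReal (enWeight σ j k) * ‖a s k‖ₑ ^ 2 =
      ∑' k, ENNReal.ofReal (enWeight σ j k * ‖a s k‖ ^ 2) := fun s => by
    refine tsum_congr fun k => ?_
    rw [ENNReal.ofReal_mul (enWeight_nonneg _ _ _), ENNReal.ofReal_pow (norm_nonneg _),
      ofReal_norm]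
  rw [hE, hE]
  by_cases hX : ∑' k, ENNReal.ofReal (enWeight σ j k * ‖a 0 k‖ ^ 2) = ⊤
  · simp [hX]
  have hnn : ∀ s k, 0 ≤ enWeight σ j k * ‖a s k‖ ^ 2 := fun s k =>
    mul_nonneg (enWeight_nonneg _ _ _) (sq_nonneg _)
  have hs0 : Summable fun k => enWeight σ j k * ‖a 0 k‖ ^ 2 :=
    (ENNReal.summable_toReal hX).congr fun k => ENNReal.toReal_ofReal (hnn 0 k)
  -- the three forms of the cubic sum
  have hZ3 := h.summable_enMul σ j hT ht
  -- The cyclic rotation of (k₁, k₂, k₃) leaves the trilinear integral unchanged and permutes the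
  -- three sums.
  let rot : Freq × Freq ≃ Freq × Freq :=
    { toFun := fun p => (p.2, -p.1 - p.2)
      invFun := fun p => (-p.1 - p.2, p.1)
      left_inv := fun p => Prod.ext (by simp only; abel) rfl
      right_inv := fun p => Prod.ext rfl (by simp only; abel) }
  have hrot : ∀ p : Freq × Freq,
      tripInt a t (rot p).1 (rot p).2 = tripInt a t p.1 p.2 := fun p => by
    change tripInt a t p.2 (-p.1 - p.2) = _
    rw [show -p.1 - p.2 = -p.2 - p.1 by abel, tripInt_swap_right, tripInt_swap]
  set Z1 : Freq × Freq → ℂ := fun p => (enMul σ j p.1 : ℂ) * tripInt a t p.1 p.2 with hZ1def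
  set Z2 : Freq × Freq → ℂ := fun p => (enMul σ j p.2 : ℂ) * tripInt a t p.1 p.2 with hZ2def
  set Z3 : Freq × Freq → ℂ := fun p => (enMul σ j (-p.1 - p.2) : ℂ) * tripInt a t p.1 p.2
    with hZ3def
  have e1 : ∀ p, Z3 (rot p) = Z1 p := fun p => by
    simp only [hZ3def, hZ1def, hrot]
    congr 3
    change -p.2 - (-p.1 - p.2) = p.1
    abel
  have e2 : ∀ p, Z1 (rot p) = Z2 p := fun p => by
    simp only [hZ2def, hZ1def, hrot]
    rfl
  have hZ1 : Summable Z1 := (rot.summable_iff.2 hZ3).congr fun p => e1 p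
  have hZ2 : Summable Z2 := (rot.summable_iff.2 hZ1).congr fun p => e2 p
  have t1 : ∑' p, Z1 p = ∑' p, Z3 p := by
    rw [← rot.tsum_eq Z3]; exact tsum_congr fun p => (e1 p).symm
  have t2 : ∑' p, Z2 p = ∑' p, Z1 p := by
    rw [← rot.tsum_eq Z1]; exact tsum_congr fun p => (e2 p).symm
  set A : ℂ := ∑' p, Z1 p with hA
  -- Symmetrization: each of the three rotated sums equals A, and together they carry the
  -- symmetrized symbol.
  have hA3 : 3 * A = ∑' p : Freq × Freq, (symbol σ j p.1 p.2 : ℂ) * tripInt a t p.1 p.2 := by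
    have h3 := ((hZ1.add hZ2).tsum_add hZ3).symm
    rw [hZ1.tsum_add hZ2, t2, ← t1] at h3
    rw [show 3 * A = A + A + A by ring, h3]
    refine tsum_congr fun p => ?_
    simp only [hZ1def, hZ2def, hZ3def, symbol]
    push_cast
    ring
  have hAle : ‖A‖ₑ ≤ ∑' k₁, ∑' k₂, ‖symbol σ j k₁ k₂‖ₑ * ‖tripInt a t k₁ k₂‖ₑ := by
    calc ‖A‖ₑ = 1 * ‖A‖ₑ := (one_mul _).symm
      _ ≤ ‖(3 : ℂ)‖ₑ * ‖A‖ₑ := by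
          gcongr
          rw [← ofReal_norm, ← ENNReal.ofReal_one]
          exact ENNReal.ofReal_le_ofReal (by norm_num)
      _ = ‖∑' p : Freq × Freq, (symbol σ j p.1 p.2 : ℂ) * tripInt a t p.1 p.2‖ₑ := by
          rw [← enorm_mul, hA3]
      _ ≤ ∑' p : Freq × Freq, ‖(symbol σ j p.1 p.2 : ℂ) * tripInt a t p.1 p.2‖ₑ :=
          enorm_tsum_le_tsum_enorm
      _ = _ := by
          rw [← ENNReal.tsum_prod (f := fun k₁ k₂ => ‖symbol σ j k₁ k₂‖ₑ * ‖tripInt a t k₁ k₂‖ₑ)]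
          refine tsum_congr fun p => ?_
          rw [enorm_mul, enorm_complex_ofReal]
  have hf := hZ1.prod
  have hf2 : Summable fun k : Freq => ∑' i, (enMul σ j (-k) : ℂ) * tripInt a t (-k) i :=
    ((Equiv.neg Freq).summable_iff (f := fun k => ∑' i, Z1 (k, i))).2 hf
  have hfA : ∑' k : Freq, ∑' i, (enMul σ j k : ℂ) * tripInt a t k i = A := (hZ1.tsum_prod).symm
  have hfA2 : ∑' k : Freq, ∑' i, (enMul σ j (-k) : ℂ) * tripInt a t (-k) i = A := by
    rw [← hfA]
    exact (Equiv.neg Freq).tsum_eq (fun k => ∑' i, Z1 (k, i))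
  -- The terms of k and of -k have the same sum A, so the factor i/2 becomes i.
  have hsum : HasSum (fun k => ((enWeight σ j k * ‖a t k‖ ^ 2 - enWeight σ j k * ‖a 0 k‖ ^ 2 : ℝ)
      : ℂ)) (Complex.I * A) := by
    have := ((hf.hasSum.add hf2.hasSum).mul_left (Complex.I / 2))
    rw [hfA2, show (∑' b : Freq, ∑' c, Z1 (b, c)) = A from hfA,
      show Complex.I / 2 * (A + A) = Complex.I * A by ring] at this
    refine this.congr_fun ?_
    intro k
    exact h.enWeight_mul_sub_eq σ j hT ht k
  have hre := Complex.hasSum_re hsum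
  simp only [Complex.ofReal_re] at hre
  have hst : HasSum (fun k => enWeight σ j k * ‖a t k‖ ^ 2)
      (∑' k, enWeight σ j k * ‖a 0 k‖ ^ 2 + (Complex.I * A).re) := by
    have := hs0.hasSum.add hre
    simpa using this
  rw [← ENNReal.ofReal_tsum_of_nonneg (hnn t) hst.summable, hst.tsum_eq,
    ← ENNReal.ofReal_tsum_of_nonneg (hnn 0) hs0]
  refine ENNReal.ofReal_add_le.trans ?_
  gcongr
  refine le_trans ?_ hAle
  rw [← ofReal_norm]
  refine ENNReal.ofReal_le_ofReal ((le_abs_self _).trans ((Complex.abs_re_le_norm _).trans ?_))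
  simp

/-! ### Fourier coefficients on the torus -/

/-- The normalized Haar measure of the torus. -/
abbrev torusMeasure : Measure (UnitAddTorus (Fin 2)) :=
  Measure.pi fun _ : Fin 2 => (AddCircle.haarAddCircle : Measure UnitAddCircle)

lemma coeff_eq (f : L2Torus) (k : Freq) :
    coeff f k = ∫ z, UnitAddTorus.mFourier (-k) z * ((f z : ℝ) : ℂ) ∂torusMeasure := rfl

lemma coeffMul_eq (f g : L2Torus) (k : Freq) : coeffMul f g k =
    ∫ z, UnitAddTorus.mFourier (-k) z * ((f z * g z : ℝ) : ℂ) ∂torusMeasure := rfl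

lemma memLp_mFourier_mul (f : L2Torus) (k : Freq) :
    MemLp (fun z => UnitAddTorus.mFourier k z * ((f z : ℝ) : ℂ)) 2 torusMeasure := by
  have h : MemLp (fun z => ((f z : ℝ) : ℂ)) 2 torusMeasure := (Lp.memLp f).ofReal
  refine h.of_le ((ContinuousMap.continuous _).aestronglyMeasurable.mul h.aestronglyMeasurable)
    (ae_of_all _ fun z => ?_)
  rw [norm_mul]
  refine mul_le_of_le_one_left (norm_nonneg _) ?_
  exact ((UnitAddTorus.mFourier k).norm_coe_le_norm z).trans UnitAddTorus.mFourier_norm.le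

lemma integrable_mFourier_mul (f : L2Torus) (k : Freq) :
    Integrable (fun z => UnitAddTorus.mFourier k z * ((f z : ℝ) : ℂ)) torusMeasure :=
  (memLp_mFourier_mul f k).integrable one_le_two

lemma coeff_sub (f g : L2Torus) (k : Freq) : coeff (f - g) k = coeff f k - coeff g k := by
  rw [coeff_eq, coeff_eq, coeff_eq,
    ← integral_sub (integrable_mFourier_mul f _) (integrable_mFourier_mul g _)]
  refine integral_congr_ae ?_
  filter_upwards [Lp.coeFn_sub f g] with z hz
  rw [hz, Pi.sub_apply]
  push_cast
  ring

lemma conj_coeff (f : L2Torus) (k : Freq) : (starRingEnd ℂ) (coeff f k) = coeff f (-k) := by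
  rw [coeff_eq, coeff_eq, ← integral_conj]
  refine integral_congr_ae (ae_of_all _ fun z => ?_)
  simp only [map_mul, Complex.conj_ofReal, ← UnitAddTorus.mFourier_neg]

/-- The Fourier coefficients of a product are the convolution of the Fourier coefficients. -/
lemma hasSum_coeffMul (f g : L2Torus) (k : Freq) :
    HasSum (fun i => coeff f (k - i) * coeff g i) (coeffMul f g k) := by
  have hF := memLp_mFourier_mul f k
  have hG : MemLp (fun z => ((g z : ℝ) : ℂ)) 2 torusMeasure := (Lp.memLp g).ofReal
  -- Parseval's identity for e_k f and g. Since f is real, the conjugate of the i-th coefficient of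
  -- e_k f is that of f at k - i.
  have h := UnitAddTorus.hasSum_prod_mFourierCoeff (d := Fin 2) (hF.toLp _) (hG.toLp _)
  have e1 : ∀ i, (starRingEnd ℂ) (UnitAddTorus.mFourierCoeff (hF.toLp _) i) = coeff f (k - i) := by
    intro i
    rw [show k - i = -(i - k) by abel, ← conj_coeff]
    congr 1
    rw [coeff_eq]
    refine integral_congr_ae ?_
    filter_upwards [hF.coeFn_toLp] with z hz
    rw [smul_eq_mul, hz, show -(i - k) = -i + k by abel, UnitAddTorus.mFourier_add, mul_assoc]
  have e2 : ∀ i, UnitAddTorus.mFourierCoeff (hG.toLp _) i = coeff g i := by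
    intro i
    refine integral_congr_ae ?_
    filter_upwards [hG.coeFn_toLp] with z hz
    rw [hz]
  have e3 : ∫ z, (starRingEnd ℂ) (hF.toLp _ z) * hG.toLp _ z ∂torusMeasure = coeffMul f g k := by
    rw [coeffMul_eq]
    refine integral_congr_ae ?_
    filter_upwards [hF.coeFn_toLp, hG.coeFn_toLp] with z hz1 hz2
    rw [hz1, hz2, map_mul, Complex.conj_ofReal, ← UnitAddTorus.mFourier_neg]
    push_cast
    ring
  rw [← e3]
  refine HasSum.congr_fun h fun i => ?_
  rw [← e1, ← e2]

lemma energyNorm_add_sq_le (σ : ℝ) (a b : Freq → ℂ) :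
    energyNorm σ (fun k => a k + b k) ^ 2 ≤ 2 * (energyNorm σ a ^ 2 + energyNorm σ b ^ 2) := by
  rw [energyNorm_eq, energyNorm_eq, energyNorm_eq, l2_sq, l2_sq, l2_sq, ← ENNReal.tsum_add,
    ← ENNReal.tsum_mul_left]
  refine ENNReal.tsum_le_tsum fun k => ?_
  rw [mul_pow, mul_pow, mul_pow, ← mul_add, mul_left_comm]
  gcongr
  calc ‖a k + b k‖ₑ ^ 2 ≤ (‖a k‖ₑ + ‖b k‖ₑ) ^ 2 := by gcongr; exact enorm_add_le _ _
    _ ≤ 2 * (‖a k‖ₑ ^ 2 + ‖b k‖ₑ ^ 2) := by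
        have := ENNReal.rpow_add_le_mul_rpow_add_rpow ‖a k‖ₑ ‖b k‖ₑ (p := 2) one_le_two
        norm_num at this
        exact this

lemma ContinuousInto.energyNorm_lt_top {S : Set ℝ} {u : ℝ → L2Torus} (hu : ContinuousInto S u)
    {σ : ℝ} (hσ : 2 ≤ σ) {t : ℝ} (ht : t ∈ S) : energyNorm σ (coeff (u t)) < ⊤ :=
  (mem_iInter₂.1 (hu.1 t ht) σ hσ).2

lemma ContinuousInto.coeff_eq_zero {S : Set ℝ} {u : ℝ → L2Torus} (hu : ContinuousInto S u)
    {t : ℝ} (ht : t ∈ S) {k : Freq} (hk : k 0 = 0) : coeff (u t) k = 0 :=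
  (mem_iInter₂.1 (hu.1 t ht) 2 (mem_Ici.2 le_rfl)).1 k hk

lemma ContinuousInto.continuousOn {S : Set ℝ} {u : ℝ → L2Torus} (hu : ContinuousInto S u)
    (k : Freq) : ContinuousOn (fun t => coeff (u t) k) S := by
  intro t₀ ht₀
  rw [ContinuousWithinAt, tendsto_iff_edist_tendsto_0]
  refine tendsto_of_tendsto_of_tendsto_of_le_of_le tendsto_const_nhds (hu.2 2 le_rfl t₀ ht₀)
    (fun _ => zero_le) fun t => ?_
  rw [edist_eq_enorm_sub, ← coeff_sub]
  exact enorm_le_energyNorm (by norm_num) _ k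

/-- Near each t₀ the norm of u(s) - u(t₀) is at most 1, which bounds u(s) locally; compactness makes
the bound uniform. -/
lemma ContinuousInto.exists_energyNorm_le {S : Set ℝ} {u : ℝ → L2Torus} (hu : ContinuousInto S u)
    (hS : IsCompact S) {σ : ℝ} (hσ : 2 ≤ σ) :
    ∃ B : ℝ≥0, ∀ s ∈ S, energyNorm σ (coeff (u s)) ≤ B := by
  refine hS.induction_on (p := fun A => ∃ B : ℝ≥0, ∀ s ∈ A, energyNorm σ (coeff (u s)) ≤ B)
    ⟨0, by simp⟩ ?_ ?_ ?_
  · rintro A A' hA ⟨B, hB⟩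
    exact ⟨B, fun s hs => hB s (hA hs)⟩
  · rintro A A' ⟨B, hB⟩ ⟨B', hB'⟩
    refine ⟨max B B', fun s hs => ?_⟩
    rcases hs with hs | hs
    · exact (hB s hs).trans (by exact_mod_cast le_max_left _ _)
    · exact (hB' s hs).trans (by exact_mod_cast le_max_right _ _)
  · intro t₀ ht₀
    have hev := (hu.2 σ hσ t₀ ht₀).eventually (Iio_mem_nhds (zero_lt_one (α := ℝ≥0∞)))
    refine ⟨_, hev, ?_⟩
    set D := 2 * (energyNorm σ (coeff (u t₀)) ^ 2 + 1) with hD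
    have hDtop : D ^ (1 / 2 : ℝ) ≠ ⊤ := ENNReal.rpow_ne_top_of_nonneg (by norm_num)
      (ENNReal.mul_ne_top (by simp) (ENNReal.add_ne_top.2
        ⟨ENNReal.pow_ne_top (hu.energyNorm_lt_top hσ ht₀).ne, by simp⟩))
    refine ⟨(D ^ (1 / 2 : ℝ)).toNNReal, fun s hs => ?_⟩
    rw [ENNReal.coe_toNNReal hDtop]
    have hs1 : energyNorm σ (coeff (u s - u t₀)) ≤ 1 := le_of_lt hs
    have e : coeff (u s) = fun k => coeff (u t₀) k + coeff (u s - u t₀) k := by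
      ext k; rw [coeff_sub]; ring
    rw [← sq_rpow_half (energyNorm σ (coeff (u s))), e]
    refine rpow_half_mono ((energyNorm_add_sq_le σ _ _).trans ?_)
    rw [hD]
    gcongr
    exact pow_le_one₀ zero_le hs1

lemma dx_iterate_add (a : Freq → ℂ) (k : Freq) :
    dx^[5] a k + dxInv (dy^[2] a) k = Complex.I * omega k * a k := by
  simp only [Function.iterate_succ, Function.iterate_zero, Function.comp_apply, id, dx, dy, dxInv,
    omega]
  push_cast
  rw [mul_inv, Complex.inv_I]
  have hI2 := Complex.I_sq
  have h5 : Complex.I ^ 5 = Complex.I := by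
    rw [show Complex.I ^ 5 = (Complex.I ^ 2) ^ 2 * Complex.I by ring, hI2]; ring
  calc _ = Complex.I ^ 5 * (k 0 : ℂ) ^ 5 * a k
        - Complex.I * Complex.I ^ 2 * ((k 1 : ℂ) ^ 2 * (k 0 : ℂ)⁻¹) * a k := by ring
    _ = _ := by rw [h5, hI2, div_eq_mul_inv]; ring

/-- The Fourier coefficients of a solution and of its square. -/
lemma IsSolution.fourierFlow {T : ℝ} {u : ℝ → L2Torus} (hs : IsSolution T u)
    (hu : ContinuousInto (Icc (-T) T) u) :
    FourierFlow T (fun s => coeff (u s)) (fun s => coeffMul (u s) (u s)) where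
  eq_zero s h k hk := hu.coeff_eq_zero h hk
  conj s _ k := conj_coeff (u s) k
  continuousOn := hu.continuousOn
  bounded σ hσ := hu.exists_energyNorm_le isCompact_Icc hσ
  hasSum s _ k := (hasSum_coeffMul (u s) (u s) k).congr_fun fun i => mul_comm _ _
  deriv s h k := by
    obtain ⟨w, hw, hd⟩ := hs s h
    convert! hd k using 1
    rw [dx_iterate_add]
    congr 1
    have h1 : HasSum (fun i => coeff (u s) (k - i) * (Complex.I * (i 0 : ℂ) * coeff (u s) i))
        (coeffMul (u s) w k) := by
      refine (hasSum_coeffMul (u s) w k).congr_fun fun i => ?_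
      rw [hw, dx]
    -- The reflection i ↦ k - i is averaged with the identity: this is u ∂ₓu = ½ ∂ₓ(u²) for the
    -- coefficients.
    have h2 := (Equiv.subLeft k).hasSum_iff.2 h1
    have h3 := (h1.add h2).unique (((hasSum_coeffMul (u s) (u s) k).mul_left
      (Complex.I * (k 0 : ℂ))).congr_fun fun i => ?_)
    · rw [div_mul_eq_mul_div, ← h3]; ring
    · simp only [Function.comp_apply, Equiv.subLeft_apply, sub_sub_cancel, Pi.sub_apply]
      push_cast
      ring

/-! ### Trilinear bounds on time intervals -/

lemma modForm_mul_const (κ : ℝ → ℝ≥0∞) (c : ℝ) {A₁ A₂ A₃ : ℝ≥0∞} (h₁ : A₁ ≠ ⊤) (h₂ : A₂ ≠ ⊤)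
    (h₃ : A₃ ≠ ⊤) (f₁ f₂ f₃ : ℝ → ℝ≥0∞) :
    modForm κ c (fun s => A₁ * f₁ s) (fun s => A₂ * f₂ s) (fun s => A₃ * f₃ s) =
      A₁ * A₂ * A₃ * modForm κ c f₁ f₂ f₃ := by
  unfold modForm
  have h : A₁ * A₂ * A₃ ≠ ⊤ := ENNReal.mul_ne_top (ENNReal.mul_ne_top h₁ h₂) h₃
  rw [← lintegral_const_mul' _ _ h]
  refine lintegral_congr fun s₁ => ?_
  rw [← lintegral_const_mul' _ _ h]
  refine lintegral_congr fun s₂ => ?_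
  rw [← lintegral_const_mul' _ _ h]
  refine lintegral_congr fun s₃ => ?_
  ring

/-- The localization `χ(M² (t - t₀)) v̂(t, k)` of the Fourier coefficients of `v`, with `M = 2^j`. -/
def cutCoeff (χ : ℝ → ℝ) (j : ℕ) (t₀ : ℝ) (v : ℝ → L2Torus) (k : Freq) (t : ℝ) : ℂ :=
  (χ (((2 : ℝ) ^ j) ^ 2 * (t - t₀)) : ℂ) * coeff (v t) k

lemma one_le_two_pow_sq (j : ℕ) : (1 : ℝ) ≤ (2 ^ j) ^ 2 :=
  one_le_pow₀ (one_le_pow₀ (by norm_num))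

lemma cutCoeff_eq {χ : ℝ → ℝ} (hχ : IsCutoff χ) {j : ℕ} {t₀ t : ℝ} (v : ℝ → L2Torus) (k : Freq)
    (h : ((2 : ℝ) ^ j) ^ 2 * |t - t₀| ≤ 1) : cutCoeff χ j t₀ v k t = coeff (v t) k := by
  rw [cutCoeff, hχ.eq_one_of_abs, Complex.ofReal_one, one_mul]
  rw [abs_mul, abs_of_nonneg (by positivity : (0 : ℝ) ≤ (2 ^ j) ^ 2)]
  linarith

lemma continuous_cutCoeff {χ : ℝ → ℝ} (hχ : IsCutoff χ) (j : ℕ) (t₀ : ℝ) {v : ℝ → L2Torus}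
    (hv : ContinuousInto univ v) (k : Freq) : Continuous (cutCoeff χ j t₀ v k) := by
  have h1 := hχ.continuous
  have h2 := continuousOn_univ.1 (hv.continuousOn k)
  unfold cutCoeff
  fun_prop

lemma integrable_cutCoeff {χ : ℝ → ℝ} (hχ : IsCutoff χ) (j : ℕ) (t₀ : ℝ) {v : ℝ → L2Torus}
    (hv : ContinuousInto univ v) (k : Freq) : Integrable (cutCoeff χ j t₀ v k) := by
  refine (continuous_cutCoeff hχ j t₀ hv k).integrable_of_hasCompactSupport
    (HasCompactSupport.of_support_subset_isCompact
      (isCompact_Icc (a := t₀ - 8 / 5) (b := t₀ + 8 / 5)) fun t ht => ?_)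
  by_contra h
  refine ht ?_
  rw [cutCoeff, hχ.eq_zero, Complex.ofReal_zero, zero_mul]
  rw [abs_mul, abs_of_nonneg (by positivity : (0 : ℝ) ≤ (2 ^ j) ^ 2)]
  have h1 : 8 / 5 < |t - t₀| := by
    by_contra h2
    rw [not_lt, abs_le] at h2
    exact h ⟨by linarith, by linarith⟩
  nlinarith [one_le_two_pow_sq j, abs_nonneg (t - t₀)]

lemma modBound_of_shortNorm {χ : ℝ → ℝ} (hχ : IsCutoff χ) (ε : ℝ) (j : ℕ) (t₀ : ℝ)
    {v : ℝ → L2Torus} (hv : ContinuousInto univ v) :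
    ModBound (fun s k => ENNReal.ofReal (weight k) *
      ‖timeFourier (cutCoeff χ j t₀ v k) (s - ε * omega k)‖ₑ) (4 * shortNorm χ ε j v) := by
  set F : ℝ → Freq → ℂ := fun τ k => (weight k : ℂ) * timeFourier (cutCoeff χ j t₀ v k) τ with hF
  have hm : ∀ k, Measurable fun τ => F τ k := fun k =>
    ((continuous_timeFourier (integrable_cutCoeff hχ j t₀ hv k)).measurable).const_mul _
  have h := modBound_of_xNorm hχ ε hm
  have hle : 4 * xNorm χ ε F ≤ 4 * shortNorm χ ε j v := by
    gcongr
    exact le_iSup (fun t₀ : ℝ => xNorm χ ε (fun τ k => (weight k : ℂ) * timeFourier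
      (fun t => (χ (((2 : ℝ) ^ j) ^ 2 * (t - t₀)) : ℂ) * coeff (v t) k) τ)) t₀
  have e : (fun (s : ℝ) (k : Freq) => ‖F (s - ε * omega k) k‖ₑ) = fun s k =>
      ENNReal.ofReal (weight k) * ‖timeFourier (cutCoeff χ j t₀ v k) (s - ε * omega k)‖ₑ := by
    ext s k
    simp only [hF]
    rw [enorm_mul, enorm_complex_ofReal, Real.enorm_of_nonneg (weight_pos k).le]
  rw [← e]
  exact ⟨h.measurable, h.lintegral_le.trans hle, fun L hL => (h.tail_le L hL).trans (by gcongr)⟩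

/-- A finite X_M norm bounds the L¹ norm in modulation, and p ≥ 1 allows the weight to be dropped.
This is the integrability needed for Fourier inversion. -/
lemma integrable_timeFourier_cutCoeff {χ : ℝ → ℝ} (hχ : IsCutoff χ) (ε : ℝ) (j : ℕ) (t₀ : ℝ)
    {v : ℝ → L2Torus} (hv : ContinuousInto univ v) (hN : shortNorm χ ε j v ≠ ⊤) (k : Freq) :
    Integrable (timeFourier (cutCoeff χ j t₀ v k)) := by
  refine ⟨(continuous_timeFourier (integrable_cutCoeff hχ j t₀ hv k)).aestronglyMeasurable, ?_⟩
  have h := modBound_of_shortNorm hχ ε j t₀ hv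
  refine lt_of_le_of_lt ?_ (ENNReal.mul_ne_top (by simp) hN : 4 * shortNorm χ ε j v ≠ ⊤).lt_top
  refine le_trans ?_ h.lintegral_le
  rw [← lintegral_sub_right_eq_self
    (fun τ => ‖timeFourier (cutCoeff χ j t₀ v k) τ‖ₑ) (ε * omega k)]
  refine lintegral_mono fun s => ?_
  refine le_trans ?_ (le_l2 _ k)
  refine le_mul_of_one_le_left' ?_
  rw [← ENNReal.ofReal_one]
  exact ENNReal.ofReal_le_ofReal (one_le_weight k)

lemma cutCoeff_eq_superpose {χ : ℝ → ℝ} (hχ : IsCutoff χ) (ε : ℝ) (j : ℕ) (t₀ : ℝ)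
    {v : ℝ → L2Torus} (hv : ContinuousInto univ v) (hN : shortNorm χ ε j v ≠ ⊤) (k : Freq)
    (t : ℝ) : cutCoeff χ j t₀ v k t = (2 * Real.pi : ℂ)⁻¹ *
      superpose (fun s => timeFourier (cutCoeff χ j t₀ v k) (s - ε * omega k)) (ε * omega k) t := by
  have := timeFourier_inversion (continuous_cutCoeff hχ j t₀ hv k) (integrable_cutCoeff hχ j t₀ hv k)
    (integrable_timeFourier_cutCoeff hχ ε j t₀ hv hN k) (ε * omega k) t
  rw [this, superpose]

lemma enorm_two_pi_inv_le : ‖(2 * Real.pi : ℂ)⁻¹‖ₑ ≤ 1 := by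
  rw [← ofReal_norm, ← ENNReal.ofReal_one]
  refine ENNReal.ofReal_le_ofReal ?_
  rw [norm_inv, norm_mul, Complex.norm_real, Real.norm_of_nonneg Real.pi_pos.le, Complex.norm_ofNat]
  exact inv_le_one_of_one_le₀ (by linarith [Real.pi_gt_three])

/-- All three localizations are centred at the endpoint a of the window. Its length is at most
2^{-2j₃}, the shortest of the three time scales, so each cutoff equals 1 there. -/
lemma enorm_integral_coeff_le {χ : ℝ → ℝ} (hχ : IsCutoff χ) {ε : ℝ} {j₁ j₂ j₃ : ℕ}
    (h12 : j₁ ≤ j₂) (h23 : j₂ ≤ j₃) {v₁ v₂ v₃ : ℝ → L2Torus} (hv₁ : ContinuousInto univ v₁)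
    (hv₂ : ContinuousInto univ v₂) (hv₃ : ContinuousInto univ v₃)
    (hN₁ : shortNorm χ ε j₁ v₁ ≠ ⊤) (hN₂ : shortNorm χ ε j₂ v₂ ≠ ⊤)
    (hN₃ : shortNorm χ ε j₃ v₃ ≠ ⊤) {a b : ℝ} (hab : |b - a| ≤ (((2 : ℝ) ^ j₃) ^ 2)⁻¹)
    (k₁ k₂ : Freq) :
    ENNReal.ofReal (weight k₁) * ENNReal.ofReal (weight k₂) * ENNReal.ofReal (weight (-k₁ - k₂)) *
      ‖∫ s in a..b, coeff (v₁ s) k₁ * coeff (v₂ s) k₂ * coeff (v₃ s) (-k₁ - k₂)‖ₑ ≤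
      esqrt (Real.sqrt (27 * |b - a|)) * modForm (ker ((2 ^ j₃) ^ 2)) (-ε * resonance k₁ k₂)
        (fun s => ENNReal.ofReal (weight k₁) *
          ‖timeFourier (cutCoeff χ j₁ a v₁ k₁) (s - ε * omega k₁)‖ₑ)
        (fun s => ENNReal.ofReal (weight k₂) *
          ‖timeFourier (cutCoeff χ j₂ a v₂ k₂) (s - ε * omega k₂)‖ₑ)
        (fun s => ENNReal.ofReal (weight (-k₁ - k₂)) *
          ‖timeFourier (cutCoeff χ j₃ a v₃ (-k₁ - k₂)) (s - ε * omega (-k₁ - k₂))‖ₑ) := by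
  have hA : (0 : ℝ) < (2 ^ j₃) ^ 2 := by positivity
  have hcut : ∀ {i : ℕ}, i ≤ j₃ → ∀ s ∈ uIcc a b, ((2 : ℝ) ^ i) ^ 2 * |s - a| ≤ 1 := by
    intro i hi s hs
    calc ((2 : ℝ) ^ i) ^ 2 * |s - a| ≤ (2 ^ j₃) ^ 2 * (((2 : ℝ) ^ j₃) ^ 2)⁻¹ := by
          gcongr
          · norm_num
          · exact (abs_sub_left_of_mem_uIcc hs).trans hab
      _ = 1 := mul_inv_cancel₀ hA.ne'
  have hint : ∀ {i : ℕ} {v : ℝ → L2Torus}, ContinuousInto univ v → shortNorm χ ε i v ≠ ⊤ →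
      ∀ k, Integrable fun s => timeFourier (cutCoeff χ i a v k) (s - ε * omega k) :=
    fun hv hN k => (integrable_timeFourier_cutCoeff hχ ε _ a hv hN k).comp_sub_right _
  have hmeas : ∀ {i : ℕ} {v : ℝ → L2Torus}, ContinuousInto univ v →
      ∀ k, Measurable fun s => timeFourier (cutCoeff χ i a v k) (s - ε * omega k) :=
    fun hv k => (continuous_timeFourier (integrable_cutCoeff hχ _ a hv k)).measurable.comp
      (by fun_prop)
  rw [modForm_mul_const _ _ ENNReal.ofReal_ne_top ENNReal.ofReal_ne_top ENNReal.ofReal_ne_top,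
    mul_left_comm]
  gcongr
  set f₁ := fun s => timeFourier (cutCoeff χ j₁ a v₁ k₁) (s - ε * omega k₁) with hf₁
  set f₂ := fun s => timeFourier (cutCoeff χ j₂ a v₂ k₂) (s - ε * omega k₂) with hf₂
  set f₃ := fun s => timeFourier (cutCoeff χ j₃ a v₃ (-k₁ - k₂)) (s - ε * omega (-k₁ - k₂)) with hf₃
  have e : ∫ s in a..b, coeff (v₁ s) k₁ * coeff (v₂ s) k₂ * coeff (v₃ s) (-k₁ - k₂) =
      ((2 * Real.pi : ℂ)⁻¹) ^ 3 * ∫ s in a..b, superpose f₁ (ε * omega k₁) s *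
        superpose f₂ (ε * omega k₂) s * superpose f₃ (ε * omega (-k₁ - k₂)) s := by
    rw [← intervalIntegral.integral_const_mul]
    refine intervalIntegral.integral_congr fun s hs => ?_
    rw [← cutCoeff_eq hχ v₁ k₁ (hcut (h12.trans h23) s hs), ← cutCoeff_eq hχ v₂ k₂ (hcut h23 s hs),
      ← cutCoeff_eq hχ v₃ (-k₁ - k₂) (hcut le_rfl s hs),
      cutCoeff_eq_superpose hχ ε j₁ a hv₁ hN₁, cutCoeff_eq_superpose hχ ε j₂ a hv₂ hN₂,
      cutCoeff_eq_superpose hχ ε j₃ a hv₃ hN₃]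
    ring
  rw [e, enorm_mul, enorm_pow]
  refine (mul_le_of_le_one_left' (pow_le_one₀ zero_le enorm_two_pi_inv_le)).trans ?_
  have := enorm_integral_superpose_le_modForm (hint hv₁ hN₁ k₁) (hint hv₂ hN₂ k₂)
    (hint hv₃ hN₃ (-k₁ - k₂)) (hmeas hv₁ k₁) (hmeas hv₂ k₂) (hmeas hv₃ (-k₁ - k₂))
    (ε * omega k₁) (ε * omega k₂) (ε * omega (-k₁ - k₂)) hA hab
  rwa [show -(ε * omega k₁ + ε * omega k₂ + ε * omega (-k₁ - k₂)) = -ε * resonance k₁ k₂ by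
    rw [resonance]; ring] at this

/-- The trilinear estimate for the time integral over a short interval. -/
lemma tsum_integral_coeff_le {χ : ℝ → ℝ} (hχ : IsCutoff χ) {ε : ℝ} (hε : |ε| = 1) {j₁ j₂ j₃ : ℕ}
    (h12 : j₁ ≤ j₂) (h23 : j₂ ≤ j₃) {v₁ v₂ v₃ : ℝ → L2Torus} (hv₁ : ContinuousInto univ v₁)
    (hv₂ : ContinuousInto univ v₂) (hv₃ : ContinuousInto univ v₃)
    (hN₁ : shortNorm χ ε j₁ v₁ ≠ ⊤) (hN₂ : shortNorm χ ε j₂ v₂ ≠ ⊤)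
    (hN₃ : shortNorm χ ε j₃ v₃ ≠ ⊤) {a b : ℝ} (hab : |b - a| ≤ (((2 : ℝ) ^ j₃) ^ 2)⁻¹) :
    ∑' k₁, ∑' k₂, tripInd j₁ j₂ j₃ k₁ k₂ * symBound j₁ j₃ k₁ k₂ *
      (ENNReal.ofReal (weight k₁) * ENNReal.ofReal (weight k₂) *
        ENNReal.ofReal (weight (-k₁ - k₂)) *
        ‖∫ s in a..b, coeff (v₁ s) k₁ * coeff (v₂ s) k₂ * coeff (v₃ s) (-k₁ - k₂)‖ₑ) ≤
      esqrt (Real.sqrt (27 * |b - a|)) * (64 * triConst * esqrt ((2 ^ j₁) ^ 3 / (2 ^ j₃) ^ 3) *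
        (shortNorm χ ε j₁ v₁ * shortNorm χ ε j₂ v₂ * shortNorm χ ε j₃ v₃)) := by
  have hmain := tsum_modForm_le h12 h23 (e := -ε) (by rwa [abs_neg])
    (modBound_of_shortNorm hχ ε j₁ a hv₁) (modBound_of_shortNorm hχ ε j₂ a hv₂)
    (modBound_of_shortNorm hχ ε j₃ a hv₃)
  calc _ ≤ ∑' k₁, ∑' k₂, esqrt (Real.sqrt (27 * |b - a|)) *
        (tripInd j₁ j₂ j₃ k₁ k₂ * symBound j₁ j₃ k₁ k₂ *
        modForm (ker ((2 ^ j₃) ^ 2)) (-ε * resonance k₁ k₂)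
        (fun s => ENNReal.ofReal (weight k₁) *
          ‖timeFourier (cutCoeff χ j₁ a v₁ k₁) (s - ε * omega k₁)‖ₑ)
        (fun s => ENNReal.ofReal (weight k₂) *
          ‖timeFourier (cutCoeff χ j₂ a v₂ k₂) (s - ε * omega k₂)‖ₑ)
        (fun s => ENNReal.ofReal (weight (-k₁ - k₂)) *
          ‖timeFourier (cutCoeff χ j₃ a v₃ (-k₁ - k₂)) (s - ε * omega (-k₁ - k₂))‖ₑ)) := by
        refine ENNReal.tsum_le_tsum fun k₁ => ENNReal.tsum_le_tsum fun k₂ => ?_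
        rw [mul_left_comm (esqrt _)]
        refine mul_le_mul' le_rfl ?_
        exact enorm_integral_coeff_le hχ h12 h23 hv₁ hv₂ hv₃ hN₁ hN₂ hN₃ hab k₁ k₂
    -- Each profile costs a factor 4 by `modBound_of_shortNorm`; together they give 64.
    _ ≤ esqrt (Real.sqrt (27 * |b - a|)) * (triConst * esqrt ((2 ^ j₁) ^ 3 / (2 ^ j₃) ^ 3) *
        (4 * shortNorm χ ε j₁ v₁ * (4 * shortNorm χ ε j₂ v₂) * (4 * shortNorm χ ε j₃ v₃))) := by
        simp_rw [ENNReal.tsum_mul_left]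
        gcongr
    _ = _ := by ring

/-- The trilinear estimate for the time integral over `[0, t]`. -/
lemma tsum_tripInt_le {χ : ℝ → ℝ} (hχ : IsCutoff χ) {ε : ℝ} (hε : |ε| = 1) {j₁ j₂ j₃ : ℕ}
    (h12 : j₁ ≤ j₂) (h23 : j₂ ≤ j₃) {v₁ v₂ v₃ : ℝ → L2Torus} (hv₁ : ContinuousInto univ v₁)
    (hv₂ : ContinuousInto univ v₂) (hv₃ : ContinuousInto univ v₃)
    (hN₁ : shortNorm χ ε j₁ v₁ ≠ ⊤) (hN₂ : shortNorm χ ε j₂ v₂ ≠ ⊤)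
    (hN₃ : shortNorm χ ε j₃ v₃ ≠ ⊤) {a : ℝ → Freq → ℂ} {T t : ℝ} (hT : T ≤ 1)
    (ht : t ∈ Icc (-T) T)
    (ha₁ : ∀ s ∈ Icc (-T) T, ∀ k : Freq, k 0 ∈ blk j₁ → coeff (v₁ s) k = a s k)
    (ha₂ : ∀ s ∈ Icc (-T) T, ∀ k : Freq, k 0 ∈ blk j₂ → coeff (v₂ s) k = a s k)
    (ha₃ : ∀ s ∈ Icc (-T) T, ∀ k : Freq, k 0 ∈ blk j₃ → coeff (v₃ s) k = a s k) :
    ∑' k₁, ∑' k₂, tripInd j₁ j₂ j₃ k₁ k₂ * symBound j₁ j₃ k₁ k₂ *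
      (ENNReal.ofReal (weight k₁) * ENNReal.ofReal (weight k₂) *
        ENNReal.ofReal (weight (-k₁ - k₂)) * ‖tripInt a t k₁ k₂‖ₑ) ≤
      64 * triConst * esqrt (Real.sqrt (27 * T)) * esqrt ((2 ^ j₁) ^ 3) *
        (shortNorm χ ε j₁ v₁ * shortNorm χ ε j₂ v₂ * shortNorm χ ε j₃ v₃) := by
  have htT : |t| ≤ T := abs_le.2 ht
  have hT0 : 0 ≤ T := (abs_nonneg t).trans htT
  set M : ℝ := 2 ^ j₃ with hM
  have hM0 : 0 < M := by positivity
  -- The number of windows is M², so each has length |t|/M² ≤ M⁻²; working with t times i/n covers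
  -- both signs of t.
  set n : ℕ := (2 ^ j₃) ^ 2 with hn
  have hnM : (n : ℝ) = M ^ 2 := by rw [hn, hM]; push_cast; rfl
  have hn0 : (0 : ℝ) < n := by rw [hnM]; positivity
  set p : ℕ → ℝ := fun i => t * (i / n) with hp
  have hstep : ∀ i, |p (i + 1) - p i| = |t| / n := fun i => by
    rw [hp]
    simp only
    rw [← mul_sub, ← sub_div, Nat.cast_succ, add_sub_cancel_left, abs_mul,
      abs_of_pos (by positivity : (0 : ℝ) < 1 / n), mul_one_div]
  have hpmem : ∀ i ≤ n, p i ∈ Icc (-T) T := fun i hi => by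
    rw [mem_Icc, ← abs_le, abs_mul, abs_of_nonneg (by positivity : (0 : ℝ) ≤ (i : ℝ) / n)]
    have : (i : ℝ) / n ≤ 1 := (div_le_one hn0).2 (by exact_mod_cast hi)
    exact (mul_le_of_le_one_right (abs_nonneg t) this).trans htT
  set c : Freq → Freq → ℝ≥0∞ := fun k₁ k₂ => tripInd j₁ j₂ j₃ k₁ k₂ * symBound j₁ j₃ k₁ k₂ with hc
  set W : Freq → Freq → ℝ≥0∞ := fun k₁ k₂ => ENNReal.ofReal (weight k₁) *
    ENNReal.ofReal (weight k₂) * ENNReal.ofReal (weight (-k₁ - k₂)) with hW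
  set J : ℕ → Freq → Freq → ℂ := fun i k₁ k₂ => ∫ s in p i..p (i + 1),
    coeff (v₁ s) k₁ * coeff (v₂ s) k₂ * coeff (v₃ s) (-k₁ - k₂) with hJ
  have hpt : ∀ k₁ k₂, c k₁ k₂ * (W k₁ k₂ * ‖tripInt a t k₁ k₂‖ₑ) ≤
      ∑ i ∈ Finset.range n, c k₁ k₂ * (W k₁ k₂ * ‖J i k₁ k₂‖ₑ) := by
    intro k₁ k₂
    rcases tripInd_cases j₁ j₂ j₃ k₁ k₂ with h | ⟨h, b₁, b₂, b₃⟩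
    · simp only [hc, h, zero_mul, zero_le]
    · rw [← Finset.mul_sum, ← Finset.mul_sum]
      refine mul_le_mul' le_rfl (mul_le_mul' le_rfl ?_)
      have hcont : Continuous fun s => coeff (v₁ s) k₁ * coeff (v₂ s) k₂ *
          coeff (v₃ s) (-k₁ - k₂) :=
        ((continuousOn_univ.1 (hv₁.continuousOn _)).mul
          (continuousOn_univ.1 (hv₂.continuousOn _))).mul
          (continuousOn_univ.1 (hv₃.continuousOn _))
      have e : tripInt a t k₁ k₂ = ∑ i ∈ Finset.range n, J i k₁ k₂ := by
        rw [hJ]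
        simp only
        rw [intervalIntegral.sum_integral_adjacent_intervals
          (fun i _ => hcont.intervalIntegrable _ _), tripInt]
        have e0 : p 0 = 0 := by simp [hp]
        have e1 : p n = t := by rw [hp]; simp only; rw [div_self hn0.ne', mul_one]
        rw [e0, e1]
        refine intervalIntegral.integral_congr fun s hs => ?_
        have hs' : s ∈ Icc (-T) T := uIcc_subset_Icc ⟨by linarith, hT0⟩ ht hs
        rw [ha₁ s hs' k₁ b₁, ha₂ s hs' k₂ b₂, ha₃ s hs' _ b₃]
      rw [e]
      exact enorm_sum_le _ _
  have hwin : ∀ i ∈ Finset.range n, ∑' k₁, ∑' k₂, c k₁ k₂ * (W k₁ k₂ * ‖J i k₁ k₂‖ₑ) ≤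
      esqrt (Real.sqrt (27 * T) / M) * (64 * triConst * esqrt ((2 ^ j₁) ^ 3 / M ^ 3) *
        (shortNorm χ ε j₁ v₁ * shortNorm χ ε j₂ v₂ * shortNorm χ ε j₃ v₃)) := by
    intro i _
    have hle : |p (i + 1) - p i| ≤ (((2 : ℝ) ^ j₃) ^ 2)⁻¹ := by
      rw [hstep, hnM, div_eq_mul_inv]
      exact mul_le_of_le_one_left (by positivity) (htT.trans hT)
    refine (tsum_integral_coeff_le hχ hε h12 h23 hv₁ hv₂ hv₃ hN₁ hN₂ hN₃ hle).trans ?_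
    refine mul_le_mul' (esqrt_mono ?_) le_rfl
    rw [hstep, hnM, ← mul_div_assoc, Real.sqrt_div (by positivity), Real.sqrt_sq hM0.le]
    gcongr
  calc _ ≤ ∑' k₁, ∑' k₂, ∑ i ∈ Finset.range n, c k₁ k₂ * (W k₁ k₂ * ‖J i k₁ k₂‖ₑ) :=
        ENNReal.tsum_le_tsum fun k₁ => ENNReal.tsum_le_tsum fun k₂ => hpt k₁ k₂
    _ = ∑ i ∈ Finset.range n, ∑' k₁, ∑' k₂, c k₁ k₂ * (W k₁ k₂ * ‖J i k₁ k₂‖ₑ) := by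
        rw [← Summable.tsum_finsetSum fun i _ => ENNReal.summable]
        refine tsum_congr fun k₁ => ?_
        rw [← Summable.tsum_finsetSum fun i _ => ENNReal.summable]
    _ ≤ ∑ i ∈ Finset.range n, esqrt (Real.sqrt (27 * T) / M) *
        (64 * triConst * esqrt ((2 ^ j₁) ^ 3 / M ^ 3) *
        (shortNorm χ ε j₁ v₁ * shortNorm χ ε j₂ v₂ * shortNorm χ ε j₃ v₃)) :=
        Finset.sum_le_sum hwin
    _ = (esqrt ((M ^ 2) ^ 2) * (esqrt (Real.sqrt (27 * T) / M) * esqrt ((2 ^ j₁) ^ 3 / M ^ 3))) *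
        (64 * triConst *
        (shortNorm χ ε j₁ v₁ * shortNorm χ ε j₂ v₂ * shortNorm χ ε j₃ v₃)) := by
        rw [Finset.sum_const, Finset.card_range, nsmul_eq_mul, esqrt_sq (by positivity), ← hnM,
          ENNReal.ofReal_natCast]
        ring
    -- The M² windows exactly consume the gains M^{-1/2} from the length and M^{-3/2} from the
    -- trilinear estimate: no power of the largest frequency remains.
    _ = (esqrt (Real.sqrt (27 * T)) * esqrt ((2 ^ j₁) ^ 3)) * (64 * triConst *
        (shortNorm χ ε j₁ v₁ * shortNorm χ ε j₂ v₂ * shortNorm χ ε j₃ v₃)) := by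
        rw [esqrt_mul (by positivity), esqrt_mul (by positivity), esqrt_mul (by positivity)]
        congr 2
        field_simp
    _ = _ := by ring

/-! ### The cubic sum over dyadic blocks -/

/-- The part of the cubic sum with frequencies in the blocks `j₁, j₂, j₃`. -/
def blockSum (σ : ℝ) (j : ℕ) (a : ℝ → Freq → ℂ) (t : ℝ) (j₁ j₂ j₃ : ℕ) : ℝ≥0∞ :=
  ∑' k₁, ∑' k₂, tripInd j₁ j₂ j₃ k₁ k₂ * (‖symbol σ j k₁ k₂‖ₑ * ‖tripInt a t k₁ k₂‖ₑ)

lemma symbol_swap (σ : ℝ) (j : ℕ) (k₁ k₂ : Freq) : symbol σ j k₂ k₁ = symbol σ j k₁ k₂ := by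
  rw [symbol, symbol, show -k₂ - k₁ = -k₁ - k₂ by abel]
  ring

lemma symbol_swap_right (σ : ℝ) (j : ℕ) (k₁ k₂ : Freq) :
    symbol σ j k₁ (-k₁ - k₂) = symbol σ j k₁ k₂ := by
  rw [symbol, symbol, sub_sub_cancel]
  ring

lemma blockSum_swap (σ : ℝ) (j : ℕ) (a : ℝ → Freq → ℂ) (t : ℝ) (j₁ j₂ j₃ : ℕ) :
    blockSum σ j a t j₁ j₂ j₃ = blockSum σ j a t j₂ j₁ j₃ := by
  unfold blockSum
  rw [ENNReal.tsum_comm]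
  refine tsum_congr fun k₁ => tsum_congr fun k₂ => ?_
  rw [tripInd_swap, symbol_swap, tripInt_swap]

lemma blockSum_swap_right (σ : ℝ) (j : ℕ) (a : ℝ → Freq → ℂ) (t : ℝ) (j₁ j₂ j₃ : ℕ) :
    blockSum σ j a t j₁ j₂ j₃ = blockSum σ j a t j₁ j₃ j₂ := by
  unfold blockSum
  refine tsum_congr fun k₁ => ?_
  rw [← (thirdEquiv k₁).tsum_eq]
  refine tsum_congr fun k₂ => ?_
  change tripInd j₁ j₂ j₃ k₁ (-k₁ - k₂) * (‖symbol σ j k₁ (-k₁ - k₂)‖ₑ *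
    ‖tripInt a t k₁ (-k₁ - k₂)‖ₑ) = _
  rw [tripInd_swap_right, symbol_swap_right, tripInt_swap_right]

lemma tripInt_eq_zero {a : ℝ → Freq → ℂ} {t : ℝ} {k₁ k₂ : Freq}
    (h : ∀ s ∈ uIcc 0 t, a s k₁ * a s k₂ * a s (-k₁ - k₂) = 0) : tripInt a t k₁ k₂ = 0 := by
  rw [tripInt, intervalIntegral.integral_congr (g := fun _ => (0 : ℂ)) h,
    intervalIntegral.integral_zero]

/-- Triples with a vanishing first frequency contribute nothing, and every other triple lies in the
blocks given by `blkIndex`. -/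
lemma tsum_symbol_le_tsum_blockSum (σ : ℝ) (j : ℕ) {a : ℝ → Freq → ℂ} {T t : ℝ}
    (ht : t ∈ Icc (-T) T) (ha : ∀ s ∈ Icc (-T) T, ∀ k : Freq, k 0 = 0 → a s k = 0) :
    ∑' k₁, ∑' k₂, ‖symbol σ j k₁ k₂‖ₑ * ‖tripInt a t k₁ k₂‖ₑ ≤
      ∑' j₁, ∑' j₂, ∑' j₃, blockSum σ j a t j₁ j₂ j₃ := by
  have hpt : ∀ k₁ k₂, ‖symbol σ j k₁ k₂‖ₑ * ‖tripInt a t k₁ k₂‖ₑ ≤ ∑' j₁, ∑' j₂, ∑' j₃,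
      tripInd j₁ j₂ j₃ k₁ k₂ * (‖symbol σ j k₁ k₂‖ₑ * ‖tripInt a t k₁ k₂‖ₑ) := by
    intro k₁ k₂
    have hsub : uIcc 0 t ⊆ Icc (-T) T :=
      uIcc_subset_Icc ⟨by linarith [ht.1, ht.2], by linarith [ht.1, ht.2]⟩ ht
    by_cases h1 : k₁ 0 = 0
    · rw [tripInt_eq_zero fun s hs => by rw [ha s (hsub hs) k₁ h1]; ring]
      simp
    by_cases h2 : k₂ 0 = 0
    · rw [tripInt_eq_zero fun s hs => by rw [ha s (hsub hs) k₂ h2]; ring]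
      simp
    by_cases h3 : (-k₁ - k₂) 0 = 0
    · rw [tripInt_eq_zero fun s hs => by rw [ha s (hsub hs) _ h3]; ring]
      simp
    have hI : tripInd (blkIndex (k₁ 0)) (blkIndex (k₂ 0)) (blkIndex ((-k₁ - k₂) 0)) k₁ k₂ = 1 := by
      rw [tripInd, indicator_of_mem (mem_blk_blkIndex h1), indicator_of_mem (mem_blk_blkIndex h2),
        indicator_of_mem (mem_blk_blkIndex h3)]
      simp
    refine le_trans ?_ (ENNReal.le_tsum (blkIndex (k₁ 0)))
    refine le_trans ?_ (ENNReal.le_tsum (blkIndex (k₂ 0)))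
    refine le_trans ?_ (ENNReal.le_tsum (blkIndex ((-k₁ - k₂) 0)))
    rw [hI, one_mul]
  have hcomm : ∀ f : Freq → Freq → ℕ → ℝ≥0∞,
      ∑' k₁, ∑' k₂, ∑' i, f k₁ k₂ i = ∑' i, ∑' k₁, ∑' k₂, f k₁ k₂ i := fun f => by
    rw [ENNReal.tsum_comm (f := fun i k₁ => ∑' k₂, f k₁ k₂ i)]
    exact tsum_congr fun k₁ => ENNReal.tsum_comm
  calc _ ≤ ∑' k₁, ∑' k₂, ∑' j₁, ∑' j₂, ∑' j₃,
      tripInd j₁ j₂ j₃ k₁ k₂ * (‖symbol σ j k₁ k₂‖ₑ * ‖tripInt a t k₁ k₂‖ₑ) :=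
        ENNReal.tsum_le_tsum fun k₁ => ENNReal.tsum_le_tsum fun k₂ => hpt k₁ k₂
    _ = _ := by
        rw [hcomm]
        refine tsum_congr fun j₁ => ?_
        rw [hcomm]
        refine tsum_congr fun j₂ => ?_
        rw [hcomm]
        rfl

/-- A symmetric triple sum is at most six times the sum over ordered indices. -/
lemma tsum_le_six_mul {B : ℕ → ℕ → ℕ → ℝ≥0∞} (h12 : ∀ i j k, B i j k = B j i k)
    (h23 : ∀ i j k, B i j k = B i k j) :
    ∑' i, ∑' j, ∑' k, B i j k ≤ 6 * ∑' i, ∑' j, ∑' k, if i ≤ j ∧ j ≤ k then B i j k else 0 := by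
  set S : ℕ → ℕ → ℕ → ℝ≥0∞ := fun i j k => if i ≤ j ∧ j ≤ k then B i j k else 0 with hS
  have hpt : ∀ i j k, B i j k ≤ S i j k + S i k j + S j i k + S j k i + S k i j + S k j i := by
    intro i j k
    have hle : ∀ i j k, i ≤ j → j ≤ k → B i j k ≤ S i j k := fun i j k h1 h2 => by
      simp only [hS]; rw [if_pos ⟨h1, h2⟩]
    rcases le_total i j with hij | hij <;> rcases le_total j k with hjk | hjk <;>
      rcases le_total i k with hik | hik
    · exact (hle i j k hij hjk).trans (by simp only [add_assoc]; exact le_self_add)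
    · exact (hle i j k hij hjk).trans (by simp only [add_assoc]; exact le_self_add)
    · rw [h23]
      refine (hle i k j hik hjk).trans ?_
      calc S i k j ≤ S i k j + (S i j k + S j i k + S j k i + S k i j + S k j i) := le_self_add
        _ = _ := by ring
    · rw [h23, h12]
      refine (hle k i j hik hij).trans ?_
      calc S k i j ≤ S k i j + (S i j k + S i k j + S j i k + S j k i + S k j i) := le_self_add
        _ = _ := by ring
    · rw [h12]
      refine (hle j i k hij hik).trans ?_
      calc S j i k ≤ S j i k + (S i j k + S i k j + S j k i + S k i j + S k j i) := le_self_add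
        _ = _ := by ring
    · rw [h12, h23]
      refine (hle j k i hjk hik).trans ?_
      calc S j k i ≤ S j k i + (S i j k + S i k j + S j i k + S k i j + S k j i) := le_self_add
        _ = _ := by ring
    · rw [h12, h23, h12]
      refine (hle k j i hjk hij).trans ?_
      calc S k j i ≤ S k j i + (S i j k + S i k j + S j i k + S j k i + S k i j) := le_self_add
        _ = _ := by ring
    · rw [h12, h23, h12]
      refine (hle k j i hjk hij).trans ?_
      calc S k j i ≤ S k j i + (S i j k + S i k j + S j i k + S j k i + S k i j) := le_self_add
        _ = _ := by ring
  have c23 : ∀ F : ℕ → ℕ → ℕ → ℝ≥0∞,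
      ∑' i, ∑' j, ∑' k, F i k j = ∑' i, ∑' j, ∑' k, F i j k :=
    fun F => tsum_congr fun i => ENNReal.tsum_comm
  have c12 : ∀ F : ℕ → ℕ → ℕ → ℝ≥0∞,
      ∑' i, ∑' j, ∑' k, F j i k = ∑' i, ∑' j, ∑' k, F i j k := fun F => ENNReal.tsum_comm
  calc ∑' i, ∑' j, ∑' k, B i j k ≤ ∑' i, ∑' j, ∑' k,
        (S i j k + S i k j + S j i k + S j k i + S k i j + S k j i) :=
        ENNReal.tsum_le_tsum fun i => ENNReal.tsum_le_tsum fun j => ENNReal.tsum_le_tsum fun k =>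
          hpt i j k
    _ = 6 * ∑' i, ∑' j, ∑' k, S i j k := by
        simp only [ENNReal.tsum_add]
        have e3 := (c12 fun i j k => S i k j).trans (c23 S)
        rw [c23 S, c12 S, e3, (c23 fun i j k => S j i k).trans (c12 S),
          (c23 fun i j k => S j k i).trans e3]
        ring

/-! ### The bound on a single block -/

lemma exists_shortNorm_lt {χ : ℝ → ℝ} {ε : ℝ} {j : ℕ} {T : ℝ} {u : ℝ → L2Torus} {N : ℝ≥0∞}
    (h : shortNormOn χ ε j T u < N) : ∃ v : ℝ → L2Torus, ContinuousInto univ v ∧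
      (∀ s ∈ Icc (-T) T, ∀ k : Freq, k 0 ∈ blk j → coeff (v s) k = coeff (u s) k) ∧
      shortNorm χ ε j v < N := by
  simp only [shortNormOn, iInf_lt_iff] at h
  obtain ⟨v, h1, -, h3, h4⟩ := h
  refine ⟨v, h1, fun s hs k hk => ?_, h4⟩
  rw [h3 s hs, proj, indicator_of_mem]
  exact blk_subset_freqBlock j hk

/-- The infimum over extensions need not be attained; near-minimizers are used and the excess δ is
sent to 0. -/
lemma le_mul_of_forall_lt {X D : ℝ≥0∞} {n₁ n₂ n₃ : ℝ≥0∞} (hD : D ≠ ⊤) (h₁ : n₁ ≠ ⊤)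
    (h₂ : n₂ ≠ ⊤) (h₃ : n₃ ≠ ⊤)
    (h : ∀ N₁ N₂ N₃ : ℝ≥0∞, n₁ < N₁ → n₂ < N₂ → n₃ < N₃ → X ≤ D * (N₁ * N₂ * N₃)) :
    X ≤ D * (n₁ * n₂ * n₃) := by
  lift D to ℝ≥0 using hD
  lift n₁ to ℝ≥0 using h₁
  lift n₂ to ℝ≥0 using h₂
  lift n₃ to ℝ≥0 using h₃
  have hc : Continuous fun δ : ℝ≥0 => D * ((n₁ + δ) * (n₂ + δ) * (n₃ + δ)) := by fun_prop
  have ht : Tendsto (fun δ : ℝ≥0 => ((D * ((n₁ + δ) * (n₂ + δ) * (n₃ + δ)) : ℝ≥0) : ℝ≥0∞))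
      (𝓝[>] 0) (𝓝 ((D * ((n₁ + 0) * (n₂ + 0) * (n₃ + 0)) : ℝ≥0) : ℝ≥0∞)) :=
    (ENNReal.tendsto_coe.2 (hc.tendsto 0)).mono_left nhdsWithin_le_nhds
  simp only [add_zero] at ht
  have hX : X ≤ ((D * (n₁ * n₂ * n₃) : ℝ≥0) : ℝ≥0∞) := by
    refine ge_of_tendsto ht ?_
    filter_upwards [self_mem_nhdsWithin] with δ hδ
    have hδ0 : 0 < δ := hδ
    have hlt : ∀ n : ℝ≥0, (n : ℝ≥0∞) < ((n + δ : ℝ≥0) : ℝ≥0∞) := fun n => by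
      exact_mod_cast lt_add_of_pos_right n hδ0
    have := h _ _ _ (hlt n₁) (hlt n₂) (hlt n₃)
    exact_mod_cast this
  exact_mod_cast hX

/-- The symbol bound meets the trilinear estimate for near-optimal extensions of the three pieces of
u, which may be unrelated to each other since only their values on [-T, T] enter the integral. -/
lemma blockSum_le {χ : ℝ → ℝ} (hχ : IsCutoff χ) {ε : ℝ} (hε : |ε| = 1) {σ : ℝ} (hσ : 2 ≤ σ)
    (j : ℕ) {j₁ j₂ j₃ : ℕ} (h12 : j₁ ≤ j₂) (h23 : j₂ ≤ j₃) {u : ℝ → L2Torus} {T t : ℝ}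
    (hT : T ≤ 1) (ht : t ∈ Icc (-T) T) (hn : ∀ i, shortNormOn χ ε i T u ≠ ⊤) :
    blockSum σ j (fun s => coeff (u s)) t j₁ j₂ j₃ ≤ (near j j₁ + near j j₂ + near j j₃) *
      (symConst σ * ENNReal.ofReal (((2 : ℝ) ^ j₃) ^ (2 * σ)) *
        (64 * triConst * esqrt (Real.sqrt (27 * T)) * esqrt ((2 ^ j₁) ^ 3))) *
      (shortNormOn χ ε j₁ T u * shortNormOn χ ε j₂ T u * shortNormOn χ ε j₃ T u) := by
  set R := (near j j₁ + near j j₂ + near j j₃) *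
    (symConst σ * ENNReal.ofReal (((2 : ℝ) ^ j₃) ^ (2 * σ))) with hR
  set Q := 64 * triConst * esqrt (Real.sqrt (27 * T)) * esqrt ((2 ^ j₁) ^ 3) with hQ
  have hnear : ∀ i, near j i ≠ ⊤ := fun i => by unfold near; split_ifs <;> simp
  have hRtop : R ≠ ⊤ := by
    refine ENNReal.mul_ne_top (ENNReal.add_ne_top.2 ⟨ENNReal.add_ne_top.2 ⟨hnear _, hnear _⟩,
      hnear _⟩) (ENNReal.mul_ne_top ?_ ENNReal.ofReal_ne_top)
    exact ENNReal.ofReal_ne_top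
  have hQtop : Q ≠ ⊤ := ENNReal.mul_ne_top (ENNReal.mul_ne_top (ENNReal.mul_ne_top (by simp)
    triConst_ne_top) (esqrt_ne_top _)) (esqrt_ne_top _)
  rw [← mul_assoc (near j j₁ + near j j₂ + near j j₃), ← hR]
  refine le_mul_of_forall_lt (ENNReal.mul_ne_top hRtop hQtop) (hn _) (hn _) (hn _)
    fun N₁ N₂ N₃ h₁ h₂ h₃ => ?_
  obtain ⟨v₁, hv₁, ha₁, hN₁⟩ := exists_shortNorm_lt h₁
  obtain ⟨v₂, hv₂, ha₂, hN₂⟩ := exists_shortNorm_lt h₂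
  obtain ⟨v₃, hv₃, ha₃, hN₃⟩ := exists_shortNorm_lt h₃
  have hmain := tsum_tripInt_le hχ hε h12 h23 hv₁ hv₂ hv₃ hN₁.ne_top hN₂.ne_top hN₃.ne_top
    (a := fun s => coeff (u s)) hT ht ha₁ ha₂ ha₃
  calc _ ≤ ∑' k₁, ∑' k₂, R * (tripInd j₁ j₂ j₃ k₁ k₂ * symBound j₁ j₃ k₁ k₂ *
      (ENNReal.ofReal (weight k₁) * ENNReal.ofReal (weight k₂) *
        ENNReal.ofReal (weight (-k₁ - k₂)) * ‖tripInt (fun s => coeff (u s)) t k₁ k₂‖ₑ)) := by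
        refine ENNReal.tsum_le_tsum fun k₁ => ENNReal.tsum_le_tsum fun k₂ => ?_
        rw [← mul_assoc]
        refine (mul_le_mul' (enorm_symbol_le hσ j h12 h23 k₁ k₂) le_rfl).trans (le_of_eq ?_)
        rw [← hR]
        ring
    _ ≤ R * (Q * (N₁ * N₂ * N₃)) := by
        simp_rw [ENNReal.tsum_mul_left]
        refine mul_le_mul' le_rfl (hmain.trans ?_)
        gcongr
    _ = _ := by ring

lemma blockSum_eq_zero {σ : ℝ} {j : ℕ} {a : ℝ → Freq → ℂ} {t : ℝ} {j₁ j₂ j₃ : ℕ} (h12 : j₁ ≤ j₂)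
    (h : ¬ j₃ ≤ j₂ + 2) : blockSum σ j a t j₁ j₂ j₃ = 0 := by
  unfold blockSum
  simp only [ENNReal.tsum_eq_zero]
  intro k₁ k₂
  rcases tripInd_cases j₁ j₂ j₃ k₁ k₂ with h0 | ⟨-, b₁, b₂, b₃⟩
  · rw [h0, zero_mul]
  · refine absurd ?_ h
    have := le_four_mul h12 b₁ b₂ b₃
    rw [show (4 : ℝ) * 2 ^ j₂ = 2 ^ (j₂ + 2) by ring] at this
    exact (pow_le_pow_iff_right₀ (by norm_num)).1 this

/-! ### Summation over the dyadic blocks -/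

lemma ofReal_two_pow_rpow (j : ℕ) (s : ℝ) :
    ENNReal.ofReal (((2 : ℝ) ^ j) ^ s) = ((2 : ℝ≥0∞) ^ j) ^ s := by
  rw [← ENNReal.ofReal_rpow_of_pos (by positivity), ENNReal.ofReal_pow (by norm_num),
    ENNReal.ofReal_ofNat]

/-- The constant `2` in the Cauchy–Schwarz inequality over the lowest frequency. -/
lemma l2_esqrt_inv_le : l2 (fun j : ℕ => esqrt ((2 : ℝ) ^ j)⁻¹) ≤ 2 := by
  have h : ∑' j : ℕ, esqrt ((2 : ℝ) ^ j)⁻¹ ^ 2 = 2 := by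
    rw [← ENNReal.tsum_geometric_two]
    refine tsum_congr fun j => ?_
    rw [esqrt, rpow_half_sq, ENNReal.ofReal_inv_of_pos (by positivity),
      ENNReal.ofReal_pow (by norm_num), ENNReal.ofReal_ofNat, ENNReal.inv_pow]
  rw [l2, h, rpow_half_le_iff]
  norm_num

/-- Write a^{3/2} = a^{-1/2} a²: the spare half power is summable, and a² is the weight of the F
norm. -/
lemma tsum_esqrt_mul_le (n : ℕ → ℝ≥0∞) : ∑' j : ℕ, esqrt (((2 : ℝ) ^ j) ^ 3) * n j ≤
    2 * (∑' j : ℕ, ((2 : ℝ≥0∞) ^ j) ^ (2 * (2 : ℝ)) * n j ^ 2) ^ (1 / 2 : ℝ) := by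
  have e : ∀ j : ℕ, esqrt (((2 : ℝ) ^ j) ^ 3) * n j =
      esqrt ((2 : ℝ) ^ j)⁻¹ * (ENNReal.ofReal (((2 : ℝ) ^ j) ^ 2) * n j) := fun j => by
    rw [← mul_assoc, ← esqrt_sq (by positivity), esqrt_mul (by positivity)]
    congr 2
    field_simp
  simp_rw [e]
  refine (tsum_mul_le_l2 _ _).trans (mul_le_mul' l2_esqrt_inv_le (rpow_half_mono
    (ENNReal.tsum_le_tsum fun j => ?_)))
  rw [mul_pow, ← ENNReal.ofReal_pow (by positivity), ← ofReal_two_pow_rpow]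
  gcongr
  rw [← pow_mul, show 2 * (2 : ℝ) = ((2 * 2 : ℕ) : ℝ) by norm_num, Real.rpow_natCast]

lemma tsum_close_le (j₂ : ℕ) :
    ∑' j₃ : ℕ, (if j₂ ≤ j₃ ∧ j₃ ≤ j₂ + 2 then (1 : ℝ≥0∞) else 0) ≤ 3 := by
  rw [tsum_eq_sum (s := Finset.Icc j₂ (j₂ + 2)) fun j hj => if_neg (by simpa using hj)]
  refine (Finset.sum_le_card_nsmul _ _ 1 fun j _ => by split_ifs <;> simp).trans ?_
  rw [Nat.card_Icc, nsmul_eq_mul, show j₂ + 2 + 1 - j₂ = 3 by omega]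
  norm_num

lemma tsum_close_le' (j₃ : ℕ) :
    ∑' j₂ : ℕ, (if j₂ ≤ j₃ ∧ j₃ ≤ j₂ + 2 then (1 : ℝ≥0∞) else 0) ≤ 3 := by
  rw [tsum_eq_sum (s := Finset.Icc (j₃ - 2) j₃)
    fun j hj => if_neg (by rw [Finset.mem_Icc] at hj; omega)]
  refine (Finset.sum_le_card_nsmul _ _ 1 fun j _ => by split_ifs <;> simp).trans ?_
  rw [Nat.card_Icc, nsmul_eq_mul, mul_one]
  exact_mod_cast (by omega : j₃ + 1 - (j₃ - 2) ≤ 3)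

/-- For j₃ ≤ j₂ + 2 the full weight at j₃ is shared between both indices at the price 4^σ. Then xy ≤
x² + y², and each index has at most three partners. -/
lemma tsum_close_mul_le {σ : ℝ} (hσ : 0 ≤ σ) (n : ℕ → ℝ≥0∞) :
    ∑' j₂ : ℕ, ∑' j₃ : ℕ, (if j₂ ≤ j₃ ∧ j₃ ≤ j₂ + 2 then (1 : ℝ≥0∞) else 0) *
      (ENNReal.ofReal (((2 : ℝ) ^ j₃) ^ (2 * σ)) * (n j₂ * n j₃)) ≤
    6 * ENNReal.ofReal (4 ^ σ) * ∑' j : ℕ, ((2 : ℝ≥0∞) ^ j) ^ (2 * σ) * n j ^ 2 := by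
  set c : ℕ → ℕ → ℝ≥0∞ := fun j₂ j₃ => if j₂ ≤ j₃ ∧ j₃ ≤ j₂ + 2 then (1 : ℝ≥0∞) else 0 with hc
  set f : ℕ → ℝ≥0∞ := fun j => ENNReal.ofReal (((2 : ℝ) ^ j) ^ σ) * n j with hf
  have hf2 : ∀ j : ℕ, f j ^ 2 = ((2 : ℝ≥0∞) ^ j) ^ (2 * σ) * n j ^ 2 := fun j => by
    rw [hf, mul_pow, ← ENNReal.ofReal_pow (by positivity), ← ofReal_two_pow_rpow,
      ← Real.rpow_natCast, ← Real.rpow_mul (by positivity), mul_comm σ]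
    norm_num
  have hprod : ∀ x y : ℝ≥0∞, x * y ≤ x ^ 2 + y ^ 2 := fun x y => by
    rcases le_total x y with h | h
    · calc x * y ≤ y * y := by gcongr
        _ = y ^ 2 := (sq y).symm
        _ ≤ _ := le_add_self
    · calc x * y ≤ x * x := by gcongr
        _ = x ^ 2 := (sq x).symm
        _ ≤ _ := le_self_add
  have hpt : ∀ j₂ j₃ : ℕ, c j₂ j₃ * (ENNReal.ofReal (((2 : ℝ) ^ j₃) ^ (2 * σ)) * (n j₂ * n j₃)) ≤
      ENNReal.ofReal (4 ^ σ) * (c j₂ j₃ * f j₂ ^ 2 + c j₂ j₃ * f j₃ ^ 2) := by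
    intro j₂ j₃
    by_cases h : j₂ ≤ j₃ ∧ j₃ ≤ j₂ + 2
    · simp only [hc, if_pos h, one_mul]
      have hreal : ((2 : ℝ) ^ j₃) ^ (2 * σ) ≤ 4 ^ σ * (((2 : ℝ) ^ j₂) ^ σ * ((2 : ℝ) ^ j₃) ^ σ) := by
        rw [two_mul, Real.rpow_add (by positivity), ← mul_assoc,
          ← Real.mul_rpow (x := 4) (by norm_num) (by positivity)]
        gcongr
        calc (2 : ℝ) ^ j₃ ≤ 2 ^ (j₂ + 2) := pow_le_pow_right₀ (by norm_num) h.2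
          _ = 4 * 2 ^ j₂ := by ring
      calc _ ≤ ENNReal.ofReal (4 ^ σ * (((2 : ℝ) ^ j₂) ^ σ * ((2 : ℝ) ^ j₃) ^ σ)) *
            (n j₂ * n j₃) := by gcongr
        _ = ENNReal.ofReal (4 ^ σ) * (f j₂ * f j₃) := by
            rw [ENNReal.ofReal_mul (by positivity), ENNReal.ofReal_mul (by positivity), hf]
            ring
        _ ≤ _ := by gcongr; exact hprod _ _
    · simp only [hc, if_neg h, zero_mul, zero_le]
  calc _ ≤ ∑' j₂ : ℕ, ∑' j₃ : ℕ,
        ENNReal.ofReal (4 ^ σ) * (c j₂ j₃ * f j₂ ^ 2 + c j₂ j₃ * f j₃ ^ 2) :=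
        ENNReal.tsum_le_tsum fun j₂ => ENNReal.tsum_le_tsum fun j₃ => hpt j₂ j₃
    _ = ENNReal.ofReal (4 ^ σ) * (∑' j₂ : ℕ, (∑' j₃ : ℕ, c j₂ j₃) * f j₂ ^ 2 +
          ∑' j₃ : ℕ, (∑' j₂ : ℕ, c j₂ j₃) * f j₃ ^ 2) := by
        simp only [ENNReal.tsum_mul_left, ENNReal.tsum_add, ENNReal.tsum_mul_right]
        rw [ENNReal.tsum_comm (f := fun j₂ j₃ => c j₂ j₃ * f j₃ ^ 2)]
        simp only [ENNReal.tsum_mul_right]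
    _ ≤ ENNReal.ofReal (4 ^ σ) * (∑' j₂ : ℕ, 3 * f j₂ ^ 2 + ∑' j₃ : ℕ, 3 * f j₃ ^ 2) := by
        gcongr
        · exact tsum_close_le _
        · exact tsum_close_le' _
    _ = _ := by
        simp only [ENNReal.tsum_mul_left, hf2]
        ring

/-- The bound for the sum over ordered triples of blocks, for the energy of index `j`. -/
def cubicBound (σ : ℝ) (n : ℕ → ℝ≥0∞) (j : ℕ) : ℝ≥0∞ :=
  ∑' j₁, ∑' j₂, ∑' j₃, (near j j₁ + near j j₂ + near j j₃) * (esqrt (((2 : ℝ) ^ j₁) ^ 3) * n j₁ *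
    ((if j₂ ≤ j₃ ∧ j₃ ≤ j₂ + 2 then (1 : ℝ≥0∞) else 0) *
      (ENNReal.ofReal (((2 : ℝ) ^ j₃) ^ (2 * σ)) * (n j₂ * n j₃))))

/-- Summing over j first removes the factors `near` at the cost 9. The lowest index then decouples
from the other two; the constant is 9 · 2 · 6. -/
lemma tsum_cubicBound_le {σ : ℝ} (hσ : 0 ≤ σ) (n : ℕ → ℝ≥0∞) :
    ∑' j, cubicBound σ n j ≤ 108 * ENNReal.ofReal (4 ^ σ) *
      ((∑' j : ℕ, ((2 : ℝ≥0∞) ^ j) ^ (2 * (2 : ℝ)) * n j ^ 2) ^ (1 / 2 : ℝ) *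
        ∑' j : ℕ, ((2 : ℝ≥0∞) ^ j) ^ (2 * σ) * n j ^ 2) := by
  set x : ℕ → ℝ≥0∞ := fun j₁ => esqrt (((2 : ℝ) ^ j₁) ^ 3) * n j₁ with hx
  set y : ℕ → ℕ → ℝ≥0∞ := fun j₂ j₃ => (if j₂ ≤ j₃ ∧ j₃ ≤ j₂ + 2 then (1 : ℝ≥0∞) else 0) *
      (ENNReal.ofReal (((2 : ℝ) ^ j₃) ^ (2 * σ)) * (n j₂ * n j₃)) with hy
  have hnear : ∀ j₁ j₂ j₃, ∑' j, (near j j₁ + near j j₂ + near j j₃) ≤ 9 := fun j₁ j₂ j₃ => by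
    rw [ENNReal.tsum_add, ENNReal.tsum_add]
    calc _ ≤ (3 : ℝ≥0∞) + 3 + 3 := by gcongr <;> exact tsum_near_le _
      _ = 9 := by norm_num
  calc ∑' j, cubicBound σ n j = ∑' j₁, ∑' j₂, ∑' j₃,
        (∑' j, (near j j₁ + near j j₂ + near j j₃)) * (x j₁ * y j₂ j₃) := by
        unfold cubicBound
        rw [ENNReal.tsum_comm]
        refine tsum_congr fun j₁ => ?_
        rw [ENNReal.tsum_comm]
        refine tsum_congr fun j₂ => ?_
        rw [ENNReal.tsum_comm]
        refine tsum_congr fun j₃ => ?_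
        rw [ENNReal.tsum_mul_right]
    _ ≤ ∑' j₁, ∑' j₂, ∑' j₃, 9 * (x j₁ * y j₂ j₃) :=
        ENNReal.tsum_le_tsum fun j₁ => ENNReal.tsum_le_tsum fun j₂ => ENNReal.tsum_le_tsum fun j₃ =>
          mul_le_mul' (hnear j₁ j₂ j₃) le_rfl
    _ = 9 * ((∑' j₁, x j₁) * ∑' j₂, ∑' j₃, y j₂ j₃) := by
        simp only [ENNReal.tsum_mul_left, ENNReal.tsum_mul_right]
    _ ≤ 9 * ((2 * (∑' j : ℕ, ((2 : ℝ≥0∞) ^ j) ^ (2 * (2 : ℝ)) * n j ^ 2) ^ (1 / 2 : ℝ)) *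
          (6 * ENNReal.ofReal (4 ^ σ) * ∑' j : ℕ, ((2 : ℝ≥0∞) ^ j) ^ (2 * σ) * n j ^ 2)) :=
        mul_le_mul' le_rfl (mul_le_mul' (tsum_esqrt_mul_le n) (tsum_close_mul_le hσ n))
    _ = _ := by ring

/-! ### The energy estimate -/

/-- The constant in the estimate of the cubic term. -/
def cubicConst (σ : ℝ) : ℝ≥0∞ := 384 * symConst σ * triConst * esqrt (Real.sqrt 27)

lemma cubicConst_ne_top (σ : ℝ) : cubicConst σ ≠ ⊤ :=
  ENNReal.mul_ne_top (ENNReal.mul_ne_top (ENNReal.mul_ne_top (by simp) ENNReal.ofReal_ne_top)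
    triConst_ne_top) (esqrt_ne_top _)

/-- Two nested square roots are the origin of the exponent 1/4. -/
lemma esqrt_sqrt_mul {T : ℝ} (hT : 0 ≤ T) : esqrt (Real.sqrt (27 * T)) =
    esqrt (Real.sqrt 27) * ENNReal.ofReal (T ^ (1 / 4 : ℝ)) := by
  have e : Real.sqrt T = (T ^ (1 / 4 : ℝ)) ^ 2 := by
    rw [Real.sqrt_eq_rpow, ← Real.rpow_natCast, ← Real.rpow_mul hT]; norm_num
  rw [Real.sqrt_mul (by norm_num), ← esqrt_mul (Real.sqrt_nonneg _), e,
    esqrt_sq (Real.rpow_nonneg hT _)]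

/-- The bound does not depend on t, so the supremum over time can be taken for each j before the
blocks are summed. -/
lemma tsum_symbol_mul_tripInt_le {χ : ℝ → ℝ} (hχ : IsCutoff χ) {ε : ℝ} (hε : |ε| = 1) {σ : ℝ}
    (hσ : 2 ≤ σ) (j : ℕ) {u : ℝ → L2Torus} {T t : ℝ} (hT : T ≤ 1) (ht : t ∈ Icc (-T) T)
    (hu : ContinuousInto (Icc (-T) T) u) (hn : ∀ i, shortNormOn χ ε i T u ≠ ⊤) :
    ∑' k₁, ∑' k₂, ‖symbol σ j k₁ k₂‖ₑ * ‖tripInt (fun s => coeff (u s)) t k₁ k₂‖ₑ ≤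
      cubicConst σ * ENNReal.ofReal (T ^ (1 / 4 : ℝ)) *
        cubicBound σ (fun i => shortNormOn χ ε i T u) j := by
  have hT0 : 0 ≤ T := by linarith [ht.1, ht.2]
  set a : ℝ → Freq → ℂ := fun s => coeff (u s)
  set n : ℕ → ℝ≥0∞ := fun i => shortNormOn χ ε i T u
  refine (tsum_symbol_le_tsum_blockSum σ j ht
    fun s hs k hk => hu.coeff_eq_zero hs hk).trans ?_
  refine (tsum_le_six_mul (blockSum_swap σ j a t) (blockSum_swap_right σ j a t)).trans ?_
  have hpt : ∀ j₁ j₂ j₃, (if j₁ ≤ j₂ ∧ j₂ ≤ j₃ then blockSum σ j a t j₁ j₂ j₃ else 0) ≤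
      (64 * symConst σ * triConst * esqrt (Real.sqrt 27) * ENNReal.ofReal (T ^ (1 / 4 : ℝ))) *
      ((near j j₁ + near j j₂ + near j j₃) * (esqrt (((2 : ℝ) ^ j₁) ^ 3) * n j₁ *
      ((if j₂ ≤ j₃ ∧ j₃ ≤ j₂ + 2 then (1 : ℝ≥0∞) else 0) *
      (ENNReal.ofReal (((2 : ℝ) ^ j₃) ^ (2 * σ)) * (n j₂ * n j₃))))) := by
    intro j₁ j₂ j₃
    by_cases h : j₁ ≤ j₂ ∧ j₂ ≤ j₃
    · rw [if_pos h]
      by_cases h3 : j₃ ≤ j₂ + 2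
      · rw [if_pos ⟨h.2, h3⟩]
        refine (blockSum_le hχ hε hσ j h.1 h.2 hT ht hn).trans (le_of_eq ?_)
        rw [esqrt_sqrt_mul hT0]
        ring
      · rw [blockSum_eq_zero h.1 h3]
        exact zero_le
    · rw [if_neg h]
      exact zero_le
  calc _ ≤ 6 * ∑' j₁, ∑' j₂, ∑' j₃,
      (64 * symConst σ * triConst * esqrt (Real.sqrt 27) * ENNReal.ofReal (T ^ (1 / 4 : ℝ))) *
      ((near j j₁ + near j j₂ + near j j₃) * (esqrt (((2 : ℝ) ^ j₁) ^ 3) * n j₁ *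
      ((if j₂ ≤ j₃ ∧ j₃ ≤ j₂ + 2 then (1 : ℝ≥0∞) else 0) *
      (ENNReal.ofReal (((2 : ℝ) ^ j₃) ^ (2 * σ)) * (n j₂ * n j₃))))) :=
        mul_le_mul' le_rfl (ENNReal.tsum_le_tsum fun j₁ => ENNReal.tsum_le_tsum fun j₂ =>
          ENNReal.tsum_le_tsum fun j₃ => hpt j₁ j₂ j₃)
    _ = _ := by
        rw [cubicBound, cubicConst]
        simp only [ENNReal.tsum_mul_left]
        ring

lemma energyNorm_proj_sq_le {σ : ℝ} (hσ : 2 ≤ σ) (j : ℕ) (a : Freq → ℂ) :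
    energyNorm σ (proj j a) ^ 2 ≤ ENNReal.ofReal (218 * (3 : ℝ) ^ (2 * σ)) *
      ∑' k, ENNReal.ofReal (enWeight σ j k) * ‖a k‖ₑ ^ 2 := by
  rw [energyNorm_eq, l2_sq, ← ENNReal.tsum_mul_left]
  refine ENNReal.tsum_le_tsum fun k => ?_
  by_cases hk : k 0 ∈ freqBlock j
  · rw [proj, indicator_of_mem (show k ∈ {k : Freq | k 0 ∈ freqBlock j} from hk), mul_pow,
      ← mul_assoc, ← ENNReal.ofReal_mul (by positivity), ← ENNReal.ofReal_pow]
    · gcongr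
      exact sq_weight_le_enWeight hσ hk
    · exact mul_nonneg (Real.rpow_nonneg (zero_le_one.trans (one_le_bracket _)) _) (weight_pos k).le
  · rw [proj, indicator_of_notMem (show k ∉ {k : Freq | k 0 ∈ freqBlock j} from hk)]
    simp

lemma tsum_energy_le {σ : ℝ} (hσ : 2 ≤ σ) {a : Freq → ℂ} (ha : ∀ k : Freq, k 0 = 0 → a k = 0) :
    ∑' j, ∑' k, ENNReal.ofReal (enWeight σ j k) * ‖a k‖ₑ ^ 2 ≤
      3 * ENNReal.ofReal (512 * (2 : ℝ) ^ (2 * σ)) * energyNorm σ a ^ 2 := by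
  rw [ENNReal.tsum_comm, energyNorm_eq, l2_sq, ← ENNReal.tsum_mul_left]
  refine ENNReal.tsum_le_tsum fun k => ?_
  by_cases hk : k 0 = 0
  · simp [ha k hk]
  set D := ENNReal.ofReal (512 * (2 : ℝ) ^ (2 * σ))
  calc _ ≤ ∑' j, near j (blkIndex (k 0)) *
        (D * ENNReal.ofReal (bracket (k 0 : ℝ) ^ σ * weight k) ^ 2) * ‖a k‖ₑ ^ 2 :=
        ENNReal.tsum_le_tsum fun j =>
          mul_le_mul' (enWeight_le hσ j (mem_blk_blkIndex hk)) le_rfl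
    _ = (∑' j, near j (blkIndex (k 0))) *
        (D * ENNReal.ofReal (bracket (k 0 : ℝ) ^ σ * weight k) ^ 2) * ‖a k‖ₑ ^ 2 := by
        rw [ENNReal.tsum_mul_right, ENNReal.tsum_mul_right]
    _ ≤ 3 * (D * ENNReal.ofReal (bracket (k 0 : ℝ) ^ σ * weight k) ^ 2) * ‖a k‖ₑ ^ 2 := by
        gcongr
        exact tsum_near_le _
    _ = _ := by ring

lemma shortNormOn_ne_top {χ : ℝ → ℝ} {ε σ T : ℝ} {u : ℝ → L2Torus}
    (h : solutionNorm χ ε σ T u ≠ ⊤) (i : ℕ) : shortNormOn χ ε i T u ≠ ⊤ := by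
  intro hi
  refine h ?_
  have h1 : ((2 : ℝ≥0∞) ^ i) ^ (2 * σ) ≠ 0 := by
    rw [← ofReal_two_pow_rpow]
    exact (ENNReal.ofReal_pos.2 (by positivity)).ne'
  rw [solutionNorm, ENNReal.rpow_eq_top_iff_of_pos (by norm_num)]
  refine ENNReal.tsum_eq_top_of_eq_top ⟨i, ?_⟩
  rw [hi, ENNReal.top_pow (by norm_num), ENNReal.mul_top h1]

/-- It excludes the product 0 · ∞ in the theorem: an infinite F^σ norm forces a nonzero F norm. -/
lemma solutionNorm_eq_zero {χ : ℝ → ℝ} {ε σ σ' T : ℝ} {u : ℝ → L2Torus}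
    (h : solutionNorm χ ε σ T u = 0) : solutionNorm χ ε σ' T u = 0 := by
  rw [solutionNorm, ENNReal.rpow_eq_zero_iff_of_pos (by norm_num), ENNReal.tsum_eq_zero] at h
  rw [solutionNorm, ENNReal.rpow_eq_zero_iff_of_pos (by norm_num), ENNReal.tsum_eq_zero]
  intro j
  have h1 : ((2 : ℝ≥0∞) ^ j) ^ (2 * σ) ≠ 0 := by
    rw [← ofReal_two_pow_rpow]
    exact (ENNReal.ofReal_pos.2 (by positivity)).ne'
  rw [(mul_eq_zero.1 (h j)).resolve_left h1, mul_zero]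

/-- The constant in the energy estimate. -/
def energyConst (σ : ℝ) : ℝ≥0∞ := ENNReal.ofReal (218 * (3 : ℝ) ^ (2 * σ)) *
  (3 * ENNReal.ofReal (512 * (2 : ℝ) ^ (2 * σ)) +
    108 * cubicConst σ * ENNReal.ofReal (4 ^ σ))

lemma energyConst_ne_top (σ : ℝ) : energyConst σ ≠ ⊤ :=
  ENNReal.mul_ne_top ENNReal.ofReal_ne_top (ENNReal.add_ne_top.2
    ⟨ENNReal.mul_ne_top (by simp) ENNReal.ofReal_ne_top,
      ENNReal.mul_ne_top (ENNReal.mul_ne_top (by simp) (cubicConst_ne_top σ))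
        ENNReal.ofReal_ne_top⟩)

/-- The energy estimate for solutions with finite norms. -/
lemma energyTypeNorm_sq_le {χ : ℝ → ℝ} (hχ : IsCutoff χ) {ε : ℝ} (hε : |ε| = 1) {σ : ℝ}
    (hσ : 2 ≤ σ) {u : ℝ → L2Torus} {T : ℝ} (hT0 : 0 ≤ T) (hT : T ≤ 1)
    (hu : ContinuousInto (Icc (-T) T) u) (hs : IsSolution T u)
    (hn : ∀ i, shortNormOn χ ε i T u ≠ ⊤) :
    energyTypeNorm σ T u ^ 2 ≤ energyConst σ * (energyNorm σ (coeff (u 0)) ^ 2 +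
      ENNReal.ofReal (T ^ (1 / 4 : ℝ)) * solutionNorm χ ε 2 T u *
        solutionNorm χ ε σ T u ^ 2) := by
  have hflow := hs.fourierFlow hu
  have h0 : (0 : ℝ) ∈ Icc (-T) T := ⟨by linarith, hT0⟩
  set n : ℕ → ℝ≥0∞ := fun i => shortNormOn χ ε i T u with hndef
  set D₁ := ENNReal.ofReal (218 * (3 : ℝ) ^ (2 * σ)) with hD₁
  set D₂ := ENNReal.ofReal (512 * (2 : ℝ) ^ (2 * σ)) with hD₂
  set τ := ENNReal.ofReal (T ^ (1 / 4 : ℝ)) with hτ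
  have hsup : ∀ j, ⨆ t ∈ Icc (-T) T, energyNorm σ (proj j (coeff (u t))) ^ 2 ≤
      D₁ * (∑' k, ENNReal.ofReal (enWeight σ j k) * ‖coeff (u 0) k‖ₑ ^ 2 +
        cubicConst σ * τ * cubicBound σ n j) := fun j => by
    refine iSup₂_le fun t ht => (energyNorm_proj_sq_le hσ j _).trans ?_
    refine mul_le_mul' le_rfl ((hflow.energy_le σ j hT0 ht).trans ?_)
    exact add_le_add le_rfl (tsum_symbol_mul_tripInt_le hχ hε hσ j hT ht hu hn)
  have hN : solutionNorm χ ε σ T u ^ 2 = ∑' j : ℕ, ((2 : ℝ≥0∞) ^ j) ^ (2 * σ) * n j ^ 2 :=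
    rpow_half_sq _
  have hN2 : solutionNorm χ ε 2 T u =
      (∑' j : ℕ, ((2 : ℝ≥0∞) ^ j) ^ (2 * (2 : ℝ)) * n j ^ 2) ^ (1 / 2 : ℝ) := rfl
  calc energyTypeNorm σ T u ^ 2
      = ∑' j, ⨆ t ∈ Icc (-T) T, energyNorm σ (proj j (coeff (u t))) ^ 2 := rpow_half_sq _
    _ ≤ ∑' j, D₁ * (∑' k, ENNReal.ofReal (enWeight σ j k) * ‖coeff (u 0) k‖ₑ ^ 2 +
        cubicConst σ * τ * cubicBound σ n j) := ENNReal.tsum_le_tsum hsup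
    _ = D₁ * (∑' j, ∑' k, ENNReal.ofReal (enWeight σ j k) * ‖coeff (u 0) k‖ₑ ^ 2 +
        cubicConst σ * τ * ∑' j, cubicBound σ n j) := by
        rw [ENNReal.tsum_mul_left, ENNReal.tsum_add, ENNReal.tsum_mul_left]
    _ ≤ D₁ * (3 * D₂ * energyNorm σ (coeff (u 0)) ^ 2 + cubicConst σ * τ *
        (108 * ENNReal.ofReal (4 ^ σ) *
          (solutionNorm χ ε 2 T u * solutionNorm χ ε σ T u ^ 2))) := by
        rw [hN, hN2]
        exact mul_le_mul' le_rfl (add_le_add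
          (tsum_energy_le hσ fun k hk => hu.coeff_eq_zero h0 hk)
          (mul_le_mul' le_rfl (tsum_cubicBound_le (by linarith) n)))
    _ = D₁ * (3 * D₂ * energyNorm σ (coeff (u 0)) ^ 2 +
        108 * cubicConst σ * ENNReal.ofReal (4 ^ σ) *
          (τ * solutionNorm χ ε 2 T u * solutionNorm χ ε σ T u ^ 2)) := by ring
    _ ≤ D₁ * ((3 * D₂ + 108 * cubicConst σ * ENNReal.ofReal (4 ^ σ)) *
        energyNorm σ (coeff (u 0)) ^ 2 +
        (3 * D₂ + 108 * cubicConst σ * ENNReal.ofReal (4 ^ σ)) *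
          (τ * solutionNorm χ ε 2 T u * solutionNorm χ ε σ T u ^ 2)) := by
        gcongr
        · exact le_self_add
        · exact le_add_self
    _ = _ := by rw [energyConst]; ring

end

end KPOneFifth

/-! ### The energy estimate, with infinite norms included -/

theorem mainTheorem3 (χ : ℝ → ℝ) (hχ : KPOneFifth.IsCutoff χ) :
    ∃ μ₀ : ℝ, 0 < μ₀ ∧ ∀ σ : ℝ, 2 ≤ σ → ∃ C : ℝ≥0,
      ∀ ε : ℝ, (ε = 1 ∨ ε = -1) → ∀ T : ℝ, 0 < T → T < 1 → ∀ u : ℝ → KPOneFifth.L2Torus,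
        KPOneFifth.ContinuousInto (Icc (-T) T) u → KPOneFifth.IsSolution T u →
          KPOneFifth.energyTypeNorm σ T u ^ 2 ≤
            (C : ℝ≥0∞) * (KPOneFifth.energyNorm σ (KPOneFifth.coeff (u 0)) ^ 2 +
              ENNReal.ofReal (T ^ μ₀) * KPOneFifth.solutionNorm χ ε 2 T u *
                KPOneFifth.solutionNorm χ ε σ T u ^ 2) := by
  -- Adding 1 keeps the constant nonzero, so that the right side is infinite when the F^σ norm is.
  refine ⟨1 / 4, by norm_num, fun σ hσ => ⟨(KPOneFifth.energyConst σ + 1).toNNReal, ?_⟩⟩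
  intro ε hε T hT0 hT u hu hs
  have htop : KPOneFifth.energyConst σ + 1 ≠ ⊤ :=
    ENNReal.add_ne_top.2 ⟨KPOneFifth.energyConst_ne_top σ, by simp⟩
  rw [ENNReal.coe_toNNReal htop]
  have hε1 : |ε| = 1 := by rcases hε with rfl | rfl <;> simp
  by_cases hN : KPOneFifth.solutionNorm χ ε σ T u = ⊤
  · have hN2 : KPOneFifth.solutionNorm χ ε 2 T u ≠ 0 := fun h => by
      rw [KPOneFifth.solutionNorm_eq_zero h] at hN
      exact ENNReal.zero_ne_top hN
    have hτ : ENNReal.ofReal (T ^ (1 / 4 : ℝ)) ≠ 0 :=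
      (ENNReal.ofReal_pos.2 (Real.rpow_pos_of_pos hT0 _)).ne'
    rw [hN, ENNReal.top_pow (by norm_num), ENNReal.mul_top (mul_ne_zero hτ hN2), add_top,
      ENNReal.mul_top (by simp)]
    exact le_top
  · refine (KPOneFifth.energyTypeNorm_sq_le hχ hε1 hσ hT0.le hT.le hu hs
      (KPOneFifth.shortNormOn_ne_top hN)).trans ?_
    exact mul_le_mul' le_self_add le_rfl
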